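/- **Conventions.** Let $d_j=2j+1$. Wigner $3jm$- and $6j$-symbols are the standard ones, set to $0$ whenever a triangle or integrality condition fails (in particular if a spin is negative). Let $\mathcal F=\bigoplus_{j\in\frac12\mathbb N}\mathcal H_j$ with standard basis $|j,m\rangle$, let $D(g)$ be the action of $g\in SU(2)$ on $\mathcal F$ by the spin-$j$ representations, and let $a^A,a^{A\dagger}$ ($A=\pm\frac12$) be the operators $$a^{A}|j,m\rangle=\sqrt{j+(-1)^{\frac12-A}m}\;|j-\tfrac12,m-A\rangle,\qquad a^{A\dagger}|j,m\rangle=\sqrt{j+(-1)^{\frac12-A}m+1}\;|j+\tfrac12,m+A\rangle .$$ For six links $e_1,\dots,e_6$ consider finite combinations $T$ of tensors $\bigotimes_e |j_e,m_e\rangle\otimes\langle k_e,n_e|$; such a $T$ defines a function on $SU(2)^6$ by replacing this tensor with $\prod_e\langle k_e,n_e|D(g_e)|j_e,m_e\rangle$. The operators $a_e^A,a_e^{A\dagger}$ act on the ket of $e$; $\tilde a_e^A,\tilde a_e^{A\dagger}$ act by $a^A,a^{A\dagger}$ from the right on the bra of $e$ (so $\tilde a^A_e$ raises and $\tilde a_e^{A\dagger}$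 lowers its spin). Put $$\widehat F_{12}=\sum_A(-1)^{\frac12-A}a_1^{-A}a_2^{A},\quad \widehat E_{12}=\sum_A a_1^{A\dagger}a_2^A,\quad \widehat F_{61}=\sum_A(-1)^{\frac12-A}a_6^{-A}\tilde a_1^{A},\quad \widehat E_{16}=\sum_A\tilde a_1^{A\dagger}a_6^A,$$ $$\widehat F_{62}=\sum_A(-1)^{\frac12-A}\tilde a_6^{-A}\tilde a_2^{A},\qquad \widehat F_{26}^\dagger=\sum_A(-1)^{\frac12-A}\tilde a_6^{A\dagger}\tilde a_2^{-A\dagger},$$ and let $$\widehat H^{(--)}_{e_6e_1e_2|R}=\Bigl(\sum_{A,B}(-1)^{\frac12-A}(g_1)_{AB}\,a_6^{-A}a_2^{B}-\widehat F_{62}\Bigr)\widehat F_{26}^\dagger ,$$ where $(g_1)_{AB}=\langle\frac12,A|g_1|\frac12,B\rangle$ acts by multiplication of functions on $SU(2)^6$. The tetrahedral spin network with spins $j_1,\dots,j_6$ is $$s^{j_1\dots j_6}_{\rm tet}=\sum_{m,n}\begin{pmatrix}j_1&j_2&j_3\\m_1&m_2&m_3\end{pmatrix}\begin{pmatrix}j_1&j_5&j_6\\-n_1&-n_5&m_6\end{pmatrix}\begin{pmatrix}j_3&j_4&j_5\\-n_3&-n_4&m_5\end{pmatrix}\begin{pmatrix}j_2&j_6&j_4\\-n_2&-n_6&m_4\end{pmatrix}\prod_{e}(-1)^{j_e-n_e}\langle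 j_e,n_e|g_e|j_e,m_e\rangle .$$ Set $$A_0=(-1)^{j_2+j_4+j_6+1}\begin{Bmatrix}j_2&j_2-\frac12&\frac12\\j_6-\frac12&j_6&j_4\end{Bmatrix},$$ $$A_{\pm\frac12}=(-1)^{2j_1+j_2+j_3+j_5+j_6+\frac{\pm1+1}{2}-1}\,d_{j_1\pm\frac12}\begin{Bmatrix}j_1\pm\frac12&j_1&\frac12\\j_2&j_2-\frac12&j_3\end{Bmatrix}\begin{Bmatrix}j_1\pm\frac12&j_1&\frac12\\j_6&j_6-\frac12&j_5\end{Bmatrix},$$ $$N=(-1)^{j_2+j_4+j_6+1}\,d_{j_2}\,d_{j_2-\frac12}\,d_{j_6}\,d_{j_6-\frac12}\begin{Bmatrix}j_2&j_2-\frac12&\frac12\\j_6-\frac12&j_6&j_4\end{Bmatrix}.$$ **Proposition.** Let $j_1,\dots,j_6\in\frac12\mathbb N$ be such that $(j_1,j_2,j_3)$, $(j_1,j_5,j_6)$, $(j_3,j_4,j_5)$, $(j_2,j_6,j_4)$ satisfy the triangle inequalities and have integer sums. Then: 1. As functions on $SU(2)^6$, $$\widehat H^{(--)}_{e_6e_1e_2|R}\,s_{\rm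 tet}^{j_1\dots j_6}=\Bigl((\widehat F_{61}\widehat E_{12}+\widehat E_{16}\widehat F_{12})\tfrac1{d_{j_1}}-\widehat F_{62}\Bigr)\widehat F_{26}^\dagger\, s_{\rm tet}^{j_1\dots j_6},$$ and this equals $$N\Bigl(A_{+\frac12}\,s_{\rm tet}^{j_1+\frac12,\,j_2-\frac12,\,j_3,\,j_4,\,j_5,\,j_6-\frac12}+A_0\,s_{\rm tet}^{j_1\dots j_6}+A_{-\frac12}\,s_{\rm tet}^{j_1-\frac12,\,j_2-\frac12,\,j_3,\,j_4,\,j_5,\,j_6-\frac12}\Bigr).$$ 2. Let $$\mathcal R=A_{+\frac12}\begin{Bmatrix}j_1+\frac12&j_2-\frac12&j_3\\j_4&j_5&j_6-\frac12\end{Bmatrix}+A_0\begin{Bmatrix}j_1&j_2&j_3\\j_4&j_5&j_6\end{Bmatrix}+A_{-\frac12}\begin{Bmatrix}j_1-\frac12&j_2-\frac12&j_3\\j_4&j_5&j_6-\frac12\end{Bmatrix}.$$ At $g_1=\dots=g_6=\mathbb 1$ the value of $\widehat H^{(--)}_{e_6e_1e_2|R}s_{\rm tet}^{j_1\dots j_6}$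 is $N\,\mathcal R$; it is also equal to $\mathcal R$, because both vanish: $$\widehat H^{(--)}_{e_6e_1e_2|R}\,s_{\rm tet}^{j_1\dots j_6}\big|_{g_e=\mathbb 1}=0=\mathcal R .$$ 3. Explicitly, the recursion $\mathcal R=0$ reads $$\begin{aligned}&\sqrt{(-j_1+j_5+j_6)(j_1+j_5-j_6+1)(-j_1+j_2+j_3)(j_1-j_2+j_3+1)}\begin{Bmatrix}j_1+\frac12&j_2-\frac12&j_3\\j_4&j_5&j_6-\frac12\end{Bmatrix}\\&-d_{j_1}\sqrt{(j_2+j_6+j_4+1)(j_2+j_6-j_4)}\begin{Bmatrix}j_1&j_2&j_3\\j_4&j_5&j_6\end{Bmatrix}\\&-\sqrt{(j_1-j_5+j_6)(j_1+j_5+j_6+1)(j_1+j_2-j_3)(j_1+j_2+j_3+1)}\begin{Bmatrix}j_1-\frac12&j_2-\frac12&j_3\\j_4&j_5&j_6-\frac12\end{Bmatrix}=0.\end{aligned}$$ -/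

import Mathlib

open scoped BigOperators

noncomputable section

namespace SpinNet

/-! Spins and magnetic numbers are given by their doubles: an integer `J` stands for the
spin `j = J / 2`, and an integer `M` for the magnetic number `m = M / 2`. -/

/-- The spin `j = J / 2`. -/
def spin (J : ℤ) : ℝ := (J : ℝ) / 2

/-- The dimension `d_j = 2 j + 1`. -/
def dim (J : ℤ) : ℝ := (J : ℝ) + 1

/-- The phase `(-1) ^ n`. -/
def phase (n : ℤ) : ℝ := (-1 : ℝ) ^ n

/-- The spins `a/2, b/2, c/2` satisfy the triangle inequalities and have an integer sum.
(The inequalities force all three to be nonnegative.) -/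
def Triad (a b c : ℤ) : Prop :=
  Even (a + b + c) ∧ a ≤ b + c ∧ b ≤ a + c ∧ c ≤ a + b

/-- `n !` for `n ≥ 0`. -/
def fact (n : ℤ) : ℝ := (n.toNat.factorial : ℝ)

/-- `1 / n !`, with value `0` for negative `n`. -/
def invFact (n : ℤ) : ℝ := if n < 0 then 0 else 1 / fact n

open Classical in
/-- The Wigner 3jm-symbol with spins `a/2, b/2, c/2` and magnetic numbers `x/2, y/2, z/2`
(Racah's formula); it is `0` unless the spins form a triad, the magnetic numbers are
admissible for them, and they sum to `0`. -/
def threeJ (a b c x y z : ℤ) : ℝ :=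
  if Triad a b c ∧ x + y + z = 0 ∧ |x| ≤ a ∧ |y| ≤ b ∧ |z| ≤ c ∧
      Even (a - x) ∧ Even (b - y) ∧ Even (c - z) then
    phase ((a - b - z) / 2) *
    √(fact ((a + b - c) / 2) * fact ((a - b + c) / 2) * fact ((-a + b + c) / 2) /
        fact ((a + b + c) / 2 + 1)) *
    √(fact ((a + x) / 2) * fact ((a - x) / 2) * fact ((b + y) / 2) * fact ((b - y) / 2) *
        fact ((c + z) / 2) * fact ((c - z) / 2)) *
    ∑ t ∈ Finset.range ((a + b - c) / 2 + 1).toNat,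
      (-1 : ℝ) ^ t * invFact t * invFact ((c - b + x) / 2 + t) * invFact ((c - a - y) / 2 + t) *
        invFact ((a + b - c) / 2 - t) * invFact ((a - x) / 2 - t) * invFact ((b + y) / 2 - t)
  else 0

/-- The Wigner 6j-symbol `{J₁ J₂ J₃; J₄ J₅ J₆}` (doubled spins), as the tetrahedral
contraction of four 3jm-symbols. The summation index `k i` is `j_i + m_i`, it runs over
`0, …, 2 j_i`; so `M i = 2 m_i` and `J i - k i = j_i - m_i`. -/
def sixJ (J₁ J₂ J₃ J₄ J₅ J₆ : ℤ) : ℝ :=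
  let J : Fin 6 → ℤ := ![J₁, J₂, J₃, J₄, J₅, J₆]
  ∑ k ∈ Fintype.piFinset (fun i : Fin 6 => Finset.range (J i + 1).toNat),
    let M : Fin 6 → ℤ := fun i => 2 * (k i : ℤ) - J i
    phase (∑ i, (J i - k i)) *
      threeJ J₁ J₂ J₃ (-M 0) (-M 1) (-M 2) * threeJ J₁ J₅ J₆ (M 0) (-M 4) (M 5) *
      threeJ J₄ J₂ J₆ (M 3) (M 1) (-M 5) * threeJ J₄ J₅ J₃ (-M 3) (M 4) (M 2)

/-! ### The bosonic state space of the tetrahedral graph -/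

/-- Occupation numbers of the two oscillators of one half-link: `ν 0 = n⁻`, `ν 1 = n⁺`.
They label the standard basis `|j, m⟩` of `⨁_j H_j` through `j = (n⁺ + n⁻)/2`,
`m = (n⁺ - n⁻)/2`. The spinor index `A = -1/2` is `0 : Fin 2` and `A = +1/2` is
`1 : Fin 2`. -/
abbrev Occ := Fin 2 → ℕ

/-- The half-links. The link `e_{i+1}` has index `i : Fin 6`; its source half is `Sum.inl i`,
its target half is `Sum.inr i`. -/
abbrev Leg := Fin 6 ⊕ Fin 6

/-- The link to which a half-link belongs. -/
def Leg.link (l : Leg) : Fin 6 := Sum.elim id id l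

/-- Finite combinations of basis tensors. The configuration `c` stands for
`⨂_e |j_e, m_e⟩ ⊗ ⟨k_e, n_e|`, with the ket at the source of `e` labelled by `c (Sum.inl e)`
and the bra at its target labelled by `c (Sum.inr e)`. -/
abbrev State := (Leg → Occ) →₀ ℂ

/-- Remove one quantum of type `A` on the half-link `l`, with weight `√n`. -/
def lower (l : Leg) (A : Fin 2) : State →ₗ[ℂ] State :=
  Finsupp.linearCombination ℂ fun c : Leg → Occ =>
    Finsupp.single (Function.update c l (Function.update (c l) A (c l A - 1)))
      ((√(c l A : ℝ) : ℝ) : ℂ)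

/-- Add one quantum of type `A` on the half-link `l`, with weight `√(n + 1)`. -/
def raise (l : Leg) (A : Fin 2) : State →ₗ[ℂ] State :=
  Finsupp.linearCombination ℂ fun c : Leg → Occ =>
    Finsupp.single (Function.update c l (Function.update (c l) A (c l A + 1)))
      ((√((c l A : ℝ) + 1) : ℝ) : ℂ)

/-- `a_e^A` at the source of the link `e`. -/
def a (e : Fin 6) (A : Fin 2) : State →ₗ[ℂ] State := lower (Sum.inl e) A

/-- `a_e^{A†}` at the source of the link `e`. -/
def aDag (e : Fin 6) (A : Fin 2) : State →ₗ[ℂ] State := raise (Sum.inl e) A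

/-- `ã_e^A` at the target of the link `e`. It acts on the right, i.e. on the bra:
`⟨n| a^A = √(n_A + 1) ⟨n + 1_A|`, so it adds a quantum. -/
def aTilde (e : Fin 6) (A : Fin 2) : State →ₗ[ℂ] State := raise (Sum.inr e) A

/-- `ã_e^{A†}` at the target of the link `e`. It acts on the right, i.e. on the bra:
`⟨n| a^{A†} = √(n_A) ⟨n - 1_A|`, so it removes a quantum. -/
def aTildeDag (e : Fin 6) (A : Fin 2) : State →ₗ[ℂ] State := lower (Sum.inr e) A

/-- The sign `(-1)^{1/2 - A}`. -/
def eps (A : Fin 2) : ℂ := ![-1, 1] A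

/-! The invariant contractions. `Fin.rev A` is the spinor index `-A`. -/

/-- `F̂₁₂ = [a₁|a₂⟩`. -/
def F12 : State →ₗ[ℂ] State := ∑ A, eps A • (a 0 (Fin.rev A) ∘ₗ a 1 A)

/-- `Ê₁₂ = ⟨a₁|a₂⟩`. -/
def E12 : State →ₗ[ℂ] State := ∑ A, aDag 0 A ∘ₗ a 1 A

/-- `F̂₆₁ = [a₆|ã₁⟩`. -/
def F61 : State →ₗ[ℂ] State := ∑ A, eps A • (a 5 (Fin.rev A) ∘ₗ aTilde 0 A)

/-- `Ê₁₆ = ⟨ã₁|a₆⟩`. -/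
def E16 : State →ₗ[ℂ] State := ∑ A, aTildeDag 0 A ∘ₗ a 5 A

/-- `F̂₆₂ = [ã₆|ã₂⟩`. -/
def F62 : State →ₗ[ℂ] State := ∑ A, eps A • (aTilde 5 (Fin.rev A) ∘ₗ aTilde 1 A)

/-- `F̂₂₆† = ⟨ã₆|ã₂]`. -/
def F26Dag : State →ₗ[ℂ] State := ∑ A, eps A • (aTildeDag 5 A ∘ₗ aTildeDag 1 (Fin.rev A))

/-- The diagonal operator `1 / d_{j₁}`, where `2 j₁` is the number of quanta at the source of
the first link. -/
def invDim1 : State →ₗ[ℂ] State :=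
  Finsupp.linearCombination ℂ fun c : Leg → Occ =>
    Finsupp.single c (1 / ((c (Sum.inl 0) 0 : ℂ) + (c (Sum.inl 0) 1 : ℂ) + 1))

/-! ### Holonomies and functions on `SU(2)^6` -/

/-- The group `SU(2)`; rows and columns are indexed by `A = -1/2, +1/2` in this order. -/
abbrev SU2 := Matrix.specialUnitaryGroup (Fin 2) ℂ

/-- The matrix element `⟨p|D(g)|n⟩` between occupation number states of the action of `g` on
`⨁_j H_j`, where `D(g) |n⟩ = ∏_B (∑_A g_{AB} a^{A†})^{n_B} / √(n_B !) |0⟩`. It is the Wigner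
matrix element `⟨j, m'|g|j, m⟩` if `p` and `n` have the same spin `j`, and `0` otherwise. -/
def wignerD (g : SU2) (p n : Occ) : ℂ :=
  ((√((p 0).factorial * (p 1).factorial : ℝ) / √((n 0).factorial * (n 1).factorial : ℝ) : ℝ) : ℂ) *
    MvPolynomial.coeff (Finsupp.equivFunOnFinite.symm p)
      (∏ B, (∑ A, MvPolynomial.C (g.1 A B) * MvPolynomial.X A) ^ n B : MvPolynomial (Fin 2) ℂ)

/-- The function on `SU(2)^6` defined by a state: each link carries `⟨k_e, n_e|g_e|j_e, m_e⟩`. -/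
def eval (T : State) (g : Fin 6 → SU2) : ℂ :=
  T.sum fun c x => x * ∏ e, wignerD (g e) (c (Sum.inr e)) (c (Sum.inl e))

/-- The tetrahedral spin network with doubled spins `J`, as a state. On the half-link `l`,
`k l` is the number `n⁺` and `M l` is twice the magnetic number: `M (Sum.inl i)` is
`2 m_{i+1}` and `M (Sum.inr i)` is `2 n_{i+1}`. -/
def tetState (J : Fin 6 → ℤ) : State :=
  ∑ k ∈ Fintype.piFinset (fun l : Leg => Finset.range (J l.link + 1).toNat),
    let M : Leg → ℤ := fun l => 2 * (k l : ℤ) - J l.link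
    Finsupp.single (fun l => ![(J l.link - k l).toNat, k l])
      ((phase (∑ e, (J e - k (Sum.inr e))) *
        threeJ (J 0) (J 1) (J 2) (M (Sum.inl 0)) (M (Sum.inl 1)) (M (Sum.inl 2)) *
        threeJ (J 0) (J 4) (J 5) (-M (Sum.inr 0)) (-M (Sum.inr 4)) (M (Sum.inl 5)) *
        threeJ (J 2) (J 3) (J 4) (-M (Sum.inr 2)) (-M (Sum.inr 3)) (M (Sum.inl 4)) *
        threeJ (J 1) (J 5) (J 3) (-M (Sum.inr 1)) (-M (Sum.inr 5)) (M (Sum.inl 3)) : ℝ) : ℂ)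

/-- The tetrahedral spin network function `s_tet^{j₁ … j₆}(g₁, …, g₆)`. -/
def sTet (J₁ J₂ J₃ J₄ J₅ J₆ : ℤ) (g : Fin 6 → SU2) : ℂ :=
  eval (tetState ![J₁, J₂, J₃, J₄, J₅, J₆]) g

/-- `Ĥ^{(--)}_{e₆e₁e₂|R} = ([a₆|g₁|a₂⟩ - [ã₆|ã₂⟩) ⟨ã₆|ã₂]` on a state, as a function on
`SU(2)^6`; the matrix elements of `g₁` act by multiplication. -/
def hamR (T : State) (g : Fin 6 → SU2) : ℂ :=
  (∑ A, ∑ B, eps A * (g 0).1 A B * eval (a 5 (Fin.rev A) (a 1 B (F26Dag T))) g) -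
    eval (F62 (F26Dag T)) g

/-- The same Hamiltonian written with spin-1/2 graspings only:
`((F̂₆₁ Ê₁₂ + Ê₁₆ F̂₁₂) (1/d_{j₁}) - F̂₆₂) F̂₂₆†`. -/
def graspR : State →ₗ[ℂ] State :=
  ((F61 ∘ₗ E12 + E16 ∘ₗ F12) ∘ₗ invDim1 - F62) ∘ₗ F26Dag

/-! ### The coefficients. The labels `α, β, σ` are doubled too: `±1` stands for `±1/2`. -/

/-- `A₀^{(α,β)}`. -/
def coeffA0 (α β J₂ J₄ J₆ : ℤ) : ℝ :=
  phase ((J₂ + J₄ + J₆) / 2 + 1) * sixJ J₂ (J₂ + β) 1 (J₆ + α) J₆ J₄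

/-- `A_{σ}^{(α,β)}` for `σ = ±1/2`. -/
def coeffA (α β σ J₁ J₂ J₃ J₅ J₆ : ℤ) : ℝ :=
  phase ((2 * J₁ + J₂ + J₃ + J₅ + J₆) / 2 + (σ + 1) / 2 + (α + β) / 2) * dim (J₁ + σ) *
    sixJ (J₁ + σ) J₁ 1 J₂ (J₂ + β) J₃ * sixJ (J₁ + σ) J₁ 1 J₆ (J₆ + α) J₅

/-- The overall factor
`(-1)^{j₂+j₄+j₆+1} d_{j₂} d_{j₂-1/2} d_{j₆} d_{j₆-1/2} {j₂ j₂-1/2 1/2; j₆-1/2 j₆ j₄}`. -/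
def overall (J₂ J₄ J₆ : ℤ) : ℝ :=
  phase ((J₂ + J₄ + J₆) / 2 + 1) * dim J₂ * dim (J₂ - 1) * dim J₆ * dim (J₆ - 1) *
    sixJ J₂ (J₂ - 1) 1 (J₆ - 1) J₆ J₄

end SpinNet

end

/-! One half-link carries the Fock space of two oscillators, so a 3jm-symbol is a vector in the Fock
space of six. On polynomials with Bargmann's inner product it is, up to its norm, the product of
brackets `[z₁|z₂⟩^α [z₂|z₃⟩^β [z₃|z₁⟩^γ` (`vertex_eq_wave`, `bargmann_bracketProd`). Annihilators
differentiate and creators multiply. A spin-1/2 grasping of two legs therefore sends such a product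
to an integer multiple of another one, and normalisation turns the integer into the familiar square
roots (`lowerPair_vertex`, `raisePair_vertex`, `transfer_vertex` and their variants).

In the tetrahedral state every ladder operator touches a single vertex, up to a sign when it acts on
a bra. Hence `graspR_tetState` just multiplies vertex factors. The coefficients of the proposition
are 6j-symbols with a spin 1/2, and the same graspings evaluate them: the sum over the spin-1/2 line
is a grasping of one vertex, after which only the norm of a 3jm-symbol is left (`sixJ_raise_lower`,
`sixJ_lower_lower`).

Multiplication by a matrix element of `g₁` decomposes spin `1/2 ⊗ j` into `j ± 1/2`; with ladder
operators this is a polynomial identity that needs only `det g = 1` (`mul_wignerD`). It gives the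
grasping form of the Hamiltonian on every state (`hamR_eq_eval_graspR`).

At the identity, an annihilator on a ket equals the same operator acting from the right on the bra,
so the two terms of the Hamiltonian cancel on every state (`hamR_one`), while the spin network
becomes a 6j-symbol (`eval_tetState_one`). This yields `N R = 0`. The factor `N` vanishes when `j₄ =
j₂ + j₆`, but then both shifted 6j-symbols and the middle root vanish too, so the recursion holds in
all cases (`sixJ_recursion`), and with it `R = 0` (`coeff_sixJ_eq_zero`). -/

noncomputable section

namespace SpinNet

set_option linter.unusedSimpArgs false
set_option linter.unusedSectionVars false

/-! ### Products of brackets and the differential operators acting on them -/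

section

open MvPolynomial

/-- Polynomials in the spinor variables of the three legs of a vertex. -/
abbrev Poly := MvPolynomial (Fin 3 × Fin 2) ℝ

/-- The bracket `[z_i|z_j⟩`. -/
def bracket (i j : Fin 3) : Poly := X (i, 1) * X (j, 0) - X (i, 0) * X (j, 1)

/-- The second-order operator dual to `bracket i j`. -/
def bracketDual (i j : Fin 3) (P : Poly) : Poly :=
  pderiv (i, 0) (pderiv (j, 1) P) - pderiv (i, 1) (pderiv (j, 0) P)

/-- The Euler operator of the leg `i`. -/
def euler (i : Fin 3) : Derivation ℝ Poly Poly :=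
  (X (i, 0) : Poly) • pderiv (i, 0) + (X (i, 1) : Poly) • pderiv (i, 1)

lemma euler_apply (i : Fin 3) (P : Poly) :
    euler i P = X (i, 0) * pderiv (i, 0) P + X (i, 1) * pderiv (i, 1) P := by
  simp [euler]

/-- An `sl₂`-type commutator: bracket and dual bracket commute up to the two Euler operators. It
reduces the action on powers of a bracket to a count of degrees. -/
lemma bracketDual_bracket_mul {i j : Fin 3} (h : i ≠ j) (P : Poly) :
    bracketDual i j (bracket i j * P) =
      bracket i j * bracketDual i j P - (euler i P + euler j P + 2 * P) := by
  have h' := h.symm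
  simp [bracketDual, bracket, euler_apply, pderiv_mul, pderiv_X, Pi.single_apply, h, h']
  ring

lemma derivation_pow_of_eigen (D : Derivation ℝ Poly Poly) {P : Poly} {c : ℝ}
    (h : D P = C c * P) (n : ℕ) : D (P ^ n) = C (n * c) * P ^ n := by
  induction n with
  | zero => simp
  | succ n ih =>
    rw [pow_succ, D.leibniz, ih, h]
    simp only [smul_eq_mul, Nat.cast_succ, map_add, map_mul, map_one]
    ring

lemma euler_bracket_left {i j : Fin 3} (h : i ≠ j) : euler i (bracket i j) = C 1 * bracket i j := by
  have h' := h.symm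
  simp [bracket, euler_apply, pderiv_mul, pderiv_X, Pi.single_apply, h, h']
  ring

lemma euler_bracket_right {i j : Fin 3} (h : i ≠ j) :
    euler j (bracket i j) = C 1 * bracket i j := by
  have h' := h.symm
  simp [bracket, euler_apply, pderiv_mul, pderiv_X, Pi.single_apply, h, h']
  ring

lemma euler_bracket_of_ne {i j k : Fin 3} (h : k ≠ i) (h' : k ≠ j) :
    euler k (bracket i j) = C 0 * bracket i j := by
  simp [bracket, euler_apply, pderiv_mul, pderiv_X, Pi.single_apply, h.symm, h'.symm]

/-- The product of brackets which represents the invariant of a vertex. -/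
def bracketProd (i j k : Fin 3) (α β γ : ℕ) : Poly :=
  bracket i j ^ α * (bracket j k ^ β * bracket k i ^ γ)

lemma euler_bracketProd_fst {i j k : Fin 3} (hij : i ≠ j) (_ : j ≠ k) (hki : k ≠ i)
    (α β γ : ℕ) :
    euler i (bracketProd i j k α β γ) = C (α + γ : ℝ) * bracketProd i j k α β γ := by
  simp only [bracketProd, Derivation.leibniz,
    derivation_pow_of_eigen _ (euler_bracket_left hij),
    derivation_pow_of_eigen _ (euler_bracket_right hki),
    derivation_pow_of_eigen _ (euler_bracket_of_ne hij hki.symm), smul_eq_mul, map_add]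
  simp
  ring

lemma euler_bracketProd_snd {i j k : Fin 3} (hij : i ≠ j) (hjk : j ≠ k) (_ : k ≠ i)
    (α β γ : ℕ) :
    euler j (bracketProd i j k α β γ) = C (α + β : ℝ) * bracketProd i j k α β γ := by
  simp only [bracketProd, Derivation.leibniz,
    derivation_pow_of_eigen _ (euler_bracket_right hij),
    derivation_pow_of_eigen _ (euler_bracket_left hjk),
    derivation_pow_of_eigen _ (euler_bracket_of_ne hjk hij.symm), smul_eq_mul, map_add]
  simp
  ring

/-- The two derivatives hit `[k i]` and `[j k]` once each and leave the antisymmetric contraction of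
`z_k` with itself. -/
lemma bracketDual_bracketProd_zero {i j k : Fin 3} (hij : i ≠ j) (hjk : j ≠ k) (hki : k ≠ i)
    (β γ : ℕ) :
    bracketDual i j (bracketProd i j k 0 β γ) = 0 := by
  have h1 := hij.symm
  have h2 := hjk.symm
  have h3 := hki.symm
  simp [bracketDual, bracketProd, pderiv_mul, pderiv_pow, bracket, pderiv_X, Pi.single_apply,
    hij, hjk, hki, h1, h2, h3]
  ring

/-- Commuting the dual bracket past one more factor `[i j]` adds `-(2α + β + γ + 2)`, read off from
the degrees in `z_i` and `z_j`. These contributions sum to the stated product. -/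
lemma bracketDual_bracketProd {i j k : Fin 3} (hij : i ≠ j) (hjk : j ≠ k) (hki : k ≠ i)
    (α β γ : ℕ) :
    bracketDual i j (bracketProd i j k (α + 1) β γ) =
      C (-((α + 1) * (α + β + γ + 2)) : ℝ) * bracketProd i j k α β γ := by
  have key : ∀ α, bracketProd i j k (α + 1) β γ = bracket i j * bracketProd i j k α β γ := by
    intro α; simp only [bracketProd]; ring
  induction α with
  | zero =>
    rw [key, bracketDual_bracket_mul hij, bracketDual_bracketProd_zero hij hjk hki,
      euler_bracketProd_fst hij hjk hki, euler_bracketProd_snd hij hjk hki]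
    simp only [map_neg, map_mul, map_add, map_one, map_natCast, Nat.cast_zero, map_zero, map_ofNat]
    ring
  | succ α ih =>
    rw [key, bracketDual_bracket_mul hij, ih,
      euler_bracketProd_fst hij hjk hki, euler_bracketProd_snd hij hjk hki, key]
    simp only [map_neg, map_mul, map_add, map_one, map_natCast, Nat.cast_succ, map_zero, map_ofNat]
    ring

/-- Moving one quantum from leg `j` to leg `i`. -/
lemma transfer_bracketProd {i j k : Fin 3} (hij : i ≠ j) (hjk : j ≠ k) (hki : k ≠ i)
    (α β γ : ℕ) :
    X (i, 0) * pderiv (j, 0) (bracketProd i j k α β γ) +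
        X (i, 1) * pderiv (j, 1) (bracketProd i j k α β γ) =
      C (-(β : ℝ)) * bracketProd i j k α (β - 1) (γ + 1) := by
  have h1 := hij.symm
  have h2 := hjk.symm
  have h3 := hki.symm
  -- The operator is the derivation replacing `z_j` by `z_i`: it kills `[i j]` and turns `[j k]`
  -- into `-[k i]`. For `β = 0` the truncated exponent is harmless because the coefficient vanishes.
  simp [bracketProd, pderiv_mul, pderiv_pow, bracket, pderiv_X, Pi.single_apply,
    hij, hjk, hki, h1, h2, h3]
  ring

/-- Moving one quantum from leg `i` to leg `j`. -/
lemma transfer_bracketProd' {i j k : Fin 3} (hij : i ≠ j) (hjk : j ≠ k) (hki : k ≠ i)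
    (α β γ : ℕ) :
    X (j, 0) * pderiv (i, 0) (bracketProd i j k α β γ) +
        X (j, 1) * pderiv (i, 1) (bracketProd i j k α β γ) =
      C (-(γ : ℝ)) * bracketProd i j k α (β + 1) (γ - 1) := by
  have h1 := hij.symm
  have h2 := hjk.symm
  have h3 := hki.symm
  simp [bracketProd, pderiv_mul, pderiv_pow, bracket, pderiv_X, Pi.single_apply,
    hij, hjk, hki, h1, h2, h3]
  ring

/-! ### The Bargmann inner product -/

/-- The squared norm of a monomial. -/
def monoNorm (n : (Fin 3 × Fin 2) →₀ ℕ) : ℝ := ∏ x, ((n x).factorial : ℝ)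

lemma monoNorm_add_single (n : (Fin 3 × Fin 2) →₀ ℕ) (i : Fin 3 × Fin 2) :
    monoNorm (n + Finsupp.single i 1) = (n i + 1) * monoNorm n := by
  simp only [monoNorm]
  rw [← Finset.mul_prod_erase _ _ (Finset.mem_univ i),
    ← Finset.mul_prod_erase (a := i) _ (fun x => ((n x).factorial : ℝ)) (Finset.mem_univ i)]
  rw [Finset.prod_congr rfl (g := fun x => ((n x).factorial : ℝ))]
  · simp [Nat.factorial_succ, mul_assoc]
  · intro x hx
    simp [(Finset.ne_of_mem_erase hx).symm]

/-- Bargmann's pairing `⟨P, Q⟩` as a linear function of `P`. -/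
def bargmann (Q : Poly) : Poly →ₗ[ℝ] ℝ :=
  (basisMonomials (Fin 3 × Fin 2) ℝ).constr ℝ fun n => coeff n Q * monoNorm n

lemma bargmann_monomial (Q : Poly) (n : (Fin 3 × Fin 2) →₀ ℕ) :
    bargmann Q (monomial n 1) = coeff n Q * monoNorm n := by
  have := (basisMonomials (Fin 3 × Fin 2) ℝ).constr_basis ℝ (fun n => coeff n Q * monoNorm n) n
  simpa [bargmann, coe_basisMonomials] using this

lemma bargmann_apply (P Q : Poly) :
    bargmann Q P = ∑ n ∈ P.support, coeff n P * coeff n Q * monoNorm n := by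
  conv_lhs => rw [P.as_sum]
  rw [map_sum]
  refine Finset.sum_congr rfl fun n _ => ?_
  have : monomial n (coeff n P) = coeff n P • (monomial n 1 : Poly) := by simp [smul_monomial]
  rw [this, map_smul, bargmann_monomial, smul_eq_mul, mul_assoc]

/-- Multiplication and differentiation are adjoint: on monomials both sides pick up the same factor
`n i + 1`, once from the norm and once from the derivative. -/
lemma bargmann_X_mul (i : Fin 3 × Fin 2) (P Q : Poly) :
    bargmann Q (X i * P) = bargmann (pderiv i Q) P := by
  have h : bargmann Q ∘ₗ LinearMap.mulLeft ℝ (X i) = bargmann (pderiv i Q) := by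
    refine (basisMonomials (Fin 3 × Fin 2) ℝ).ext fun n => ?_
    simp only [coe_basisMonomials, LinearMap.comp_apply, LinearMap.mulLeft_apply]
    rw [X, monomial_mul, one_mul, bargmann_monomial, bargmann_monomial, coeff_pderiv]
    rw [add_comm (Finsupp.single i 1) n, monoNorm_add_single]
    ring
  simpa using LinearMap.congr_fun h P

/-- The minus sign comes from the opposite order of the two terms in `bracket` and `bracketDual`. -/
lemma bargmann_bracket_mul (i j : Fin 3) (P Q : Poly) :
    bargmann Q (bracket i j * P) = - bargmann (bracketDual i j Q) P := by
  have h : ∀ Q₁ Q₂ : Poly, bargmann (Q₁ - Q₂) P = bargmann Q₁ P - bargmann Q₂ P := by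
    intro Q₁ Q₂
    simp [bargmann_apply, mul_sub, sub_mul, Finset.sum_sub_distrib]
  rw [bracket, mul_comm (X (i, 1)), mul_comm (X (i, 0)), sub_mul, map_sub, mul_assoc, mul_assoc,
    bargmann_X_mul, bargmann_X_mul, bargmann_X_mul, bargmann_X_mul, bracketDual, h]
  ring

lemma bargmann_bracketProd_succ {i j k : Fin 3} (hij : i ≠ j) (hjk : j ≠ k) (hki : k ≠ i)
    (α β γ : ℕ) :
    bargmann (bracketProd i j k (α + 1) β γ) (bracketProd i j k (α + 1) β γ) =
      (α + 1) * (α + β + γ + 2) *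
        bargmann (bracketProd i j k α β γ) (bracketProd i j k α β γ) := by
  have key : bracketProd i j k (α + 1) β γ = bracket i j * bracketProd i j k α β γ := by
    simp only [bracketProd]; ring
  conv_lhs => enter [2]; rw [key]
  rw [bargmann_bracket_mul, bracketDual_bracketProd hij hjk hki, ← smul_eq_C_mul]
  simp only [bargmann_apply, coeff_smul, smul_eq_mul, Finset.mul_sum, ← Finset.sum_neg_distrib]
  exact Finset.sum_congr rfl fun n _ => by ring

lemma bracketProd_zero_rotate (i j k : Fin 3) (β γ : ℕ) :
    bracketProd i j k 0 β γ = bracketProd j k i β γ 0 := by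
  simp [bracketProd]

/-- Adjointness removes one bracket `[i j]` at a time at the cost `(α + 1)(α + β + γ + 2)`, so the
norm is a product of factorials. -/
lemma bargmann_bracketProd {i j k : Fin 3} (hij : i ≠ j) (hjk : j ≠ k) (hki : k ≠ i)
    (α β γ : ℕ) :
    bargmann (bracketProd i j k α β γ) (bracketProd i j k α β γ) =
      α.factorial * β.factorial * γ.factorial * (α + β + γ + 1).factorial := by
  induction α with
  | succ α ih =>
    rw [bargmann_bracketProd_succ hij hjk hki, ih,
      show α + 1 + β + γ + 1 = (α + β + γ + 1) + 1 by ring,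
      Nat.factorial_succ α, Nat.factorial_succ (α + β + γ + 1)]
    push_cast; ring
  | zero =>
    -- Once an exponent is used up, a cyclic rotation puts the next bracket in front.
    rw [bracketProd_zero_rotate]
    induction β with
    | succ β ih =>
      rw [bargmann_bracketProd_succ hjk hki hij, ih,
        show 0 + (β + 1) + γ + 1 = (0 + β + γ + 1) + 1 by ring,
        Nat.factorial_succ β, Nat.factorial_succ (0 + β + γ + 1)]
      push_cast; ring
    | zero =>
      rw [bracketProd_zero_rotate]
      induction γ with
      | succ γ ih =>
        rw [bargmann_bracketProd_succ hki hij hjk, ih,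
          show 0 + 0 + (γ + 1) + 1 = (0 + 0 + γ + 1) + 1 by ring,
          Nat.factorial_succ γ, Nat.factorial_succ (0 + 0 + γ + 1)]
        push_cast; ring
      | zero =>
        have h1 : (1 : Poly) = monomial 0 1 := rfl
        simp only [bracketProd, pow_zero, mul_one]
        conv_lhs => enter [2]; rw [h1]
        rw [bargmann_monomial]
        simp [monoNorm]

end

/-! ### Ladder operators in the orthonormal basis of monomials -/

section

open MvPolynomial

/-- The exponent of the monomial with the occupation numbers `n`. -/
def occExp (n : Fin 3 → Occ) : (Fin 3 × Fin 2) →₀ ℕ :=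
  Finsupp.equivFunOnFinite.symm fun x => n x.1 x.2

@[simp] lemma occExp_apply (n : Fin 3 → Occ) (x : Fin 3 × Fin 2) : occExp n x = n x.1 x.2 := rfl

/-- The coefficients of a polynomial in the orthonormal basis of monomials. -/
def wave (P : Poly) (n : Fin 3 → Occ) : ℝ := √(monoNorm (occExp n)) * coeff (occExp n) P

/-- Remove one quantum of type `A` on the leg `i` of a vertex. -/
def legLower (i : Fin 3) (A : Fin 2) (f : (Fin 3 → Occ) → ℝ) (n : Fin 3 → Occ) : ℝ :=
  √((n i A : ℝ) + 1) * f (Function.update n i (Function.update (n i) A (n i A + 1)))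

/-- Add one quantum of type `A` on the leg `i` of a vertex. -/
def legRaise (i : Fin 3) (A : Fin 2) (f : (Fin 3 → Occ) → ℝ) (n : Fin 3 → Occ) : ℝ :=
  √(n i A : ℝ) * f (Function.update n i (Function.update (n i) A (n i A - 1)))

lemma occExp_update_succ (n : Fin 3 → Occ) (i : Fin 3) (A : Fin 2) :
    occExp (Function.update n i (Function.update (n i) A (n i A + 1))) =
      occExp n + Finsupp.single (i, A) 1 := by
  ext ⟨j, B⟩
  by_cases h : j = i
  · subst h
    by_cases h' : B = A
    · subst h'; simp
    · simp [h', Ne.symm h']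
  · simp [h, Finsupp.single_apply, Ne.symm h]

/-- The weight `√(n + 1)` and the root `√(n + 1)` by which the norm of the monomial grows combine to
the factor `n + 1` of a derivative. -/
lemma legLower_wave (i : Fin 3) (A : Fin 2) (P : Poly) :
    legLower i A (wave P) = wave (pderiv (i, A) P) := by
  funext n
  simp only [legLower, wave, occExp_update_succ, monoNorm_add_single, coeff_pderiv, occExp_apply]
  rw [Real.sqrt_mul (by positivity)]
  have := Real.mul_self_sqrt (show (0 : ℝ) ≤ n i A + 1 by positivity)
  linear_combination (√(monoNorm (occExp n)) * coeff (occExp n + Finsupp.single (i, A) 1) P) * this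

lemma legRaise_wave (i : Fin 3) (A : Fin 2) (P : Poly) :
    legRaise i A (wave P) = wave (X (i, A) * P) := by
  funext n
  -- An empty mode needs separate care, since the subtraction in `legRaise` is truncated there; the
  -- weight is then zero.
  by_cases h : n i A = 0
  · have : (i, A) ∉ (occExp n).support := by simp [h]
    simp [legRaise, wave, coeff_X_mul', h]
  · set m := Function.update n i (Function.update (n i) A (n i A - 1)) with hm
    have hn : n = Function.update m i (Function.update (m i) A (m i A + 1)) := by
      simp [hm, Nat.sub_add_cancel (Nat.pos_of_ne_zero h)]
    have hA : (n i A : ℝ) = m i A + 1 := by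
      rw [hm]; simp [Nat.cast_sub (Nat.pos_of_ne_zero h)]
    simp only [legRaise, ← hm, hA]
    rw [hn]
    simp only [wave, occExp_update_succ, monoNorm_add_single, occExp_apply]
    rw [add_comm (occExp m), coeff_X_mul, Real.sqrt_mul (by positivity)]
    ring

lemma wave_add (P Q : Poly) : wave (P + Q) = wave P + wave Q := by
  funext n; simp [wave, mul_add]

lemma wave_sub (P Q : Poly) : wave (P - Q) = wave P - wave Q := by
  funext n; simp [wave, mul_sub]

lemma wave_C_mul (c : ℝ) (P : Poly) : wave (C c * P) = c • wave P := by
  funext n; simp [wave]; ring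

/-! ### Expansion of the product of brackets -/

/-- The exponent of the monomial `(z_i^- z_j^+)^t (z_i^+ z_j^-)^s`. -/
def pairExp (i j : Fin 3) (t s : ℕ) : (Fin 3 × Fin 2) →₀ ℕ :=
  Finsupp.single (i, 0) t + Finsupp.single (j, 1) t + Finsupp.single (i, 1) s +
    Finsupp.single (j, 0) s

/-- The binomial theorem, written with `invFact` so that its terms match those of Racah's formula.
-/
lemma bracket_pow (i j : Fin 3) (α : ℕ) :
    bracket i j ^ α = ∑ t ∈ Finset.range (α + 1),
      monomial (pairExp i j t (α - t))
        ((α.factorial : ℝ) * ((-1) ^ t * invFact t * invFact ((α : ℤ) - t))) := by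
  have h : bracket i j = -(X (i, 0) * X (j, 1)) + X (i, 1) * X (j, 0) := by
    simp only [bracket]; ring
  rw [h, add_pow]
  refine Finset.sum_congr rfl fun t ht => ?_
  have ht' : t ≤ α := by simpa [Nat.lt_succ_iff] using ht
  have hc : (α.factorial : ℝ) * ((-1) ^ t * invFact t * invFact ((α : ℤ) - t)) =
      (-1) ^ t * (α.choose t : ℝ) := by
    have h1 : ¬ ((α : ℤ) - t < 0) := by omega
    have h2 : ((α : ℤ) - t).toNat = α - t := by omega
    have h0 : ¬ ((t : ℤ) < 0) := by omega
    simp only [invFact, h0, h1, fact, h2, Nat.cast_choose ℝ ht', if_false, Int.toNat_natCast]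
    field_simp
  rw [hc, pairExp, neg_pow, mul_pow, mul_pow]
  simp only [X_pow_eq_monomial]
  have h3 : ((-1 : Poly) ^ t) = C ((-1) ^ t) := by simp
  have h4 : ((α.choose t : ℕ) : Poly) = C (α.choose t : ℝ) := by simp
  rw [h3, h4]
  simp only [monomial_mul, C_mul_monomial, mul_comm _ (C (α.choose t : ℝ))]
  congr 1
  · rw [← add_assoc]
  · ring

/-- The indices `t`, `u`, `v` count how often the negative term of each of the three brackets is
chosen; the six equations compare exponents. -/
lemma coeff_bracketProd (n : Fin 3 → Occ) (α β γ : ℕ) :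
    coeff (occExp n) (bracketProd 0 1 2 α β γ) =
      (α.factorial * β.factorial * γ.factorial : ℝ) *
      ∑ t ∈ Finset.range (α + 1), ∑ u ∈ Finset.range (β + 1), ∑ v ∈ Finset.range (γ + 1),
        if n 0 0 = t + (γ - v) ∧ n 0 1 = (α - t) + v ∧ n 1 0 = (α - t) + u ∧
            n 1 1 = t + (β - u) ∧ n 2 0 = v + (β - u) ∧ n 2 1 = (γ - v) + u then
          ((-1) ^ t * invFact t * invFact ((α : ℤ) - t)) *
          ((-1) ^ u * invFact u * invFact ((β : ℤ) - u)) *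
          ((-1) ^ v * invFact v * invFact ((γ : ℤ) - v)) else 0 := by
  rw [bracketProd, bracket_pow, bracket_pow, bracket_pow, Finset.sum_mul_sum, Finset.sum_mul_sum]
  simp only [Finset.mul_sum, coeff_sum, monomial_mul, coeff_monomial]
  refine Finset.sum_congr rfl fun t _ => ?_
  refine Finset.sum_congr rfl fun u _ => ?_
  refine Finset.sum_congr rfl fun v _ => ?_
  have hc : pairExp 0 1 t (α - t) + (pairExp 1 2 u (β - u) + pairExp 2 0 v (γ - v)) = occExp n ↔
      n 0 0 = t + (γ - v) ∧ n 0 1 = (α - t) + v ∧ n 1 0 = (α - t) + u ∧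
        n 1 1 = t + (β - u) ∧ n 2 0 = v + (β - u) ∧ n 2 1 = (γ - v) + u := by
    simp only [pairExp, Finsupp.ext_iff, Prod.forall, Fin.forall_fin_succ, Finsupp.add_apply,
      Finsupp.single_apply, occExp_apply]
    simp
    omega
  rw [if_congr hc rfl rfl]
  split_ifs
  · ring
  · ring

end

/-! ### The 3jm-symbol as a normalised product of brackets -/

section

open MvPolynomial

lemma invFact_of_neg {n : ℤ} (h : n < 0) : invFact n = 0 := by simp [invFact, h]

lemma invFact_natCast (n : ℕ) : invFact n = ((n.factorial : ℝ))⁻¹ := by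
  have h0 : ¬ ((n : ℤ) < 0) := by omega
  simp [invFact, fact, h0]

lemma fact_natCast (n : ℕ) : fact n = (n.factorial : ℝ) := by simp [fact]

/-- The occupation numbers `n` fit into a vertex with `α`, `β`, `γ` brackets. -/
def Balanced (α β γ : ℕ) (n : Fin 3 → Occ) : Prop :=
  n 0 0 + n 0 1 = α + γ ∧ n 1 0 + n 1 1 = α + β ∧ n 2 0 + n 2 1 = β + γ ∧
    n 0 0 + n 1 0 + n 2 0 = n 0 1 + n 1 1 + n 2 1

lemma coeff_bracketProd_of_not_balanced {n : Fin 3 → Occ} {α β γ : ℕ} (h : ¬ Balanced α β γ n) :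
    coeff (occExp n) (bracketProd 0 1 2 α β γ) = 0 := by
  rw [coeff_bracketProd]
  refine mul_eq_zero_of_right _ (Finset.sum_eq_zero fun t ht => Finset.sum_eq_zero fun u hu =>
    Finset.sum_eq_zero fun v hv => if_neg fun hc => h ?_)
  simp only [Finset.mem_range] at ht hu hv
  simp only [Balanced]
  omega

/-- For given `t` the exponent equations force `u = n 1 0 + t - α` and `v = n 0 1 + t - α`, which
collapses the triple sum to Racah's single sum. -/
lemma coeff_bracketProd_of_balanced {n : Fin 3 → Occ} {α β γ : ℕ} (h : Balanced α β γ n) :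
    coeff (occExp n) (bracketProd 0 1 2 α β γ) =
      (α.factorial * β.factorial * γ.factorial : ℝ) * ((-1) ^ (n 0 1 + n 1 0) *
      ∑ t ∈ Finset.range (α + 1), (-1) ^ t * invFact t * invFact ((n 0 1 : ℤ) - α + t) *
        invFact ((n 1 0 : ℤ) - α + t) * invFact ((α : ℤ) - t) * invFact ((n 0 0 : ℤ) - t) *
        invFact ((n 1 1 : ℤ) - t)) := by
  obtain ⟨h0, h1, h2, h3⟩ := h
  rw [coeff_bracketProd]
  congr 1
  rw [Finset.mul_sum]
  refine Finset.sum_congr rfl fun t ht => ?_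
  have ht : t ≤ α := by simpa [Nat.lt_succ_iff] using ht
  -- The forced `u` and `v` must lie in their ranges. Otherwise no term survives on the left, and on
  -- the right some `invFact` has a negative argument.
  by_cases hu : α ≤ n 1 0 + t ∧ n 1 0 + t ≤ α + β ∧ α ≤ n 0 1 + t ∧ n 0 1 + t ≤ α + γ
  · obtain ⟨hu1, hu2, hv1, hv2⟩ := hu
    rw [Finset.sum_eq_single (n 1 0 + t - α), Finset.sum_eq_single (n 0 1 + t - α), if_pos]
    · have e1 : ((n 1 0 : ℤ) - α + t) = ((n 1 0 + t - α : ℕ) : ℤ) := by omega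
      have e2 : ((n 0 1 : ℤ) - α + t) = ((n 0 1 + t - α : ℕ) : ℤ) := by omega
      have e3 : ((n 0 0 : ℤ) - t) = (γ : ℤ) - ((n 0 1 + t - α : ℕ) : ℤ) := by omega
      have e4 : ((n 1 1 : ℤ) - t) = (β : ℤ) - ((n 1 0 + t - α : ℕ) : ℤ) := by omega
      have e5 : (-1 : ℝ) ^ (n 0 1 + n 1 0) =
          (-1) ^ (n 1 0 + t - α) * (-1) ^ (n 0 1 + t - α) := by
        rw [← pow_add]
        refine (neg_one_pow_congr ?_)
        rw [show n 1 0 + t - α + (n 0 1 + t - α) = (n 0 1 + n 1 0) + 2 * t - 2 * α by omega]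
        grind
      rw [e1, e2, e3, e4, e5]
      ring
    · omega
    · intro v _ hv
      exact if_neg (by omega)
    · intro hv
      simp only [Finset.mem_range] at hv
      omega
    · intro u _ hu
      exact Finset.sum_eq_zero fun v _ => if_neg (by omega)
    · intro hv
      simp only [Finset.mem_range] at hv
      omega
  · rw [Finset.sum_eq_zero]
    · have : (n 1 0 : ℤ) - α + t < 0 ∨ (n 1 1 : ℤ) - t < 0 ∨ (n 0 1 : ℤ) - α + t < 0 ∨
          (n 0 0 : ℤ) - t < 0 := by omega
      rcases this with h | h | h | h <;> simp [invFact_of_neg h]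
    · intro u hu'
      simp only [Finset.mem_range] at hu'
      refine Finset.sum_eq_zero fun v hv => if_neg ?_
      simp only [Finset.mem_range] at hv
      omega

/-- The 3jm-symbol as a function of the occupation numbers of the three legs. -/
def vertex (a b c : ℤ) (n : Fin 3 → Occ) : ℝ :=
  if (n 0 0 : ℤ) + n 0 1 = a ∧ (n 1 0 : ℤ) + n 1 1 = b ∧ (n 2 0 : ℤ) + n 2 1 = c then
    threeJ a b c ((n 0 1 : ℤ) - n 0 0) ((n 1 1 : ℤ) - n 1 0) ((n 2 1 : ℤ) - n 2 0)
  else 0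

/-- The norm of a product of brackets is the inverse of this number. -/
def invNorm (α β γ : ℕ) : ℝ :=
  (√(α.factorial * β.factorial * γ.factorial * (α + β + γ + 1).factorial))⁻¹

lemma vertex_eq_zero {a b c : ℤ} (h : ¬ Triad a b c) : vertex a b c = 0 := by
  funext n
  simp [vertex, threeJ, h]

lemma phase_eq_pow {n : ℤ} {m : ℕ} (h : Even (n - m)) : phase n = (-1) ^ m := by
  have h0 : (-1 : ℝ) ≠ 0 := by norm_num
  rw [phase, show n = (n - m) + (m : ℤ) by ring, zpow_add₀ h0, h.neg_one_zpow, one_mul,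
    zpow_natCast]

/-- Here `α = j₁ + j₂ - j₃`, `β = j₂ + j₃ - j₁`, `γ = j₁ + j₃ - j₂`. Racah's sum is the coefficient
of the product of brackets, its magnetic factorials are the monomial norm, and its triangle factor
is `invNorm` times the factorials of the exponents. -/
lemma vertex_eq_wave (α β γ : ℕ) :
    vertex (α + γ) (α + β) (β + γ) = invNorm α β γ • wave (bracketProd 0 1 2 α β γ) := by
  funext n
  simp only [Pi.smul_apply, smul_eq_mul, wave]
  by_cases h : Balanced α β γ n
  · rw [coeff_bracketProd_of_balanced h]
    obtain ⟨h0, h1, h2, h3⟩ := h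
    have hg : Triad (α + γ) (α + β) (β + γ) ∧
        ((n 0 1 : ℤ) - n 0 0) + ((n 1 1 : ℤ) - n 1 0) + ((n 2 1 : ℤ) - n 2 0) = 0 ∧
        |(n 0 1 : ℤ) - n 0 0| ≤ α + γ ∧ |(n 1 1 : ℤ) - n 1 0| ≤ α + β ∧
        |(n 2 1 : ℤ) - n 2 0| ≤ β + γ ∧ Even ((α + γ : ℤ) - ((n 0 1 : ℤ) - n 0 0)) ∧
        Even ((α + β : ℤ) - ((n 1 1 : ℤ) - n 1 0)) ∧
        Even ((β + γ : ℤ) - ((n 2 1 : ℤ) - n 2 0)) := by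
      refine ⟨⟨⟨α + β + γ, by ring⟩, by omega, by omega, by omega⟩, by omega, ?_, ?_, ?_,
        ⟨n 0 0, by omega⟩, ⟨n 1 0, by omega⟩, ⟨n 2 0, by omega⟩⟩ <;> rw [abs_le] <;> omega
    rw [vertex, if_pos (by omega), threeJ, if_pos hg]
    have e1 : ((α + γ : ℤ) + (α + β) - (β + γ)) / 2 = (α : ℕ) := by omega
    have e2 : ((α + γ : ℤ) - (α + β) + (β + γ)) / 2 = (γ : ℕ) := by omega
    have e3 : (-(α + γ : ℤ) + (α + β) + (β + γ)) / 2 = (β : ℕ) := by omega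
    have e4 : ((α + γ : ℤ) + (α + β) + (β + γ)) / 2 + 1 = ((α + β + γ + 1 : ℕ) : ℤ) := by omega
    have e5 : ((α + γ : ℤ) + ((n 0 1 : ℤ) - n 0 0)) / 2 = (n 0 1 : ℕ) := by omega
    have e6 : ((α + γ : ℤ) - ((n 0 1 : ℤ) - n 0 0)) / 2 = (n 0 0 : ℕ) := by omega
    have e7 : ((α + β : ℤ) + ((n 1 1 : ℤ) - n 1 0)) / 2 = (n 1 1 : ℕ) := by omega
    have e8 : ((α + β : ℤ) - ((n 1 1 : ℤ) - n 1 0)) / 2 = (n 1 0 : ℕ) := by omega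
    have e9 : ((β + γ : ℤ) + ((n 2 1 : ℤ) - n 2 0)) / 2 = (n 2 1 : ℕ) := by omega
    have e10 : ((β + γ : ℤ) - ((n 2 1 : ℤ) - n 2 0)) / 2 = (n 2 0 : ℕ) := by omega
    have e11 : ((β + γ : ℤ) - (α + β) + ((n 0 1 : ℤ) - n 0 0)) / 2 = (n 0 1 : ℤ) - α := by omega
    have e12 : ((β + γ : ℤ) - (α + γ) - ((n 1 1 : ℤ) - n 1 0)) / 2 = (n 1 0 : ℤ) - α := by omega
    have e13 : phase (((α + γ : ℤ) - (α + β) - ((n 2 1 : ℤ) - n 2 0)) / 2) =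
        (-1) ^ (n 0 1 + n 1 0) := phase_eq_pow ⟨- n 1 0, by push_cast; omega⟩
    have e14 : ((α : ℤ) + 1).toNat = α + 1 := by omega
    rw [e1, e2, e3, e4, e5, e6, e7, e8, e9, e10, e11, e12, e13, e14]
    simp only [fact_natCast]
    have hm : monoNorm (occExp n) = (n 0 1).factorial * (n 0 0).factorial * (n 1 1).factorial *
        (n 1 0).factorial * (n 2 1).factorial * (n 2 0).factorial := by
      simp only [monoNorm, occExp_apply, Fintype.prod_prod_type, Fin.prod_univ_three,
        Fin.prod_univ_two]
      ring
    have hN : √((α.factorial : ℝ) * γ.factorial * β.factorial / (α + β + γ + 1).factorial) =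
        invNorm α β γ * (α.factorial * β.factorial * γ.factorial) := by
      rw [invNorm, mul_comm (_⁻¹), ← div_eq_mul_inv, Real.sqrt_eq_iff_mul_self_eq (by positivity)
        (by positivity)]
      rw [div_mul_div_comm, Real.mul_self_sqrt (by positivity)]
      field_simp
    rw [hN, hm]
    ring
  · rw [coeff_bracketProd_of_not_balanced h, vertex]
    simp only [mul_zero]
    split_ifs with hd
    · refine if_neg fun hg => h ?_
      have := hg.2.1
      simp only [Balanced]
      omega
    · rfl

end

/-! ### How the normalisation depends on the exponents -/

section

open MvPolynomial

lemma inv_sqrt_mul_self {x z : ℝ} (hx : 0 < x) : (√(x * z))⁻¹ * x = √x * (√z)⁻¹ := by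
  have h := Real.mul_self_sqrt hx.le
  have h0 : √x ≠ 0 := (Real.sqrt_pos.2 hx).ne'
  rw [Real.sqrt_mul hx.le, mul_inv]
  nth_rewrite 2 [← h]
  field_simp

lemma sqrt_mul_inv_sqrt_mul {x z : ℝ} (hx : 0 < x) : √x * (√(x * z))⁻¹ = (√z)⁻¹ := by
  have h0 : √x ≠ 0 := (Real.sqrt_pos.2 hx).ne'
  rw [Real.sqrt_mul hx.le, mul_inv]
  field_simp

lemma invNorm_succ_left (α β γ : ℕ) : invNorm (α + 1) β γ =
    (√((α + 1) * (α + β + γ + 2) *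
      (α.factorial * β.factorial * γ.factorial * (α + β + γ + 1).factorial) : ℝ))⁻¹ := by
  rw [invNorm, show α + 1 + β + γ + 1 = (α + β + γ + 1) + 1 by ring, Nat.factorial_succ α,
    Nat.factorial_succ (α + β + γ + 1)]
  push_cast
  congr 2
  ring

/-- The integer produced by the second-order operator is the ratio of the squared norms, so after
normalisation only its square root remains. -/
lemma invNorm_lower (α β γ : ℕ) : invNorm (α + 1) β γ * ((α + 1) * (α + β + γ + 2)) =
    √((α + 1) * (α + β + γ + 2)) * invNorm α β γ := by
  rw [invNorm_succ_left, inv_sqrt_mul_self (by positivity), invNorm]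

lemma invNorm_raise (α β γ : ℕ) :
    invNorm α β γ = √((α + 1) * (α + β + γ + 2)) * invNorm (α + 1) β γ := by
  rw [invNorm_succ_left, sqrt_mul_inv_sqrt_mul (by positivity), invNorm]

lemma invNorm_rotate (α β γ : ℕ) : invNorm α β γ = invNorm β γ α := by
  simp only [invNorm]
  rw [show β + γ + α = α + β + γ by ring]
  congr 2
  ring

lemma invNorm_swap (α β γ : ℕ) : invNorm α β γ = invNorm α γ β := by
  simp only [invNorm]
  rw [show α + γ + β = α + β + γ by ring]
  congr 2
  ring

/-- A transfer keeps the total degree, so only the factorials of `β` and `γ` change. -/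
lemma invNorm_transfer (α β γ : ℕ) : invNorm α (β + 1) γ * (β + 1) =
    √((β + 1) * (γ + 1)) * invNorm α β (γ + 1) := by
  simp only [invNorm]
  rw [show α + β + (γ + 1) = α + (β + 1) + γ by ring, Nat.factorial_succ γ, Nat.factorial_succ β]
  push_cast
  set z : ℝ := α.factorial * β.factorial * γ.factorial * (α + (β + 1) + γ + 1).factorial
  have e1 : ((α.factorial : ℝ) * ((β + 1) * β.factorial) * γ.factorial *
      (α + (β + 1) + γ + 1).factorial) = (β + 1) * z := by ring
  have e2 : ((α.factorial : ℝ) * β.factorial * ((γ + 1) * γ.factorial) *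
      (α + (β + 1) + γ + 1).factorial) = (γ + 1) * z := by ring
  rw [e1, e2, inv_sqrt_mul_self (by positivity), Real.sqrt_mul (by positivity) ((γ : ℝ) + 1),
    mul_assoc (√((β : ℝ) + 1)), sqrt_mul_inv_sqrt_mul (by positivity)]

/-! ### Graspings of a vertex -/

/-- The sign `(-1)^{1/2 - A}` as a real number. -/
def sgn (A : Fin 2) : ℝ := ![-1, 1] A

/-- `∑_A (-1)^{1/2 - A} a_i^{-A} a_j^A` -/
def lowerPair (i j : Fin 3) (f : (Fin 3 → Occ) → ℝ) : (Fin 3 → Occ) → ℝ :=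
  ∑ A, sgn A • legLower i (Fin.rev A) (legLower j A f)

/-- `∑_A (-1)^{1/2 - A} a_i^{-A†} a_j^{A†}` -/
def raisePair (i j : Fin 3) (f : (Fin 3 → Occ) → ℝ) : (Fin 3 → Occ) → ℝ :=
  ∑ A, sgn A • legRaise i (Fin.rev A) (legRaise j A f)

/-- `∑_A a_i^{A†} a_j^A` -/
def transfer (i j : Fin 3) (f : (Fin 3 → Occ) → ℝ) : (Fin 3 → Occ) → ℝ :=
  ∑ A, legRaise i A (legLower j A f)

lemma legLower_smul (i : Fin 3) (A : Fin 2) (c : ℝ) (f : (Fin 3 → Occ) → ℝ) :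
    legLower i A (c • f) = c • legLower i A f := by
  funext n; simp [legLower]; ring

lemma legRaise_smul (i : Fin 3) (A : Fin 2) (c : ℝ) (f : (Fin 3 → Occ) → ℝ) :
    legRaise i A (c • f) = c • legRaise i A f := by
  funext n; simp [legRaise]; ring

lemma lowerPair_smul (i j : Fin 3) (c : ℝ) (f : (Fin 3 → Occ) → ℝ) :
    lowerPair i j (c • f) = c • lowerPair i j f := by
  simp only [lowerPair, legLower_smul, Finset.smul_sum, smul_comm c]

lemma raisePair_smul (i j : Fin 3) (c : ℝ) (f : (Fin 3 → Occ) → ℝ) :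
    raisePair i j (c • f) = c • raisePair i j f := by
  simp only [raisePair, legRaise_smul, Finset.smul_sum, smul_comm c]

lemma transfer_smul (i j : Fin 3) (c : ℝ) (f : (Fin 3 → Occ) → ℝ) :
    transfer i j (c • f) = c • transfer i j f := by
  simp only [transfer, legRaise_smul, legLower_smul, Finset.smul_sum]

lemma lowerPair_wave (i j : Fin 3) (P : Poly) :
    lowerPair i j (wave P) = wave (bracketDual i j P) := by
  simp [lowerPair, legLower_wave, bracketDual, wave_sub, sgn]
  abel

lemma raisePair_wave (i j : Fin 3) (P : Poly) :
    raisePair i j (wave P) = -wave (bracket i j * P) := by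
  have : bracket i j * P = X (i, 1) * (X (j, 0) * P) - X (i, 0) * (X (j, 1) * P) := by
    simp only [bracket]; ring
  rw [this]
  simp [raisePair, legRaise_wave, wave_sub, sgn]
  abel

lemma transfer_wave (i j : Fin 3) (P : Poly) :
    transfer i j (wave P) =
      wave (X (i, 0) * pderiv (j, 0) P + X (i, 1) * pderiv (j, 1) P) := by
  simp [transfer, legRaise_wave, legLower_wave, wave_add]

section
variable {i j k : Fin 3} (α β γ : ℕ)

/-- The normalized invariant of a vertex. -/
def invariant (i j k : Fin 3) (α β γ : ℕ) : (Fin 3 → Occ) → ℝ :=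
  invNorm α β γ • wave (bracketProd i j k α β γ)

lemma invariant_rotate (i j k : Fin 3) (α β γ : ℕ) :
    invariant i j k α β γ = invariant j k i β γ α := by
  rw [invariant, invariant, invNorm_rotate]
  congr 2
  simp only [bracketProd]; ring

lemma lowerPair_invariant (hij : i ≠ j) (hjk : j ≠ k) (hki : k ≠ i) :
    lowerPair i j (invariant i j k (α + 1) β γ) =
      (-√((α + 1) * (α + β + γ + 2))) • invariant i j k α β γ := by
  rw [invariant, invariant, lowerPair_smul, lowerPair_wave, bracketDual_bracketProd hij hjk hki,
    wave_C_mul, smul_smul, smul_smul]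
  congr 1
  linear_combination -invNorm_lower α β γ

lemma lowerPair_invariant_zero (hij : i ≠ j) (hjk : j ≠ k) (hki : k ≠ i) :
    lowerPair i j (invariant i j k 0 β γ) = 0 := by
  rw [invariant, lowerPair_smul, lowerPair_wave, bracketDual_bracketProd_zero hij hjk hki]
  funext n
  simp [wave]

lemma raisePair_invariant :
    raisePair i j (invariant i j k α β γ) =
      (-√((α + 1) * (α + β + γ + 2))) • invariant i j k (α + 1) β γ := by
  have h : bracket i j * bracketProd i j k α β γ = bracketProd i j k (α + 1) β γ := by
    simp only [bracketProd]; ring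
  rw [invariant, invariant, raisePair_smul, raisePair_wave, h, smul_neg, neg_smul, smul_smul]
  rw [← invNorm_raise]

lemma transfer_invariant (hij : i ≠ j) (hjk : j ≠ k) (hki : k ≠ i) :
    transfer i j (invariant i j k α (β + 1) γ) =
      (-√((β + 1) * (γ + 1))) • invariant i j k α β (γ + 1) := by
  rw [invariant, invariant, transfer_smul, transfer_wave, transfer_bracketProd hij hjk hki,
    wave_C_mul, smul_smul, smul_smul]
  congr 1
  push_cast
  linear_combination -invNorm_transfer α β γ

lemma transfer_invariant_zero (hij : i ≠ j) (hjk : j ≠ k) (hki : k ≠ i) :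
    transfer i j (invariant i j k α 0 γ) = 0 := by
  rw [invariant, transfer_smul, transfer_wave, transfer_bracketProd hij hjk hki]
  funext n
  simp [wave]

lemma transfer_invariant' (hij : i ≠ j) (hjk : j ≠ k) (hki : k ≠ i) :
    transfer j i (invariant i j k α β (γ + 1)) =
      (-√((γ + 1) * (β + 1))) • invariant i j k α (β + 1) γ := by
  rw [invariant, invariant, transfer_smul, transfer_wave, transfer_bracketProd' hij hjk hki,
    wave_C_mul, smul_smul, smul_smul]
  congr 1
  push_cast
  rw [invNorm_swap, invNorm_swap _ (β + 1)]
  linear_combination -invNorm_transfer α γ β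

lemma transfer_invariant_zero' (hij : i ≠ j) (hjk : j ≠ k) (hki : k ≠ i) :
    transfer j i (invariant i j k α β 0) = 0 := by
  rw [invariant, transfer_smul, transfer_wave, transfer_bracketProd' hij hjk hki]
  funext n
  simp [wave]
end

lemma vertex_eq_invariant (α β γ : ℕ) :
    vertex (α + γ) (α + β) (β + γ) = invariant 0 1 2 α β γ := vertex_eq_wave α β γ

lemma Triad.exists_nat {a b c : ℤ} (h : Triad a b c) :
    ∃ α β γ : ℕ, a = α + γ ∧ b = α + β ∧ c = β + γ := by
  obtain ⟨⟨s, hs⟩, h1, h2, h3⟩ := h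
  exact ⟨(s - c).toNat, (s - a).toNat, (s - b).toNat, by omega, by omega, by omega⟩

lemma vertex_eq_invariant_of {a b c : ℤ} (α β γ : ℕ) (ha : a = α + γ) (hb : b = α + β)
    (hc : c = β + γ) : vertex a b c = invariant 0 1 2 α β γ := by
  subst ha hb hc
  exact vertex_eq_invariant α β γ

section
variable {a b c : ℤ}

/-- In terms of the exponents the root is `√(α (α + β + γ + 1))`. For `α = 0` it vanishes, as does
the grasping, so it does not matter that the lowered spins are no longer a triad. The other
graspings follow the same pattern. -/
lemma lowerPair_vertex (h : Triad a b c) : lowerPair 0 1 (vertex a b c) =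
    (-√((spin a + spin b - spin c) * (spin a + spin b + spin c + 1))) •
      vertex (a - 1) (b - 1) c := by
  obtain ⟨α, β, γ, rfl, rfl, rfl⟩ := h.exists_nat
  rw [vertex_eq_invariant]
  rcases α with _ | α
  · rw [lowerPair_invariant_zero _ _ (by decide) (by decide) (by decide)]
    simp [spin]
    left; rw [Real.sqrt_eq_zero']; ring_nf; rfl
  · rw [lowerPair_invariant _ _ _ (by decide) (by decide) (by decide),
      vertex_eq_invariant_of α β γ (by push_cast; ring) (by push_cast; ring) (by push_cast; ring)]
    simp only [spin]
    push_cast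
    ring_nf

/-- Cyclic rotation makes the legs `2, 0` the first pair, whose bracket has the exponent `γ`. -/
lemma lowerPair_vertex' (h : Triad a b c) : lowerPair 2 0 (vertex a b c) =
    (-√((spin a + spin c - spin b) * (spin a + spin b + spin c + 1))) •
      vertex (a - 1) b (c - 1) := by
  obtain ⟨α, β, γ, rfl, rfl, rfl⟩ := h.exists_nat
  rw [vertex_eq_invariant, ← invariant_rotate 2 0 1]
  rcases γ with _ | γ
  · rw [lowerPair_invariant_zero _ _ (by decide) (by decide) (by decide)]
    simp [spin]
    left; rw [Real.sqrt_eq_zero']; ring_nf; rfl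
  · rw [lowerPair_invariant _ _ _ (by decide) (by decide) (by decide),
      vertex_eq_invariant_of α β γ (by push_cast; ring) (by push_cast; ring) (by push_cast; ring),
      ← invariant_rotate 2 0 1]
    simp only [spin]
    push_cast
    ring_nf

lemma raisePair_vertex (h : Triad a b c) : raisePair 0 1 (vertex a b c) =
    (-√((spin a + spin b - spin c + 1) * (spin a + spin b + spin c + 2))) •
      vertex (a + 1) (b + 1) c := by
  obtain ⟨α, β, γ, rfl, rfl, rfl⟩ := h.exists_nat
  rw [vertex_eq_invariant, raisePair_invariant,
      vertex_eq_invariant_of (α + 1) β γ (by push_cast; ring) (by push_cast; ring)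
      (by push_cast; ring)]
  simp only [spin]
  push_cast
  ring_nf

lemma transfer_vertex (h : Triad a b c) : transfer 0 1 (vertex a b c) =
    (-√((-spin a + spin b + spin c) * (spin a - spin b + spin c + 1))) •
      vertex (a + 1) (b - 1) c := by
  obtain ⟨α, β, γ, rfl, rfl, rfl⟩ := h.exists_nat
  rw [vertex_eq_invariant]
  rcases β with _ | β
  · rw [transfer_invariant_zero _ _ (by decide) (by decide) (by decide)]
    simp [spin]
    left; rw [Real.sqrt_eq_zero']; ring_nf; rfl
  · rw [transfer_invariant _ _ _ (by decide) (by decide) (by decide),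
      vertex_eq_invariant_of α β (γ + 1) (by push_cast; ring) (by push_cast; ring)
      (by push_cast; ring)]
    simp only [spin]
    push_cast
    ring_nf

lemma transfer_vertex_rev (h : Triad a b c) : transfer 1 0 (vertex a b c) =
    (-√((spin a - spin b + spin c) * (-spin a + spin b + spin c + 1))) •
      vertex (a - 1) (b + 1) c := by
  obtain ⟨α, β, γ, rfl, rfl, rfl⟩ := h.exists_nat
  rw [vertex_eq_invariant]
  rcases γ with _ | γ
  · rw [transfer_invariant_zero' _ _ (by decide) (by decide) (by decide)]
    simp [spin]
    left; rw [Real.sqrt_eq_zero']; ring_nf; rfl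
  · rw [transfer_invariant' _ _ _ (by decide) (by decide) (by decide),
      vertex_eq_invariant_of α (β + 1) γ (by push_cast; ring) (by push_cast; ring)
      (by push_cast; ring)]
    simp only [spin]
    push_cast
    ring_nf

lemma transfer_vertex' (h : Triad a b c) : transfer 0 2 (vertex a b c) =
    (-√((-spin a + spin b + spin c) * (spin a + spin b - spin c + 1))) •
      vertex (a + 1) b (c - 1) := by
  obtain ⟨α, β, γ, rfl, rfl, rfl⟩ := h.exists_nat
  rw [vertex_eq_invariant, ← invariant_rotate 2 0 1]
  rcases β with _ | β
  · rw [transfer_invariant_zero' _ _ (by decide) (by decide) (by decide)]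
    simp [spin]
    left; rw [Real.sqrt_eq_zero']; ring_nf; rfl
  · rw [transfer_invariant' _ _ _ (by decide) (by decide) (by decide),
      vertex_eq_invariant_of (α + 1) β γ (by push_cast; ring) (by push_cast; ring)
      (by push_cast; ring), ← invariant_rotate 2 0 1]
    simp only [spin]
    push_cast
    ring_nf
end

end

section

open MvPolynomial

/-! ### Symmetries of the 3jm-symbol -/

/-- Monomial norms are invariant under permutations of the variables, so symmetries of the
polynomial become symmetries of the 3jm-symbol. -/
lemma wave_rename (e : Fin 3 × Fin 2 ≃ Fin 3 × Fin 2) (P : Poly) {n m : Fin 3 → Occ}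
    (h : ∀ x, m (e x).1 (e x).2 = n x.1 x.2) : wave (rename e P) m = wave P n := by
  have h1 : occExp m = Finsupp.mapDomain e (occExp n) := by
    ext x
    obtain ⟨y, rfl⟩ := e.surjective x
    rw [Finsupp.mapDomain_apply e.injective, occExp_apply, occExp_apply, h]
  have h2 : monoNorm (occExp m) = monoNorm (occExp n) := by
    simp only [monoNorm, occExp_apply]
    rw [← Equiv.prod_comp e]
    simp only [h]
  rw [wave, wave, h2, h1, coeff_rename_mapDomain e e.injective]

/-- The permutation of the spinor variables induced by a permutation of the legs. -/
def legPerm (σ : Equiv.Perm (Fin 3)) : Fin 3 × Fin 2 ≃ Fin 3 × Fin 2 :=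
  Equiv.prodCongr σ (Equiv.refl _)

lemma vertex_rotate (a b c : ℤ) (n : Fin 3 → Occ) :
    vertex a b c n = vertex b c a ![n 1, n 2, n 0] := by
  by_cases h : Triad a b c
  · obtain ⟨α, β, γ, rfl, rfl, rfl⟩ := h.exists_nat
    rw [vertex_eq_invariant, vertex_eq_invariant_of β γ α (by ring) (by ring) (by ring)]
    rw [invariant_rotate, invariant, invariant]
    simp only [Pi.smul_apply]
    congr 1
    rw [← wave_rename (legPerm (finRotate 3)) (bracketProd 0 1 2 β γ α) (n := ![n 1, n 2, n 0])
      (m := n)]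
    · congr 1
      simp [bracketProd, bracket, legPerm]
    · rintro ⟨i, A⟩
      fin_cases i <;> simp [legPerm]
  · have h' : ¬ Triad b c a := fun hh => h (by
      obtain ⟨h0, h1, h2, h3⟩ := hh
      exact ⟨by rwa [show a + b + c = b + c + a by ring], by omega, by omega, by omega⟩)
    rw [vertex_eq_zero h, vertex_eq_zero h']
    rfl

/-- Exchange of the first two legs, combined with a reversal of the spinor indices. -/
def swapFlip : Fin 3 × Fin 2 ≃ Fin 3 × Fin 2 :=
  Equiv.prodCongr (Equiv.swap 0 1) Fin.revPerm

/-- A bracket is odd both under exchange of its legs and under reversal of its spinor indices. Done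
together, these fix `[0 1]` and exchange `[1 2]` with `[2 0]`, so the two customary phases cancel.
-/
lemma vertex_swap_flip (a b c : ℤ) (n : Fin 3 → Occ) :
    vertex a b c n = vertex b a c ![n 1 ∘ Fin.rev, n 0 ∘ Fin.rev, n 2 ∘ Fin.rev] := by
  by_cases h : Triad a b c
  · obtain ⟨α, β, γ, rfl, rfl, rfl⟩ := h.exists_nat
    rw [vertex_eq_invariant, vertex_eq_invariant_of α γ β (by ring) (by ring) (by ring)]
    rw [invariant, invariant, invNorm_swap]
    simp only [Pi.smul_apply]
    congr 1
    rw [← wave_rename swapFlip (bracketProd 0 1 2 α γ β)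
      (n := ![n 1 ∘ Fin.rev, n 0 ∘ Fin.rev, n 2 ∘ Fin.rev]) (m := n)]
    · congr 1
      have h2 : (Equiv.swap (0 : Fin 3) 1) 2 = 2 := by decide
      have e1 : rename swapFlip (bracket 0 1) = bracket 0 1 := by
        simp [bracket, swapFlip]; ring
      have e2 : rename swapFlip (bracket 1 2) = bracket 2 0 := by
        simp [bracket, swapFlip, h2]; ring
      have e3 : rename swapFlip (bracket 2 0) = bracket 1 2 := by
        simp [bracket, swapFlip, h2]; ring
      simp only [bracketProd, map_mul, map_pow, e1, e2, e3]
      ring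
    · have h2 : (Equiv.swap (0 : Fin 3) 1) 2 = 2 := by decide
      rintro ⟨i, A⟩
      fin_cases i <;> simp [swapFlip, h2]
  · have h' : ¬ Triad b a c := fun hh => h (by
      obtain ⟨h0, h1, h2, h3⟩ := hh
      exact ⟨by rwa [show a + b + c = b + a + c by ring], by omega, by omega, by omega⟩)
    rw [vertex_eq_zero h, vertex_eq_zero h']
    rfl

/-- The occupation numbers of the state with doubled spin `a` and doubled magnetic number `x`. -/
def occOf (a x : ℤ) : Occ := ![((a - x) / 2).toNat, ((a + x) / 2).toNat]

/-- `x` is a magnetic number for the spin `a` (both doubled). -/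
def IsMagnetic (a x : ℤ) : Prop := |x| ≤ a ∧ Even (a - x)

lemma IsMagnetic.neg {a x : ℤ} (h : IsMagnetic a x) : IsMagnetic a (-x) := by
  obtain ⟨h1, k, h2⟩ := h
  exact ⟨by rwa [abs_neg], ⟨k + x, by omega⟩⟩

lemma isMagnetic_of_le {a : ℤ} {k : ℕ} (h : (k : ℤ) ≤ a) : IsMagnetic a (2 * k - a) := by
  refine ⟨?_, ⟨a - k, by ring⟩⟩
  rw [abs_le]; omega

lemma IsMagnetic.occOf {a x : ℤ} (h : IsMagnetic a x) :
    (occOf a x 0 : ℤ) + occOf a x 1 = a ∧ (occOf a x 1 : ℤ) - occOf a x 0 = x := by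
  obtain ⟨h1, k, h2⟩ := h
  rw [abs_le] at h1
  simp [SpinNet.occOf]
  omega

lemma threeJ_eq_vertex {a b c x y z : ℤ} (hx : IsMagnetic a x) (hy : IsMagnetic b y)
    (hz : IsMagnetic c z) :
    threeJ a b c x y z = vertex a b c ![occOf a x, occOf b y, occOf c z] := by
  obtain ⟨h1, h2⟩ := hx.occOf
  obtain ⟨h3, h4⟩ := hy.occOf
  obtain ⟨h5, h6⟩ := hz.occOf
  rw [vertex, if_pos]
  · simp [h2, h4, h6]
  · exact ⟨h1, h3, h5⟩

lemma threeJ_eq_zero {a b c x y z : ℤ}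
    (h : ¬ (IsMagnetic a x ∧ IsMagnetic b y ∧ IsMagnetic c z)) : threeJ a b c x y z = 0 :=
  if_neg fun hh => h ⟨⟨hh.2.2.1, hh.2.2.2.2.2.1⟩, ⟨hh.2.2.2.1, hh.2.2.2.2.2.2.1⟩,
    ⟨hh.2.2.2.2.1, hh.2.2.2.2.2.2.2⟩⟩

lemma threeJ_eq_zero_of_sum {a b c x y z : ℤ} (h : x + y + z ≠ 0) : threeJ a b c x y z = 0 :=
  if_neg fun hh => h hh.2.1

lemma threeJ_eq_zero_of_triad {a b c : ℤ} (h : ¬ Triad a b c) (x y z : ℤ) :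
    threeJ a b c x y z = 0 :=
  if_neg fun hh => h hh.1

lemma threeJ_rotate (a b c x y z : ℤ) : threeJ a b c x y z = threeJ b c a y z x := by
  by_cases h : IsMagnetic a x ∧ IsMagnetic b y ∧ IsMagnetic c z
  · rw [threeJ_eq_vertex h.1 h.2.1 h.2.2, threeJ_eq_vertex h.2.1 h.2.2 h.1, vertex_rotate]
    simp
  · rw [threeJ_eq_zero h, threeJ_eq_zero (by tauto)]

lemma occOf_neg (a x : ℤ) : occOf a (-x) = occOf a x ∘ Fin.rev := by
  funext A
  fin_cases A <;> simp [occOf, sub_eq_add_neg]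

lemma threeJ_swap_neg (a b c x y z : ℤ) :
    threeJ a b c x y z = threeJ b a c (-y) (-x) (-z) := by
  by_cases h : IsMagnetic a x ∧ IsMagnetic b y ∧ IsMagnetic c z
  · rw [threeJ_eq_vertex h.1 h.2.1 h.2.2, threeJ_eq_vertex h.2.1.neg h.1.neg h.2.2.neg,
      vertex_swap_flip, occOf_neg, occOf_neg, occOf_neg]
    simp
  · rw [threeJ_eq_zero h, threeJ_eq_zero]
    rintro ⟨h1, h2, h3⟩
    exact h ⟨by simpa using h2.neg, by simpa using h1.neg, by simpa using h3.neg⟩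

/-! ### Normalization -/

/-- Parseval: the sum of squares is the squared Bargmann norm of the product of brackets, divided by
itself. -/
lemma sum_vertex_sq (α β γ : ℕ) :
    ∑ k ∈ Finset.range (α + γ + 1) ×ˢ Finset.range (α + β + 1) ×ˢ Finset.range (β + γ + 1),
      vertex (α + γ) (α + β) (β + γ)
        ![![α + γ - k.1, k.1], ![α + β - k.2.1, k.2.1], ![β + γ - k.2.2, k.2.2]] ^ 2 = 1 := by
  set φ : ℕ × ℕ × ℕ → (Fin 3 → Occ) := fun k =>
    ![![α + γ - k.1, k.1], ![α + β - k.2.1, k.2.1], ![β + γ - k.2.2, k.2.2]] with hφ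
  set Q := bracketProd 0 1 2 α β γ with hQ
  set K := Finset.range (α + γ + 1) ×ˢ Finset.range (α + β + 1) ×ˢ Finset.range (β + γ + 1) with hK
  have h1 : ∑ k ∈ K, coeff (occExp (φ k)) Q * coeff (occExp (φ k)) Q * monoNorm (occExp (φ k)) =
      bargmann Q Q := by
    rw [bargmann_apply]
    have hinj : Set.InjOn (fun k => occExp (φ k)) (K : Set (ℕ × ℕ × ℕ)) := by
      rintro ⟨x, y, z⟩ _ ⟨x', y', z'⟩ _ h
      have h1 := DFunLike.congr_fun h (0, 1)
      have h2 := DFunLike.congr_fun h (1, 1)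
      have h3 := DFunLike.congr_fun h (2, 1)
      simp [hφ] at h1 h2 h3
      simp [h1, h2, h3]
    rw [← Finset.sum_image (s := K) (g := fun k => occExp (φ k))
      (f := fun n => coeff n Q * coeff n Q * monoNorm n) hinj]
    refine (Finset.sum_subset ?_ ?_).symm
    -- A monomial that occurs is balanced, hence determined by its three numbers `n⁺`.
    · intro m hm
      rw [mem_support_iff] at hm
      set n : Fin 3 → Occ := fun i A => m (i, A) with hn
      have hmn : m = occExp n := by ext ⟨i, A⟩; rfl
      rw [hmn] at hm
      have hb : Balanced α β γ n := by
        by_contra hb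
        exact hm (coeff_bracketProd_of_not_balanced hb)
      obtain ⟨b1, b2, b3, b4⟩ := hb
      rw [Finset.mem_image]
      refine ⟨(n 0 1, n 1 1, n 2 1), ?_, ?_⟩
      · simp only [hK, Finset.mem_product, Finset.mem_range]; omega
      · rw [hmn]
        congr 1
        funext i A
        fin_cases i <;> fin_cases A <;> simp [hφ] <;> omega
    · intro m _ hm
      rw [notMem_support_iff] at hm
      simp [hm]
  have h2 : ∀ k, vertex (α + γ) (α + β) (β + γ) (φ k) ^ 2 = invNorm α β γ ^ 2 *
      (coeff (occExp (φ k)) Q * coeff (occExp (φ k)) Q * monoNorm (occExp (φ k))) := by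
    intro k
    rw [vertex_eq_wave, Pi.smul_apply, smul_eq_mul, wave, mul_pow, mul_pow, Real.sq_sqrt]
    · ring
    · exact Finset.prod_nonneg fun _ _ => by positivity
  rw [Finset.sum_congr rfl fun k _ => h2 k, ← Finset.mul_sum, h1,
    bargmann_bracketProd (by decide) (by decide) (by decide), invNorm, inv_pow,
    Real.sq_sqrt (by positivity)]
  field_simp

lemma sum_threeJ_sq {a b c : ℤ} (h : Triad a b c) :
    ∑ x ∈ Finset.range (a + 1).toNat, ∑ y ∈ Finset.range (b + 1).toNat,
      ∑ z ∈ Finset.range (c + 1).toNat,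
        threeJ a b c (2 * x - a) (2 * y - b) (2 * z - c) ^ 2 = 1 := by
  obtain ⟨α, β, γ, rfl, rfl, rfl⟩ := h.exists_nat
  rw [← sum_vertex_sq α β γ, Finset.sum_product, show ((α : ℤ) + γ + 1).toNat = α + γ + 1 by omega,
    show ((α : ℤ) + β + 1).toNat = α + β + 1 by omega,
    show ((β : ℤ) + γ + 1).toNat = β + γ + 1 by omega]
  refine Finset.sum_congr rfl fun x hx => ?_
  rw [Finset.sum_product]
  refine Finset.sum_congr rfl fun y hy => Finset.sum_congr rfl fun z hz => ?_
  simp only [Finset.mem_range] at hx hy hz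
  rw [threeJ_eq_vertex (isMagnetic_of_le (by omega)) (isMagnetic_of_le (by omega))
    (isMagnetic_of_le (by omega))]
  congr 2
  funext i A
  fin_cases i <;> fin_cases A <;> simp [occOf] <;> omega

lemma sum_magnetic_neg (a : ℤ) (f : ℤ → ℝ) :
    ∑ x ∈ Finset.range (a + 1).toNat, f (-(2 * x - a)) =
      ∑ x ∈ Finset.range (a + 1).toNat, f (2 * x - a) := by
  rw [← Finset.sum_range_reflect]
  refine Finset.sum_congr rfl fun x hx => ?_
  simp only [Finset.mem_range] at hx
  congr 1
  omega

end

/-! ### 3jm-symbols with a spin `1/2` -/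

/-- When the third spin is the sum of the other two, Racah's sum has only the term `t = 0`. -/
lemma vertex_stretched {n : Fin 3 → Occ} {β γ : ℕ} (h : Balanced 0 β γ n) :
    vertex γ β (β + γ) n = (-1) ^ (n 0 1 + n 1 0) *
      √((n 2 0).factorial * (n 2 1).factorial / ((n 0 0).factorial * (n 0 1).factorial *
        ((n 1 0).factorial * (n 1 1).factorial))) *
      √(β.factorial * γ.factorial / (β + γ + 1).factorial) := by
  have h0 := vertex_eq_wave 0 β γ
  simp only [Nat.cast_zero, zero_add] at h0
  rw [h0, Pi.smul_apply, smul_eq_mul, wave, coeff_bracketProd_of_balanced h]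
  simp only [zero_add, Finset.sum_range_one, pow_zero, Nat.cast_zero, sub_zero, add_zero,
    invFact_natCast, one_mul]
  rw [show invFact 0 = 1 by simp [invFact, fact]]
  have hm : monoNorm (occExp n) = ((n 2 0).factorial * (n 2 1).factorial : ℝ) *
      ((n 0 0).factorial * (n 0 1).factorial * ((n 1 0).factorial * (n 1 1).factorial)) := by
    simp only [monoNorm, occExp_apply, Fintype.prod_prod_type, Fin.prod_univ_three,
      Fin.prod_univ_two]
    ring
  have key : ∀ x y : ℝ, 0 < x → 0 < y → √(x * y) * y⁻¹ = √(x / y) := by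
    intro x y hx hy
    rw [Real.sqrt_mul hx.le, Real.sqrt_div hx.le, mul_assoc, ← div_eq_mul_inv, Real.sqrt_div_self,
      div_eq_mul_inv]
  have k1 := key ((n 2 0).factorial * (n 2 1).factorial) ((n 0 0).factorial * (n 0 1).factorial *
    ((n 1 0).factorial * (n 1 1).factorial)) (by positivity) (by positivity)
  have k2 : invNorm 0 β γ * (β.factorial * γ.factorial) =
      √(β.factorial * γ.factorial / (β + γ + 1).factorial) := by
    rw [invNorm, eq_comm, Real.sqrt_eq_iff_mul_self_eq (by positivity) (by positivity)]
    rw [mul_mul_mul_comm, ← mul_inv, Real.mul_self_sqrt (by positivity)]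
    simp only [Nat.factorial_zero, Nat.cast_one, one_mul, zero_add]
    field_simp
  rw [hm, ← k1, ← k2]
  simp only [Nat.factorial_zero, Nat.cast_one]
  field_simp

lemma sqrt_factorial_ratio (b : ℕ) :
    √((Nat.factorial 1 : ℝ) * b.factorial / (1 + b + 1).factorial) =
      (√(((b : ℝ) + 1) * (b + 2)))⁻¹ := by
  rw [← Real.sqrt_inv, show 1 + b + 1 = (b + 1) + 1 by ring, Nat.factorial_succ (b + 1),
    Nat.factorial_succ b]
  congr 1
  push_cast
  field_simp
  ring

lemma vertex_stretched_eq {a b c : ℤ} {n : Fin 3 → Occ} (β γ : ℕ) (h : Balanced 0 β γ n)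
    (ha : a = γ) (hb : b = β) (hc : c = β + γ) :
    vertex a b c n = (-1) ^ (n 0 1 + n 1 0) *
      √((n 2 0).factorial * (n 2 1).factorial / ((n 0 0).factorial * (n 0 1).factorial *
        ((n 1 0).factorial * (n 1 1).factorial))) *
      √(β.factorial * γ.factorial / (β + γ + 1).factorial) := by
  subst ha hb hc
  exact vertex_stretched h

lemma isMagnetic_one (A : Fin 2) : IsMagnetic 1 (-(2 * (A : ℕ) - 1)) := by
  fin_cases A <;> simp [IsMagnetic]

lemma occOf_eq {a k : ℕ} (h : k ≤ a) : occOf a (2 * k - a) = ![a - k, k] := by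
  funext A
  fin_cases A <;> simp [occOf] <;> omega

lemma occOf_neg_eq {a k : ℕ} (h : k ≤ a) : occOf a (-(2 * k - a)) = ![k, a - k] := by
  rw [occOf_neg, occOf_eq h]
  funext A
  fin_cases A <;> simp

lemma occOf_one (A : Fin 2) : occOf 1 (-(2 * (A : ℕ) - 1)) = ![(A : ℕ), 1 - (A : ℕ)] := by
  fin_cases A <;> rfl

/-- A 3jm-symbol with a spin 1/2 is, up to sign and normalisation, a matrix element of a ladder
operator. A rotation brings the largest spin to the third place, where the stretched formula
applies. -/
lemma threeJ_up {b k₀ k₁ : ℕ} (A : Fin 2) (h₀ : k₀ ≤ b + 1) (h₁ : k₁ ≤ b) :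
    threeJ (b + 1) b 1 (-(2 * k₀ - (b + 1))) (-(2 * k₁ - b)) (-(2 * (A : ℕ) - 1)) =
      if k₀ + k₁ + A = b + 1 then
        (-1) ^ (b + k₁ + A) * √((![k₀, b + 1 - k₀] A : ℕ) : ℝ) *
          (√(((b : ℝ) + 1) * (b + 2)))⁻¹ else 0 := by
  split_ifs with h
  · have e0 := occOf_neg_eq h₀
    push_cast at e0
    rw [threeJ_rotate, threeJ_eq_vertex (isMagnetic_of_le (by omega)).neg (isMagnetic_one A)
      (isMagnetic_of_le (by omega)).neg, occOf_neg_eq h₁, e0, occOf_one]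
    rw [vertex_stretched_eq 1 b _ rfl (by norm_num) (by push_cast; ring), sqrt_factorial_ratio]
    · obtain ⟨l, rfl⟩ := Nat.exists_eq_add_of_le h₁
      congr 1
      fin_cases A
      · obtain rfl : k₀ = l + 1 := by simp at h; omega
        have e1 : k₁ + l + 1 - (l + 1) = k₁ := by omega
        simp [e1]
        congr 1
        · rw [show k₁ + l + k₁ = l + 2 * k₁ by ring]; simp [pow_add]
        · congr 1
          rw [Nat.factorial_succ]; push_cast; field_simp
      · obtain rfl : k₀ = l := by simp at h; omega
        have e1 : k₁ + k₀ + 1 - k₀ = k₁ + 1 := by omega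
        simp [e1]
        congr 1
        · rw [show k₁ + k₀ + k₁ + 1 = k₀ + 1 + 2 * k₁ by ring, pow_add _ _ (2 * k₁)]; simp
        · congr 1
          rw [Nat.factorial_succ]; push_cast; field_simp
    · fin_cases A <;> simp [Balanced] at h ⊢ <;> omega
  · apply threeJ_eq_zero_of_sum
    omega

lemma threeJ_down {a k₀ k₁ : ℕ} (A : Fin 2) (h₀ : k₀ ≤ a) (h₁ : k₁ ≤ a + 1) :
    threeJ a (a + 1) 1 (-(2 * k₀ - a)) (-(2 * k₁ - (a + 1))) (-(2 * (A : ℕ) - 1)) =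
      if k₀ + k₁ + A = a + 1 then
        (-1) ^ (k₀ + 1 + A) * √((![k₀, a - k₀] (Fin.rev A) : ℕ) + 1 : ℝ) *
          (√(((a : ℝ) + 1) * (a + 2)))⁻¹ else 0 := by
  split_ifs with h
  · have e0 := occOf_neg_eq h₁
    push_cast at e0
    rw [← threeJ_rotate, threeJ_eq_vertex (isMagnetic_one A) (isMagnetic_of_le (by omega)).neg
      (isMagnetic_of_le (by omega)).neg, occOf_neg_eq h₀, e0, occOf_one]
    rw [vertex_stretched_eq a 1 _ (by norm_num) rfl (by push_cast; ring),
      mul_comm (a.factorial : ℝ), add_comm a 1, sqrt_factorial_ratio]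
    · obtain ⟨l, rfl⟩ := Nat.exists_eq_add_of_le h₀
      congr 1
      fin_cases A
      · obtain rfl : k₁ = l + 1 := by simp at h; omega
        have e1 : 1 + (k₀ + l) - (l + 1) = k₀ := by omega
        simp [e1]
        congr 1
        · ring
        · congr 1
          rw [Nat.factorial_succ]; push_cast; field_simp
      · obtain rfl : k₁ = l := by simp at h; omega
        have e1 : 1 + (k₀ + k₁) - k₁ = k₀ + 1 := by omega
        simp [e1]
        congr 1
        · ring
        · congr 1
          rw [Nat.factorial_succ]; push_cast; field_simp
    · fin_cases A <;> simp [Balanced] at h ⊢ <;> omega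
  · apply threeJ_eq_zero_of_sum
    omega

/-! ### Phases, and the 6j-symbol as an iterated sum -/

lemma phase_add (m n : ℤ) : phase (m + n) = phase m * phase n :=
  zpow_add₀ (by norm_num) m n

lemma phase_natCast (n : ℕ) : phase n = (-1) ^ n := zpow_natCast _ n

lemma phase_congr {m n : ℤ} (h : Even (m - n)) : phase m = phase n := by
  rw [show m = (m - n) + n by ring, phase_add, phase, h.neg_one_zpow, one_mul]

lemma phase_mul_self (n : ℤ) : phase n * phase n = 1 := by
  rw [← phase_add, phase, Even.neg_one_zpow ⟨n, rfl⟩]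

/-- The summand of the 6j-symbol with doubled spins `a, …, f`. -/
def sixJTerm (a b c d e f : ℤ) (k₀ k₁ k₂ k₃ k₄ k₅ : ℕ) : ℝ :=
  phase ((a - k₀) + (b - k₁) + (c - k₂) + (d - k₃) + (e - k₄) + (f - k₅)) *
    threeJ a b c (-(2 * k₀ - a)) (-(2 * k₁ - b)) (-(2 * k₂ - c)) *
    threeJ a e f (2 * k₀ - a) (-(2 * k₄ - e)) (2 * k₅ - f) *
    threeJ d b f (2 * k₃ - d) (2 * k₁ - b) (-(2 * k₅ - f)) *
    threeJ d e c (-(2 * k₃ - d)) (2 * k₄ - e) (2 * k₂ - c)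

/-- The outer sums run over the magnetic numbers of the vertex `(a, e, f)`, whose squared norm is
what remains after the inner sums when `c` is a spin 1/2. -/
lemma sixJ_eq_sum (a b c d e f : ℤ) :
    sixJ a b c d e f =
      ∑ k₀ ∈ Finset.range (a + 1).toNat, ∑ k₄ ∈ Finset.range (e + 1).toNat,
      ∑ k₅ ∈ Finset.range (f + 1).toNat, ∑ k₂ ∈ Finset.range (c + 1).toNat,
      ∑ k₁ ∈ Finset.range (b + 1).toNat, ∑ k₃ ∈ Finset.range (d + 1).toNat,
        sixJTerm a b c d e f k₀ k₁ k₂ k₃ k₄ k₅ := by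
  simp only [← Finset.sum_product']
  refine Finset.sum_nbij' (fun k => (k 0, k 4, k 5, k 2, k 1, k 3))
    (fun x => ![x.1, x.2.2.2.2.1, x.2.2.2.1, x.2.2.2.2.2, x.2.1, x.2.2.1]) ?_ ?_ ?_ ?_ ?_
  · intro k hk
    simp only [Fintype.mem_piFinset, Fin.forall_fin_succ] at hk
    simp at hk ⊢
    tauto
  · intro x hx
    simp only [Fintype.mem_piFinset, Fin.forall_fin_succ]
    simp at hx ⊢
    tauto
  · intro k _
    funext i
    fin_cases i <;> rfl
  · intro x _
    rfl
  · intro k _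
    simp [sixJTerm, Fin.sum_univ_succ]
    ring_nf
    tauto

lemma sixJ_eq_zero_of_neg {a b c d e f : ℤ}
    (h : a < 0 ∨ b < 0 ∨ c < 0 ∨ d < 0 ∨ e < 0 ∨ f < 0) : sixJ a b c d e f = 0 := by
  have hz : ∀ {x : ℤ}, x < 0 → (x + 1).toNat = 0 := fun hx => by omega
  rw [sixJ_eq_sum]
  rcases h with h | h | h | h | h | h <;> simp [hz h]

lemma sixJ_eq_zero_of_triad {a b c d e f : ℤ}
    (h : ¬ (Triad a b c ∧ Triad a e f ∧ Triad d b f ∧ Triad d e c)) : sixJ a b c d e f = 0 := by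
  rw [sixJ_eq_sum]
  refine Finset.sum_eq_zero fun _ _ => Finset.sum_eq_zero fun _ _ => Finset.sum_eq_zero fun _ _ =>
    Finset.sum_eq_zero fun _ _ => Finset.sum_eq_zero fun _ _ => Finset.sum_eq_zero fun _ _ => ?_
  rw [sixJTerm]
  by_cases h1 : Triad a b c
  · by_cases h2 : Triad a e f
    · by_cases h3 : Triad d b f
      · rw [threeJ_eq_zero_of_triad (a := d) (b := e) (c := c) (by tauto), mul_zero]
      · rw [threeJ_eq_zero_of_triad h3, mul_zero, zero_mul]
    · rw [threeJ_eq_zero_of_triad h2, mul_zero, zero_mul, zero_mul]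
  · rw [threeJ_eq_zero_of_triad h1, mul_zero, zero_mul, zero_mul, zero_mul]

/-- Exchange two columns upside down and reverse the magnetic numbers on all links except the first
and the fourth: the four vertices are permuted. -/
lemma sixJ_rows_swap (a b c d e f : ℤ) :
    sixJ a b c d e f = sixJ d e c a b f := by
  rw [sixJ_eq_sum, sixJ_eq_sum]
  simp only [← Finset.sum_product']
  refine Finset.sum_nbij'
    (fun x => (x.2.2.2.2.2, b.toNat - x.2.2.2.2.1, f.toNat - x.2.2.1, c.toNat - x.2.2.2.1,
      e.toNat - x.2.1, x.1))
    (fun x => (x.2.2.2.2.2, e.toNat - x.2.2.2.2.1, f.toNat - x.2.2.1, c.toNat - x.2.2.2.1,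
      b.toNat - x.2.1, x.1)) ?_ ?_ ?_ ?_ ?_
  · intro x hx
    simp only [Finset.mem_product, Finset.mem_range] at hx ⊢
    omega
  · intro x hx
    simp only [Finset.mem_product, Finset.mem_range] at hx ⊢
    omega
  · rintro ⟨x₁, x₂, x₃, x₄, x₅, x₆⟩ hx
    simp only [Finset.mem_product, Finset.mem_range] at hx
    simp only [Prod.mk.injEq, true_and, and_true]
    omega
  · rintro ⟨x₁, x₂, x₃, x₄, x₅, x₆⟩ hx
    simp only [Finset.mem_product, Finset.mem_range] at hx
    simp only [Prod.mk.injEq, true_and, and_true]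
    omega
  · rintro ⟨k₀, k₄, k₅, k₂, k₁, k₃⟩ hx
    simp only [Finset.mem_product, Finset.mem_range] at hx
    have e1 : ((b.toNat - k₁ : ℕ) : ℤ) = b - k₁ := by omega
    have e4 : ((e.toNat - k₄ : ℕ) : ℤ) = e - k₄ := by omega
    have e2 : ((c.toNat - k₂ : ℕ) : ℤ) = c - k₂ := by omega
    have e5 : ((f.toNat - k₅ : ℕ) : ℤ) = f - k₅ := by omega
    simp only [sixJTerm, e1, e2, e4, e5]
    -- The phases agree only modulo conservation at two vertices; where that fails both summands
    -- vanish.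
    by_cases h0 : -(2 * k₀ - a) + -(2 * k₁ - b) + -(2 * k₂ - c) = 0
    swap
    · rw [threeJ_eq_zero_of_sum h0,
        threeJ_eq_zero_of_sum (a := a) (b := b) (c := c) (by intro hh; apply h0; linarith)]
      ring
    by_cases h1 : (2 * k₀ - a) + -(2 * k₄ - e) + (2 * k₅ - f) = 0
    swap
    · rw [threeJ_eq_zero_of_sum h1,
        threeJ_eq_zero_of_sum (a := a) (b := e) (c := f) (by intro hh; apply h1; linarith)]
      ring
    have hp : phase ((a - k₀) + (b - k₁) + (c - k₂) + (d - k₃) + (e - k₄) + (f - k₅)) =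
        phase ((d - k₃) + (e - (e - k₄)) + (c - (c - k₂)) + (a - k₀) + (b - (b - k₁)) +
          (f - (f - k₅))) := by
      apply phase_congr
      exact ⟨f - 2 * k₅, by linarith⟩
    rw [hp]
    ring_nf

lemma fin_two_cases (A : Fin 2) : A = 0 ∨ A = 1 := by omega

/-- This is `threeJ_up` with `k₁ = e - k₄` and the opposite spinor index `B`. -/
lemma threeJ_up_right {e k₃ k₄ : ℕ} (A : Fin 2) (h₃ : k₃ ≤ e + 1) (h₄ : k₄ ≤ e) :
    threeJ (e + 1) e 1 (-(2 * k₃ - (e + 1))) (2 * k₄ - e) (2 * (A : ℕ) - 1) =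
      if k₃ = k₄ + A then
        (-1) ^ (k₄ + 1 + A) * √((![e - k₄, k₄] A : ℕ) + 1 : ℝ) *
          (√(((e : ℝ) + 1) * (e + 2)))⁻¹ else 0 := by
  obtain ⟨B, hAB⟩ : ∃ B : Fin 2, A = 0 ∧ B = 1 ∨ A = 1 ∧ B = 0 := by
    rcases fin_two_cases A with rfl | rfl
    · exact ⟨1, by simp⟩
    · exact ⟨0, by simp⟩
  have h := threeJ_up (b := e) (k₁ := e - k₄) B h₃ (by omega)
  rw [show (-(2 * ((e - k₄ : ℕ) : ℤ) - e)) = 2 * k₄ - e by push_cast [h₄]; ring,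
    show (-(2 * ((B : ℕ) : ℤ) - 1)) = 2 * (A : ℕ) - 1 by
      rcases hAB with ⟨rfl, rfl⟩ | ⟨rfl, rfl⟩ <;> simp] at h
  rw [h]
  have hc : k₃ + (e - k₄) + B = e + 1 ↔ k₃ = k₄ + A := by
    have : (A : ℕ) + B = 1 := by rcases hAB with ⟨rfl, rfl⟩ | ⟨rfl, rfl⟩ <;> rfl
    omega
  rw [if_congr hc rfl rfl]
  split_ifs with hk
  · subst hk
    obtain ⟨l, rfl⟩ := Nat.exists_eq_add_of_le h₄
    congr 1
    rcases hAB with ⟨rfl, rfl⟩ | ⟨rfl, rfl⟩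
    · have e1 : k₄ + l + 1 - k₄ = l + 1 := by omega
      simp [e1]
      left
      rw [show k₄ + l + l + 1 = k₄ + 1 + 2 * l by ring, pow_add _ _ (2 * l)]
      simp
    · simp
      left
      rw [show k₄ + l + l = k₄ + 1 + 1 + 2 * l - 2 by omega, neg_one_pow_congr]
      grind
  · rfl

lemma vertex_eq_threeJ_nat {a b c i j k : ℕ} (hi : i ≤ a) (hj : j ≤ b) (hk : k ≤ c) :
    threeJ a b c (2 * i - a) (2 * j - b) (-(2 * k - c)) =
      vertex a b c ![![a - i, i], ![b - j, j], ![k, c - k]] := by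
  rw [threeJ_eq_vertex (isMagnetic_of_le (by omega)) (isMagnetic_of_le (by omega))
    (isMagnetic_of_le (by omega)).neg, occOf_eq hi, occOf_eq hj, occOf_neg_eq hk]

/-! ### 6j-symbols with a spin 1/2 -/

/-- The two 3jm-symbols containing the spin 1/2 are ladder matrix elements, so summing over its
index `A` applies a transfer to the neighbouring vertex. -/
lemma sum_sixJTerm_up {b e f k₀ k₄ k₅ : ℕ} (h₀ : k₀ ≤ b + 1) (h₄ : k₄ ≤ e) (h₅ : k₅ ≤ f) :
    ∑ A : Fin 2, ∑ k₁ ∈ Finset.range (b + 1), ∑ k₃ ∈ Finset.range (e + 2),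
        sixJTerm (b + 1) b 1 (e + 1) e f k₀ k₁ A k₃ k₄ k₅ =
      (√(((b : ℝ) + 1) * (b + 2)))⁻¹ * (√(((e : ℝ) + 1) * (e + 2)))⁻¹ *
        (-phase (((b : ℤ) + e + f + 1) / 2)) *
        (threeJ (b + 1) e f (2 * k₀ - (b + 1)) (-(2 * k₄ - e)) (2 * k₅ - f) *
          transfer 1 0 (vertex (e + 1) b f) ![![e - k₄, k₄], ![k₀, b + 1 - k₀], ![k₅, f - k₅]]) := by
  by_cases hs : (2 * k₀ - (b + 1)) + (-(2 * k₄ - e)) + (2 * k₅ - f) = (0 : ℤ)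
  swap
  · simp only [sixJTerm, threeJ_eq_zero_of_sum hs, mul_zero, zero_mul, Finset.sum_const_zero]
  rw [transfer, Finset.sum_apply, Finset.mul_sum, Finset.mul_sum]
  refine Finset.sum_congr rfl fun A _ => ?_
  simp only [sixJTerm, legRaise, legLower]
  by_cases hk : 1 ≤ ![k₀, b + 1 - k₀] A
  · have hA : k₀ + (b + 1 - A - k₀) + A = b + 1 ∧ b + 1 - A - k₀ ≤ b := by
      rcases fin_two_cases A with rfl | rfl
      · have hk : 1 ≤ k₀ := hk
        rw [show ((0 : Fin 2) : ℕ) = 0 from rfl]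
        omega
      · have hk : 1 ≤ b + 1 - k₀ := hk
        rw [show ((1 : Fin 2) : ℕ) = 1 from rfl]
        omega
    have hA4 : k₄ + A ≤ e + 1 := by have := A.2; omega
    -- Conservation at the two spin-1/2 vertices fixes `k₁` and `k₃`.
    rw [Finset.sum_eq_single (b + 1 - A - k₀), Finset.sum_eq_single (k₄ + A)]
    · rw [threeJ_up A h₀ hA.2, threeJ_up_right A hA4 h₄, if_pos hA.1, if_pos rfl]
      have hv := vertex_eq_threeJ_nat hA4 hA.2 h₅
      simp only [Nat.cast_add, Nat.cast_one] at hv ⊢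
      rw [hv]
      have hph : phase ((b : ℤ) + 1 - k₀ + (b - ((b + 1 - A - k₀ : ℕ) : ℤ)) + (1 - (A : ℕ)) +
          (e + 1 - (k₄ + (A : ℕ))) + (e - k₄) + (f - k₅)) *
          (-1) ^ (b + (b + 1 - A - k₀) + A) * (-1) ^ (k₄ + 1 + A) =
          -phase (((b : ℤ) + e + f + 1) / 2) := by
        rw [← phase_natCast, ← phase_natCast, ← phase_add, ← phase_add,
          show -phase (((b : ℤ) + e + f + 1) / 2) = phase (((b : ℤ) + e + f + 1) / 2 + 1) by
            rw [phase_add]; simp [phase]]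
        apply phase_congr
        obtain ⟨s, hs⟩ : ∃ s : ℤ, (b : ℤ) + e + f + 1 = 2 * s := ⟨b + 1 + k₄ + f - k₀ - k₅, by omega⟩
        rw [hs, Int.mul_ediv_cancel_left _ (by norm_num)]
        refine ⟨b + e + 1 - k₄, ?_⟩
        simp only [Nat.cast_add, Nat.cast_one]
        omega
      have hu : Function.update (Function.update
          (![![e - k₄, k₄], ![k₀, b + 1 - k₀], ![k₅, f - k₅]] : Fin 3 → Occ) 1
          (Function.update ![k₀, b + 1 - k₀] A (![k₀, b + 1 - k₀] A - 1))) 0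
          (Function.update ![e - k₄, k₄] A (![e - k₄, k₄] A + 1)) =
          ![![e + 1 - (k₄ + A), k₄ + A], ![b - (b + 1 - A - k₀), b + 1 - A - k₀], ![k₅, f - k₅]] := by
        funext i C
        fin_cases i
        · rcases fin_two_cases A with rfl | rfl <;> rcases fin_two_cases C with rfl | rfl <;>
            simp [-Nat.reduceEqDiff, -Nat.reduceSubDiff] <;> omega
        · rcases fin_two_cases A with rfl | rfl <;> rcases fin_two_cases C with rfl | rfl <;>
            simp [-Nat.reduceEqDiff, -Nat.reduceSubDiff] at hk ⊢ <;> omega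
        · simp
      simp only [Matrix.cons_val_one, Matrix.cons_val_zero, Function.update_of_ne, ne_eq,
        zero_ne_one, not_false_eq_true]
      rw [hu]
      linear_combination (√((![k₀, b + 1 - k₀] A : ℕ) : ℝ) * (√(((b : ℝ) + 1) * (b + 2)))⁻¹ *
        √((![e - k₄, k₄] A : ℕ) + 1 : ℝ) * (√(((e : ℝ) + 1) * (e + 2)))⁻¹ *
        threeJ (b + 1) e f (2 * k₀ - (b + 1)) (-(2 * k₄ - e)) (2 * k₅ - f) *
        vertex (e + 1) b f ![![e + 1 - (k₄ + A), k₄ + A],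
          ![b - (b + 1 - A - k₀), b + 1 - A - k₀], ![k₅, f - k₅]]) * hph
    · intro k₃ hk₃ hne
      rw [Finset.mem_range] at hk₃
      rw [threeJ_up_right A (by omega) h₄, if_neg hne, mul_zero]
    · intro hh
      rw [Finset.mem_range] at hh
      omega
    · intro k₁ hk₁ hne
      rw [Finset.mem_range] at hk₁
      rw [threeJ_up A h₀ (by omega), if_neg (by omega)]
      simp only [mul_zero, zero_mul, Finset.sum_const_zero]
    · intro hh
      rw [Finset.mem_range] at hh
      omega
  -- With no quantum of type `A` on the leg, the ladder weight is `√0` on both sides.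
  · have hz : ![k₀, b + 1 - k₀] A = 0 := by omega
    have hz' : (![![e - k₄, k₄], ![k₀, b + 1 - k₀], ![k₅, f - k₅]] : Fin 3 → Occ) 1 A = 0 := hz
    rw [hz', Finset.sum_eq_zero]
    · simp
    · intro k₁ hk₁
      refine Finset.sum_eq_zero fun k₃ _ => ?_
      rw [Finset.mem_range] at hk₁
      rw [threeJ_up A h₀ (by omega), hz]
      simp only [Nat.cast_zero, Real.sqrt_zero, mul_zero, zero_mul, ite_self]

lemma lowerPair_apply (f : (Fin 3 → Occ) → ℝ) (p q r : Occ) :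
    lowerPair 0 1 f ![p, q, r] = ∑ A : Fin 2, (-1) ^ (A : ℕ) *
      (√((p A : ℝ) + 1) * (√((q (Fin.rev A) : ℝ) + 1) *
        f ![Function.update p A (p A + 1),
          Function.update q (Fin.rev A) (q (Fin.rev A) + 1), r])) := by
  rw [lowerPair, Finset.sum_apply, ← Equiv.sum_comp Fin.revPerm]
  refine Finset.sum_congr rfl fun A _ => ?_
  have h1 : sgn (Fin.rev A) = (-1) ^ (A : ℕ) := by
    rcases fin_two_cases A with rfl | rfl
    · rw [show Fin.rev (0 : Fin 2) = 1 from rfl]; simp [sgn]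
    · rw [show Fin.rev (1 : Fin 2) = 0 from rfl]; simp [sgn]
  have h2 : Function.update (Function.update (![p, q, r] : Fin 3 → Occ) 0
      (Function.update p A (p A + 1))) 1 (Function.update q (Fin.rev A) (q (Fin.rev A) + 1)) =
      ![Function.update p A (p A + 1), Function.update q (Fin.rev A) (q (Fin.rev A) + 1), r] := by
    funext i
    fin_cases i <;> rfl
  simp only [Fin.revPerm_apply, Pi.smul_apply, smul_eq_mul, legLower, Fin.rev_rev,
    Matrix.cons_val_zero, Matrix.cons_val_one, Function.update_of_ne, ne_eq, one_ne_zero,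
    not_false_eq_true, h1, h2]

/-- Now both ladder elements lower a leg of the neighbouring vertex, and their relative sign `(-1) ^
A` makes the sum the antisymmetric pairing. -/
lemma sum_sixJTerm_down {a e f k₀ k₄ k₅ : ℕ} (h₀ : k₀ ≤ a) (h₄ : k₄ ≤ e) (h₅ : k₅ ≤ f) :
    ∑ A : Fin 2, ∑ k₁ ∈ Finset.range (a + 2), ∑ k₃ ∈ Finset.range (e + 2),
        sixJTerm a (a + 1) 1 (e + 1) e f k₀ k₁ A k₃ k₄ k₅ =
      (√(((a : ℝ) + 1) * (a + 2)))⁻¹ * (√(((e : ℝ) + 1) * (e + 2)))⁻¹ *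
        phase (((a : ℤ) + e + f) / 2) *
        (threeJ a e f (2 * k₀ - a) (-(2 * k₄ - e)) (2 * k₅ - f) *
          lowerPair 0 1 (vertex (e + 1) (a + 1) f)
            ![![e - k₄, k₄], ![k₀, a - k₀], ![k₅, f - k₅]]) := by
  by_cases hs : (2 * k₀ - a) + (-(2 * k₄ - e)) + (2 * k₅ - f) = (0 : ℤ)
  swap
  · simp only [sixJTerm, threeJ_eq_zero_of_sum hs, mul_zero, zero_mul, Finset.sum_const_zero]
  rw [lowerPair_apply, Finset.mul_sum, Finset.mul_sum]
  refine Finset.sum_congr rfl fun A _ => ?_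
  simp only [sixJTerm]
  have hA : k₀ + (a + 1 - A - k₀) + A = a + 1 ∧ a + 1 - A - k₀ ≤ a + 1 := by
    have := A.2; omega
  have hA4 : k₄ + A ≤ e + 1 := by have := A.2; omega
  rw [Finset.sum_eq_single (a + 1 - A - k₀), Finset.sum_eq_single (k₄ + A)]
  · rw [threeJ_down A h₀ hA.2, threeJ_up_right A hA4 h₄, if_pos hA.1, if_pos rfl]
    have hv := vertex_eq_threeJ_nat hA4 hA.2 h₅
    simp only [Nat.cast_add, Nat.cast_one] at hv ⊢
    rw [hv]
    have hph : phase ((a : ℤ) - k₀ + (a + 1 - ((a + 1 - A - k₀ : ℕ) : ℤ)) + (1 - (A : ℕ)) +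
        (e + 1 - (k₄ + (A : ℕ))) + (e - k₄) + (f - k₅)) *
        (-1) ^ (k₀ + 1 + A) * (-1) ^ (k₄ + 1 + A) =
        phase (((a : ℤ) + e + f) / 2) * (-1) ^ (A : ℕ) := by
      rw [← phase_natCast, ← phase_natCast, ← phase_natCast, ← phase_add, ← phase_add,
        ← phase_add]
      apply phase_congr
      obtain ⟨s, hs⟩ : ∃ s : ℤ, (a : ℤ) + e + f = 2 * s := ⟨a + k₄ + f - k₀ - k₅, by omega⟩
      rw [hs, Int.mul_ediv_cancel_left _ (by norm_num)]
      refine ⟨e + 2 - k₄ + k₀, ?_⟩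
      simp only [Nat.cast_add, Nat.cast_one]
      omega
    have hu1 : Function.update ![e - k₄, k₄] A (![e - k₄, k₄] A + 1) =
        ![e + 1 - (k₄ + A), k₄ + A] := by
      funext C
      rcases fin_two_cases A with rfl | rfl <;> rcases fin_two_cases C with rfl | rfl <;>
        simp <;> omega
    have hu2 : Function.update ![k₀, a - k₀] (Fin.rev A) (![k₀, a - k₀] (Fin.rev A) + 1) =
        ![a + 1 - (a + 1 - A - k₀), a + 1 - A - k₀] := by
      funext C
      rcases fin_two_cases A with rfl | rfl
      · rw [show Fin.rev (0 : Fin 2) = 1 from rfl]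
        rcases fin_two_cases C with rfl | rfl <;> simp <;> omega
      · rw [show Fin.rev (1 : Fin 2) = 0 from rfl]
        rcases fin_two_cases C with rfl | rfl <;> simp <;> omega
    rw [hu1, hu2]
    linear_combination (√((![k₀, a - k₀] (Fin.rev A) : ℕ) + 1 : ℝ) *
      (√(((a : ℝ) + 1) * (a + 2)))⁻¹ *
      √((![e - k₄, k₄] A : ℕ) + 1 : ℝ) * (√(((e : ℝ) + 1) * (e + 2)))⁻¹ *
      threeJ a e f (2 * k₀ - a) (-(2 * k₄ - e)) (2 * k₅ - f) *
      vertex (e + 1) (a + 1) f ![![e + 1 - (k₄ + A), k₄ + A],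
        ![a + 1 - (a + 1 - A - k₀), a + 1 - A - k₀], ![k₅, f - k₅]]) * hph
  · intro k₃ hk₃ hne
    rw [Finset.mem_range] at hk₃
    rw [threeJ_up_right A (by omega) h₄, if_neg hne, mul_zero]
  · intro hh
    rw [Finset.mem_range] at hh
    omega
  · intro k₁ hk₁ hne
    rw [Finset.mem_range] at hk₁
    rw [threeJ_down A h₀ (by omega), if_neg (by omega)]
    simp only [mul_zero, zero_mul, Finset.sum_const_zero]
  · intro hh
    rw [Finset.mem_range] at hh
    omega

lemma sum_threeJ_sq_neg {a b c : ℤ} (h : Triad a b c) :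
    ∑ x ∈ Finset.range (a + 1).toNat, ∑ y ∈ Finset.range (b + 1).toNat,
      ∑ z ∈ Finset.range (c + 1).toNat,
        threeJ a b c (2 * x - a) (-(2 * y - b)) (2 * z - c) ^ 2 = 1 := by
  rw [← sum_threeJ_sq h]
  refine Finset.sum_congr rfl fun x _ => ?_
  exact sum_magnetic_neg b fun y => ∑ z ∈ Finset.range (c + 1).toNat,
    threeJ a b c (2 * x - a) y (2 * z - c) ^ 2

/-- The grasped vertex coincides with the remaining one without any phase, so the outer sum becomes
a sum of squares. -/
lemma vertex_eq_threeJ_swap {a e f k₀ k₄ k₅ : ℕ} (h₀ : k₀ ≤ a) (h₄ : k₄ ≤ e) (h₅ : k₅ ≤ f) :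
    vertex e a f ![![e - k₄, k₄], ![k₀, a - k₀], ![k₅, f - k₅]] =
      threeJ a e f (2 * k₀ - a) (-(2 * k₄ - e)) (2 * k₅ - f) := by
  rw [threeJ_swap_neg, neg_neg, threeJ_eq_vertex (isMagnetic_of_le (by omega))
    (isMagnetic_of_le (by omega)).neg (isMagnetic_of_le (by omega)).neg, occOf_eq h₄,
    occOf_neg_eq h₀, occOf_neg_eq h₅]

/-- The 6j-symbol which raises the spin `b` while lowering the spin `d`. -/
lemma sixJ_raise_lower {b d f : ℤ} (h : Triad d b f) (hd : 0 < d) :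
    sixJ (b + 1) b 1 d (d - 1) f = phase ((b + d + f) / 2) *
      √((spin d - spin b + spin f) * (-spin d + spin b + spin f + 1)) *
      ((√(((b : ℝ) + 1) * (b + 2)))⁻¹ * (√((d : ℝ) * (d + 1)))⁻¹) := by
  obtain ⟨b, rfl⟩ := Int.eq_ofNat_of_zero_le (show 0 ≤ b by have := h.2; omega)
  obtain ⟨f, rfl⟩ := Int.eq_ofNat_of_zero_le (show 0 ≤ f by have := h.2; omega)
  obtain ⟨e, rfl⟩ : ∃ e : ℕ, d = e + 1 := ⟨(d - 1).toNat, by omega⟩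
  have ht := transfer_vertex_rev h
  rw [sixJ_eq_sum]
  simp only [add_sub_cancel_right]
  rw [show ((b : ℤ) + 1 + 1).toNat = b + 2 by omega, show ((e : ℤ) + 1).toNat = e + 1 by omega,
    show ((f : ℤ) + 1).toNat = f + 1 by omega, show ((b : ℤ) + 1).toNat = b + 1 by omega,
    show ((e : ℤ) + 1 + 1).toNat = e + 2 by omega, show ((1 : ℤ) + 1).toNat = 2 by rfl]
  set w := √((spin (e + 1) - spin b + spin f) * (-spin (e + 1) + spin b + spin f + 1)) with hw
  have key : ∀ k₀ ∈ Finset.range (b + 2), ∀ k₄ ∈ Finset.range (e + 1), ∀ k₅ ∈ Finset.range (f + 1),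
      ∑ k₂ ∈ Finset.range 2, ∑ k₁ ∈ Finset.range (b + 1), ∑ k₃ ∈ Finset.range (e + 2),
        sixJTerm (b + 1) b 1 (e + 1) e f k₀ k₁ k₂ k₃ k₄ k₅ =
      (√(((b : ℝ) + 1) * (b + 2)))⁻¹ * (√(((e : ℝ) + 1) * (e + 2)))⁻¹ *
        phase (((b : ℤ) + e + f + 1) / 2) * w *
        threeJ (b + 1 : ℤ) e f (2 * k₀ - (b + 1 : ℤ)) (-(2 * k₄ - e)) (2 * k₅ - f) ^ 2 := by
    intro k₀ hk₀ k₄ hk₄ k₅ hk₅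
    rw [Finset.mem_range] at hk₀ hk₄ hk₅
    rw [Finset.sum_range, sum_sixJTerm_up (by omega) (by omega) (by omega), ht]
    have hv := vertex_eq_threeJ_swap (show k₀ ≤ b + 1 by omega) (show k₄ ≤ e by omega)
      (show k₅ ≤ f by omega)
    simp only [Nat.cast_add, Nat.cast_one] at hv
    rw [Pi.smul_apply, add_sub_cancel_right, hv, smul_eq_mul]
    ring
  rw [Finset.sum_congr rfl fun k₀ h₀ => Finset.sum_congr rfl fun k₄ h₄ =>
    Finset.sum_congr rfl fun k₅ h₅ => key k₀ h₀ k₄ h₄ k₅ h₅]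
  simp only [← Finset.mul_sum]
  have hc : (((e : ℤ) + 1 : ℤ) : ℝ) * (((e : ℤ) + 1 : ℤ) + 1) = ((e : ℝ) + 1) * (e + 2) := by
    push_cast; ring
  rw [hc, show (b : ℤ) + (e + 1) + f = b + e + f + 1 by ring]
  by_cases hT : Triad (b + 1) e f
  · have hs := sum_threeJ_sq_neg hT
    rw [show ((b : ℤ) + 1 + 1).toNat = b + 2 by omega, show ((e : ℤ) + 1).toNat = e + 1 by omega,
      show ((f : ℤ) + 1).toNat = f + 1 by omega] at hs
    rw [hs]
    push_cast
    ring
  -- If the outer spins are not a triad, then `d + f = b` and the ladder weight vanishes.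
  · have hw0 : w = 0 := by
      obtain ⟨⟨s, hs⟩, h1, h2, h3⟩ := h
      have : (e : ℤ) + 1 + f = b := by
        by_contra hne
        exact hT ⟨⟨s, by omega⟩, by omega, by omega, by omega⟩
      have h0 : spin ((e : ℤ) + 1) - spin b + spin f = 0 := by
        rw [← this]; simp only [spin]; push_cast; ring
      rw [hw, h0, zero_mul, Real.sqrt_zero]
    rw [hw0]
    ring

/-- The 6j-symbol which lowers the spins `b` and `d`. -/
lemma sixJ_lower_lower {b d f : ℤ} (h : Triad d b f) (hb : 0 < b) (hd : 0 < d) :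
    sixJ (b - 1) b 1 d (d - 1) f = phase ((b + d + f) / 2) *
      √((spin d + spin b - spin f) * (spin d + spin b + spin f + 1)) *
      ((√((b : ℝ) * (b + 1)))⁻¹ * (√((d : ℝ) * (d + 1)))⁻¹) := by
  obtain ⟨f, rfl⟩ := Int.eq_ofNat_of_zero_le (show 0 ≤ f by have := h.2; omega)
  obtain ⟨e, rfl⟩ : ∃ e : ℕ, d = e + 1 := ⟨(d - 1).toNat, by omega⟩
  obtain ⟨a, rfl⟩ : ∃ a : ℕ, b = a + 1 := ⟨(b - 1).toNat, by omega⟩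
  have ht := lowerPair_vertex h
  rw [sixJ_eq_sum]
  simp only [add_sub_cancel_right]
  rw [show ((a : ℤ) + 1 + 1).toNat = a + 2 by omega, show ((e : ℤ) + 1).toNat = e + 1 by omega,
    show ((f : ℤ) + 1).toNat = f + 1 by omega, show ((a : ℤ) + 1).toNat = a + 1 by omega,
    show ((e : ℤ) + 1 + 1).toNat = e + 2 by omega, show ((1 : ℤ) + 1).toNat = 2 by rfl]
  set w := √((spin (e + 1) + spin (a + 1) - spin f) * (spin (e + 1) + spin (a + 1) + spin f + 1))
    with hw
  have key : ∀ k₀ ∈ Finset.range (a + 1), ∀ k₄ ∈ Finset.range (e + 1), ∀ k₅ ∈ Finset.range (f + 1),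
      ∑ k₂ ∈ Finset.range 2, ∑ k₁ ∈ Finset.range (a + 2), ∑ k₃ ∈ Finset.range (e + 2),
        sixJTerm a (a + 1) 1 (e + 1) e f k₀ k₁ k₂ k₃ k₄ k₅ =
      (√(((a : ℝ) + 1) * (a + 2)))⁻¹ * (√(((e : ℝ) + 1) * (e + 2)))⁻¹ *
        (-phase (((a : ℤ) + e + f) / 2)) * w *
        threeJ a e f (2 * k₀ - a) (-(2 * k₄ - e)) (2 * k₅ - f) ^ 2 := by
    intro k₀ hk₀ k₄ hk₄ k₅ hk₅
    rw [Finset.mem_range] at hk₀ hk₄ hk₅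
    rw [Finset.sum_range, sum_sixJTerm_down (by omega) (by omega) (by omega), ht]
    have hv := vertex_eq_threeJ_swap (show k₀ ≤ a by omega) (show k₄ ≤ e by omega)
      (show k₅ ≤ f by omega)
    rw [Pi.smul_apply, add_sub_cancel_right, add_sub_cancel_right, hv, smul_eq_mul]
    ring
  rw [Finset.sum_congr rfl fun k₀ h₀ => Finset.sum_congr rfl fun k₄ h₄ =>
    Finset.sum_congr rfl fun k₅ h₅ => key k₀ h₀ k₄ h₄ k₅ h₅]
  simp only [← Finset.mul_sum]
  have hc : ∀ x : ℕ, (((x : ℤ) + 1 : ℤ) : ℝ) * (((x : ℤ) + 1 : ℤ) + 1) = ((x : ℝ) + 1) * (x + 2) := by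
    intro x; push_cast; ring
  have hp : phase (((a : ℤ) + 1 + (e + 1) + f) / 2) = -phase (((a : ℤ) + e + f) / 2) := by
    rw [show (a : ℤ) + 1 + (e + 1) + f = a + e + f + 1 * 2 by ring,
      Int.add_mul_ediv_right _ _ (by norm_num), phase_add]
    simp [phase]
  rw [hc, hc, hp]
  by_cases hT : Triad a e f
  · have hs := sum_threeJ_sq_neg hT
    rw [show ((a : ℤ) + 1).toNat = a + 1 by omega, show ((e : ℤ) + 1).toNat = e + 1 by omega,
      show ((f : ℤ) + 1).toNat = f + 1 by omega] at hs
    rw [hs]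
    ring
  · have hw0 : w = 0 := by
      obtain ⟨⟨s, hs⟩, h1, h2, h3⟩ := h
      have : (f : ℤ) = e + 1 + (a + 1) := by
        by_contra hne
        exact hT ⟨⟨s - 1, by omega⟩, by omega, by omega, by omega⟩
      have h0 : spin ((e : ℤ) + 1) + spin ((a : ℤ) + 1) - spin f = 0 := by
        rw [this]; simp only [spin]; push_cast; ring
      rw [hw, h0, zero_mul, Real.sqrt_zero]
    rw [hw0]
    ring

/-! ### States as functions of the occupation numbers -/

lemma lower_single (l : Leg) (A : Fin 2) (c : Leg → Occ) (x : ℂ) :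
    lower l A (Finsupp.single c x) =
      Finsupp.single (Function.update c l (Function.update (c l) A (c l A - 1)))
        (x * ((√(c l A : ℝ) : ℝ) : ℂ)) := by
  simp [lower]

lemma raise_single (l : Leg) (A : Fin 2) (c : Leg → Occ) (x : ℂ) :
    raise l A (Finsupp.single c x) =
      Finsupp.single (Function.update c l (Function.update (c l) A (c l A + 1)))
        (x * ((√((c l A : ℝ) + 1) : ℝ) : ℂ)) := by
  simp [raise]

lemma update_update_succ (c : Leg → Occ) (l : Leg) (A : Fin 2) :
    let d := Function.update c l (Function.update (c l) A (c l A + 1))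
    Function.update d l (Function.update (d l) A (d l A - 1)) = c := by
  simp

lemma update_update_pred {c : Leg → Occ} {l : Leg} {A : Fin 2} (h : c l A ≠ 0) :
    let d := Function.update c l (Function.update (c l) A (c l A - 1))
    Function.update d l (Function.update (d l) A (d l A + 1)) = c := by
  simp [Nat.sub_add_cancel (Nat.pos_of_ne_zero h)]

lemma lower_apply (l : Leg) (A : Fin 2) (T : State) (c : Leg → Occ) :
    lower l A T c = ((√((c l A : ℝ) + 1) : ℝ) : ℂ) *
      T (Function.update c l (Function.update (c l) A (c l A + 1))) := by
  induction T using Finsupp.induction_linear with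
  | zero => simp
  | add T T' h h' => rw [map_add, Finsupp.add_apply, h, h', Finsupp.add_apply, mul_add]
  | single d x =>
    rw [lower_single]
    by_cases h : d = Function.update c l (Function.update (c l) A (c l A + 1))
    · have hd := update_update_succ c l A
      simp only at hd
      rw [h, hd]
      simp [mul_comm]
    · rw [Finsupp.single_eq_of_ne (Ne.symm h), mul_zero]
      -- Here truncated subtraction would keep the configuration, but the weight is `√0`.
      by_cases h0 : d l A = 0
      · simp [h0]
      · refine Finsupp.single_eq_of_ne fun hc => h ?_
        have hd := update_update_pred h0
        simp only at hd
        rw [hc, hd]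

lemma raise_apply (l : Leg) (A : Fin 2) (T : State) (c : Leg → Occ) :
    raise l A T c = ((√(c l A : ℝ) : ℝ) : ℂ) *
      T (Function.update c l (Function.update (c l) A (c l A - 1))) := by
  induction T using Finsupp.induction_linear with
  | zero => simp
  | add T T' h h' => rw [map_add, Finsupp.add_apply, h, h', Finsupp.add_apply, mul_add]
  | single d x =>
    rw [raise_single]
    by_cases h0 : c l A = 0
    · rw [h0]
      simp only [Nat.cast_zero, Real.sqrt_zero, Complex.ofReal_zero, zero_mul]
      refine Finsupp.single_eq_of_ne fun hc => ?_
      rw [hc] at h0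
      simp at h0
    · by_cases h : d = Function.update c l (Function.update (c l) A (c l A - 1))
      · have hd := update_update_pred h0
        simp only at hd
        rw [h, hd]
        have : ((c l A - 1 : ℕ) : ℝ) + 1 = c l A := by
          rw [Nat.cast_sub (Nat.pos_of_ne_zero h0)]; simp
        simp [mul_comm, this]
      · rw [Finsupp.single_eq_of_ne (Ne.symm h), mul_zero]
        refine Finsupp.single_eq_of_ne fun hc => h ?_
        have hd := update_update_succ d l A
        simp only at hd
        rw [hc, hd]

lemma invDim1_apply (T : State) (c : Leg → Occ) :
    invDim1 T c = 1 / ((c (Sum.inl 0) 0 : ℂ) + (c (Sum.inl 0) 1 : ℂ) + 1) * T c := by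
  induction T using Finsupp.induction_linear with
  | zero => simp
  | add T T' h h' => rw [map_add, Finsupp.add_apply, h, h', Finsupp.add_apply, mul_add]
  | single d x =>
    simp only [invDim1, Finsupp.linearCombination_single, Finsupp.smul_single, smul_eq_mul]
    by_cases h : d = c
    · subst h; simp [mul_comm]
    · simp [Finsupp.single_eq_of_ne (Ne.symm h)]

/-- The reversal of the spinor index on a bra. -/
def bra (n : Occ) : Occ := ![n 1, n 0]

/-- The contraction of four vertices along the links of the tetrahedron, before the sum over the
magnetic numbers. -/
def tetOf (V₁ V₂ V₃ V₄ : (Fin 3 → Occ) → ℝ) (c : Leg → Occ) : ℝ :=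
  (∏ e, (-1) ^ c (Sum.inr e) 0) *
    V₁ ![c (Sum.inl 0), c (Sum.inl 1), c (Sum.inl 2)] *
    V₂ ![bra (c (Sum.inr 0)), bra (c (Sum.inr 4)), c (Sum.inl 5)] *
    V₃ ![bra (c (Sum.inr 2)), bra (c (Sum.inr 3)), c (Sum.inl 4)] *
    V₄ ![bra (c (Sum.inr 1)), bra (c (Sum.inr 5)), c (Sum.inl 3)]

lemma vertex_of_ne {a b c : ℤ} {p q r : Occ}
    (h : ¬ ((p 0 : ℤ) + p 1 = a ∧ (q 0 : ℤ) + q 1 = b ∧ (r 0 : ℤ) + r 1 = c)) :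
    vertex a b c ![p, q, r] = 0 := by
  rw [vertex, if_neg]
  simpa using h

lemma vertex_of_eq {a b c : ℤ} {p q r : Occ}
    (h : (p 0 : ℤ) + p 1 = a ∧ (q 0 : ℤ) + q 1 = b ∧ (r 0 : ℤ) + r 1 = c) :
    vertex a b c ![p, q, r] =
      threeJ a b c (2 * (p 1 : ℤ) - a) (2 * (q 1 : ℤ) - b) (2 * (r 1 : ℤ) - c) := by
  obtain ⟨rfl, rfl, rfl⟩ := h
  rw [vertex, if_pos (by simp)]
  simp
  ring_nf

lemma tetState_apply (J : Fin 6 → ℤ) (c : Leg → Occ) :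
    tetState J c = (tetOf (vertex (J 0) (J 1) (J 2)) (vertex (J 0) (J 4) (J 5))
      (vertex (J 2) (J 3) (J 4)) (vertex (J 1) (J 5) (J 3)) c : ℝ) := by
  rw [tetState, Finsupp.finsetSum_apply]
  by_cases h : ∀ l : Leg, (c l 0 : ℤ) + c l 1 = J l.link
  · rw [Finset.sum_eq_single fun l => c l 1]
    · have hc : (fun l : Leg => ![(J l.link - (c l 1 : ℤ)).toNat, c l 1]) = c := by
        funext l A
        have := h l
        rcases fin_two_cases A with rfl | rfl <;> simp
        omega
      rw [hc, Finsupp.single_eq_same]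
      congr 1
      have hl : ∀ e, (c (Sum.inl e) 0 : ℤ) + c (Sum.inl e) 1 = J e := fun e => h (Sum.inl e)
      have hr : ∀ e, (c (Sum.inr e) 0 : ℤ) + c (Sum.inr e) 1 = J e := fun e => h (Sum.inr e)
      have hb : ∀ e, (bra (c (Sum.inr e)) 0 : ℤ) + bra (c (Sum.inr e)) 1 = J e := fun e => by
        simp [bra, ← hr e, add_comm]
      have hb' : ∀ e, (2 * (bra (c (Sum.inr e)) 1 : ℤ) - J e) =
          -(2 * (c (Sum.inr e) 1 : ℤ) - J e) := fun e => by
        simp [bra, ← hr e]; ring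
      rw [tetOf, vertex_of_eq ⟨hl 0, hl 1, hl 2⟩, vertex_of_eq ⟨hb 0, hb 4, hl 5⟩,
        vertex_of_eq ⟨hb 2, hb 3, hl 4⟩, vertex_of_eq ⟨hb 1, hb 5, hl 3⟩]
      simp only [hb', Leg.link, Sum.elim_inl, Sum.elim_inr, id]
      congr 4
      rw [Finset.prod_pow_eq_pow_sum, ← phase_natCast]
      congr 1
      push_cast
      exact Finset.sum_congr rfl fun e _ => by rw [← hr e]; ring
    · intro k hk hne
      refine Finsupp.single_eq_of_ne fun hc => hne ?_
      funext l
      rw [hc]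
      simp
    · intro hh
      exfalso
      apply hh
      rw [Fintype.mem_piFinset]
      intro l
      have := h l
      rw [Finset.mem_range]
      omega
  · rw [Finset.sum_eq_zero]
    -- Each of the twelve half-links meets exactly one vertex, so a nonzero product forces the right
    -- spin on all of them.
    · have h' : ¬ ((∀ e, (c (Sum.inl e) 0 : ℤ) + c (Sum.inl e) 1 = J e) ∧
          ∀ e, (bra (c (Sum.inr e)) 0 : ℤ) + bra (c (Sum.inr e)) 1 = J e) := by
        rintro ⟨h1, h2⟩
        apply h
        rintro (e | e)
        · exact h1 e
        · have := h2 e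
          simp only [bra, Matrix.cons_val_zero, Matrix.cons_val_one] at this
          rw [add_comm]; exact this
      symm
      rw [Complex.ofReal_eq_zero, tetOf]
      by_contra hne
      apply h'
      have hv : ∀ {x y z : ℤ} {p q r : Occ}, vertex x y z ![p, q, r] ≠ 0 →
          ((p 0 : ℤ) + p 1 = x ∧ (q 0 : ℤ) + q 1 = y ∧ (r 0 : ℤ) + r 1 = z) := by
        intro x y z p q r hh
        by_contra hcon
        exact hh (vertex_of_ne hcon)
      simp only [mul_eq_zero, not_or] at hne
      obtain ⟨⟨⟨⟨-, h1⟩, h2⟩, h3⟩, h4⟩ := hne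
      have h1 := hv h1
      have h2 := hv h2
      have h3 := hv h3
      have h4 := hv h4
      constructor
      · intro e
        fin_cases e
        exacts [h1.1, h1.2.1, h1.2.2, h4.2.2, h3.2.2, h2.2.2]
      · intro e
        fin_cases e
        exacts [h2.1, h4.1, h3.1, h3.2.1, h2.2.1, h4.2.1]
    · intro k hk
      refine Finsupp.single_eq_of_ne fun hc => h fun l => ?_
      rw [Fintype.mem_piFinset] at hk
      have := hk l
      rw [Finset.mem_range] at this
      rw [hc]
      simp
      omega

/-! ### Ladder operators acting on single vertices of the tetrahedron -/

lemma fin_two_rev_zero : Fin.rev (0 : Fin 2) = 1 := rfl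

lemma fin_two_rev_one : Fin.rev (1 : Fin 2) = 0 := rfl

lemma update_vec_zero (p q r x : Occ) :
    Function.update (![p, q, r] : Fin 3 → Occ) 0 x = ![x, q, r] := by
  funext i; fin_cases i <;> rfl

lemma update_vec_one (p q r x : Occ) :
    Function.update (![p, q, r] : Fin 3 → Occ) 1 x = ![p, x, r] := by
  funext i; fin_cases i <;> rfl

lemma update_vec_two (p q r x : Occ) :
    Function.update (![p, q, r] : Fin 3 → Occ) 2 x = ![p, q, x] := by
  funext i; fin_cases i <;> rfl

lemma bra_update (n : Occ) (A : Fin 2) (x : ℕ) :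
    bra (Function.update n A x) = Function.update (bra n) (Fin.rev A) x := by
  funext B
  rcases fin_two_cases A with rfl | rfl <;> rcases fin_two_cases B with rfl | rfl <;>
    simp [bra, fin_two_rev_zero, fin_two_rev_one]

lemma bra_rev (n : Occ) (A : Fin 2) : bra n (Fin.rev A) = n A := by
  rcases fin_two_cases A with rfl | rfl <;> simp [bra, fin_two_rev_zero, fin_two_rev_one]

/-- The sign of a configuration of the bras. -/
def braSign (c : Leg → Occ) : ℝ := ∏ e, (-1) ^ c (Sum.inr e) 0

lemma braSign_update_inl (c : Leg → Occ) (e : Fin 6) (x : Occ) :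
    braSign (Function.update c (Sum.inl e) x) = braSign c := by
  simp [braSign]

lemma braSign_update_inr (c : Leg → Occ) (e : Fin 6) (x : Occ) :
    braSign (Function.update c (Sum.inr e) x) =
      braSign c * ((-1) ^ c (Sum.inr e) 0 * (-1) ^ x 0) := by
  have h : ∀ d : Leg → Occ, braSign d = (-1) ^ d (Sum.inr e) 0 *
      ∏ i ∈ Finset.univ.erase e, (-1) ^ d (Sum.inr i) 0 := fun d =>
    (Finset.mul_prod_erase _ _ (Finset.mem_univ e)).symm
  rw [h, h c, Finset.prod_congr rfl (g := fun i => (-1 : ℝ) ^ c (Sum.inr i) 0)]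
  · have : ((-1 : ℝ) ^ c (Sum.inr e) 0) * (-1) ^ c (Sum.inr e) 0 = 1 := by
      rw [← mul_pow]; simp
    simp only [Function.update_self]
    linear_combination (-(-1 : ℝ) ^ x 0 *
      ∏ i ∈ Finset.univ.erase e, (-1) ^ c (Sum.inr i) 0) * this
  · intro i hi
    rw [Function.update_of_ne]
    simpa using Finset.ne_of_mem_erase hi

/-- On a bra `j - n` is the number `n⁻`, so only quanta with `A = -1/2` change the sign. -/
lemma braSign_lower (c : Leg → Occ) (e : Fin 6) (A : Fin 2) :
    braSign (Function.update c (Sum.inr e)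
      (Function.update (c (Sum.inr e)) A (c (Sum.inr e) A + 1))) = sgn A * braSign c := by
  rw [braSign_update_inr, ← pow_add]
  rcases fin_two_cases A with rfl | rfl
  · simp only [Function.update_self]
    rw [Odd.neg_one_pow ⟨c (Sum.inr e) 0, by ring⟩]
    simp [sgn]
  · simp only [Function.update_of_ne, ne_eq, zero_ne_one, not_false_eq_true]
    rw [Even.neg_one_pow ⟨c (Sum.inr e) 0, by ring⟩]
    simp [sgn]

/-- The weight is kept because for an empty mode the truncated subtraction would not flip the sign.
-/
lemma sqrt_mul_braSign_raise (c : Leg → Occ) (e : Fin 6) (A : Fin 2) :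
    √(c (Sum.inr e) A : ℝ) * braSign (Function.update c (Sum.inr e)
      (Function.update (c (Sum.inr e)) A (c (Sum.inr e) A - 1))) =
      √(c (Sum.inr e) A : ℝ) * (sgn A * braSign c) := by
  by_cases h0 : c (Sum.inr e) A = 0
  · simp [h0]
  congr 1
  rw [braSign_update_inr, ← pow_add]
  rcases fin_two_cases A with rfl | rfl
  · simp only [Function.update_self]
    rw [Odd.neg_one_pow ⟨c (Sum.inr e) 0 - 1, by omega⟩]
    simp [sgn]
  · simp only [Function.update_of_ne, ne_eq, zero_ne_one, not_false_eq_true]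
    rw [Even.neg_one_pow ⟨c (Sum.inr e) 0, by ring⟩]
    simp [sgn]

lemma tetOf_eq (V₁ V₂ V₃ V₄ : (Fin 3 → Occ) → ℝ) (c : Leg → Occ) :
    tetOf V₁ V₂ V₃ V₄ c = braSign c *
    V₁ ![c (Sum.inl 0), c (Sum.inl 1), c (Sum.inl 2)] *
    V₂ ![bra (c (Sum.inr 0)), bra (c (Sum.inr 4)), c (Sum.inl 5)] *
    V₃ ![bra (c (Sum.inr 2)), bra (c (Sum.inr 3)), c (Sum.inl 4)] *
    V₄ ![bra (c (Sum.inr 1)), bra (c (Sum.inr 5)), c (Sum.inl 3)] := rfl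

/-- The state `T` is the contraction of the four vertices. -/
def IsTet (T : State) (V₁ V₂ V₃ V₄ : (Fin 3 → Occ) → ℝ) : Prop :=
  ∀ c, T c = (tetOf V₁ V₂ V₃ V₄ c : ℝ)

namespace IsTet

variable {T T' : State} {V₁ V₁' V₂ V₂' V₃ V₄ V₄' : (Fin 3 → Occ) → ℝ}

lemma add_fst (h : IsTet T V₁ V₂ V₃ V₄) (h' : IsTet T' V₁' V₂ V₃ V₄) :
    IsTet (T + T') (V₁ + V₁') V₂ V₃ V₄ := by
  intro c
  rw [Finsupp.add_apply, h, h', ← Complex.ofReal_add]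
  congr 1
  simp only [tetOf, Pi.add_apply]
  ring

lemma add_snd (h : IsTet T V₁ V₂ V₃ V₄) (h' : IsTet T' V₁ V₂' V₃ V₄) :
    IsTet (T + T') V₁ (V₂ + V₂') V₃ V₄ := by
  intro c
  rw [Finsupp.add_apply, h, h', ← Complex.ofReal_add]
  congr 1
  simp only [tetOf, Pi.add_apply]
  ring

lemma add_fourth (h : IsTet T V₁ V₂ V₃ V₄) (h' : IsTet T' V₁ V₂ V₃ V₄') :
    IsTet (T + T') V₁ V₂ V₃ (V₄ + V₄') := by
  intro c
  rw [Finsupp.add_apply, h, h', ← Complex.ofReal_add]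
  congr 1
  simp only [tetOf, Pi.add_apply]
  ring

lemma eps_smul_fst (h : IsTet T V₁ V₂ V₃ V₄) (A : Fin 2) :
    IsTet (eps A • T) (sgn A • V₁) V₂ V₃ V₄ := by
  intro c
  rw [Finsupp.smul_apply, h]
  rcases fin_two_cases A with rfl | rfl <;> simp [eps, sgn, tetOf]

lemma eps_smul_snd (h : IsTet T V₁ V₂ V₃ V₄) (A : Fin 2) :
    IsTet (eps A • T) V₁ (sgn A • V₂) V₃ V₄ := by
  intro c
  rw [Finsupp.smul_apply, h]
  rcases fin_two_cases A with rfl | rfl <;> simp [eps, sgn, tetOf]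

lemma eps_smul_fourth (h : IsTet T V₁ V₂ V₃ V₄) (A : Fin 2) :
    IsTet (eps A • T) V₁ V₂ V₃ (sgn A • V₄) := by
  intro c
  rw [Finsupp.smul_apply, h]
  rcases fin_two_cases A with rfl | rfl <;> simp [eps, sgn, tetOf]

lemma a_one (h : IsTet T V₁ V₂ V₃ V₄) (A : Fin 2) :
    IsTet (a 0 A T) (legLower 0 A V₁) V₂ V₃ V₄ := by
  intro c
  rw [a, lower_apply, h, ← Complex.ofReal_mul]
  congr 1
  rw [tetOf_eq, tetOf_eq, braSign_update_inl]
  simp [legLower, update_vec_zero]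
  ring

lemma aDag_one (h : IsTet T V₁ V₂ V₃ V₄) (A : Fin 2) :
    IsTet (aDag 0 A T) (legRaise 0 A V₁) V₂ V₃ V₄ := by
  intro c
  rw [aDag, raise_apply, h, ← Complex.ofReal_mul]
  congr 1
  rw [tetOf_eq, tetOf_eq, braSign_update_inl]
  simp [legRaise, update_vec_zero]
  ring

lemma a_two (h : IsTet T V₁ V₂ V₃ V₄) (A : Fin 2) :
    IsTet (a 1 A T) (legLower 1 A V₁) V₂ V₃ V₄ := by
  intro c
  rw [a, lower_apply, h, ← Complex.ofReal_mul]
  congr 1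
  rw [tetOf_eq, tetOf_eq, braSign_update_inl]
  simp [legLower, update_vec_one]
  ring

lemma a_six (h : IsTet T V₁ V₂ V₃ V₄) (A : Fin 2) :
    IsTet (a 5 A T) V₁ (legLower 2 A V₂) V₃ V₄ := by
  intro c
  rw [a, lower_apply, h, ← Complex.ofReal_mul]
  congr 1
  rw [tetOf_eq, tetOf_eq, braSign_update_inl]
  simp [legLower, update_vec_two]
  ring

/-- Bras enter the vertices with reversed magnetic number: a quantum `A` on the bra is a quantum
`-A` on the leg, with a sign from `(-1)^{j - n}`. -/
lemma aTilde_one (h : IsTet T V₁ V₂ V₃ V₄) (A : Fin 2) :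
    IsTet (aTilde 0 A T) V₁ (sgn A • legRaise 0 (Fin.rev A) V₂) V₃ V₄ := by
  intro c
  rw [aTilde, raise_apply, h, ← Complex.ofReal_mul]
  congr 1
  rw [tetOf_eq, tetOf_eq]
  have hs := sqrt_mul_braSign_raise c 0 A
  simp [legRaise, update_vec_zero, bra_update, bra_rev]
  simp only [← mul_assoc]
  rw [hs]
  ring

lemma aTildeDag_one (h : IsTet T V₁ V₂ V₃ V₄) (A : Fin 2) :
    IsTet (aTildeDag 0 A T) V₁ (sgn A • legLower 0 (Fin.rev A) V₂) V₃ V₄ := by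
  intro c
  rw [aTildeDag, lower_apply, h, ← Complex.ofReal_mul]
  congr 1
  rw [tetOf_eq, tetOf_eq, braSign_lower]
  simp [legLower, update_vec_zero, bra_update, bra_rev]
  ring

lemma aTilde_two (h : IsTet T V₁ V₂ V₃ V₄) (A : Fin 2) :
    IsTet (aTilde 1 A T) V₁ V₂ V₃ (sgn A • legRaise 0 (Fin.rev A) V₄) := by
  intro c
  rw [aTilde, raise_apply, h, ← Complex.ofReal_mul]
  congr 1
  rw [tetOf_eq, tetOf_eq]
  have hs := sqrt_mul_braSign_raise c 1 A
  simp [legRaise, update_vec_zero, bra_update, bra_rev]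
  simp only [← mul_assoc]
  rw [hs]
  ring

lemma aTildeDag_two (h : IsTet T V₁ V₂ V₃ V₄) (A : Fin 2) :
    IsTet (aTildeDag 1 A T) V₁ V₂ V₃ (sgn A • legLower 0 (Fin.rev A) V₄) := by
  intro c
  rw [aTildeDag, lower_apply, h, ← Complex.ofReal_mul]
  congr 1
  rw [tetOf_eq, tetOf_eq, braSign_lower]
  simp [legLower, update_vec_zero, bra_update, bra_rev]
  ring

lemma aTilde_six (h : IsTet T V₁ V₂ V₃ V₄) (A : Fin 2) :
    IsTet (aTilde 5 A T) V₁ V₂ V₃ (sgn A • legRaise 1 (Fin.rev A) V₄) := by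
  intro c
  rw [aTilde, raise_apply, h, ← Complex.ofReal_mul]
  congr 1
  rw [tetOf_eq, tetOf_eq]
  have hs := sqrt_mul_braSign_raise c 5 A
  simp [legRaise, update_vec_one, bra_update, bra_rev]
  simp only [← mul_assoc]
  rw [hs]
  ring

lemma aTildeDag_six (h : IsTet T V₁ V₂ V₃ V₄) (A : Fin 2) :
    IsTet (aTildeDag 5 A T) V₁ V₂ V₃ (sgn A • legLower 1 (Fin.rev A) V₄) := by
  intro c
  rw [aTildeDag, lower_apply, h, ← Complex.ofReal_mul]
  congr 1
  rw [tetOf_eq, tetOf_eq, braSign_lower]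
  simp [legLower, update_vec_one, bra_update, bra_rev]
  ring

end IsTet

lemma legLower_comm {i j : Fin 3} (h : i ≠ j) (A B : Fin 2) (f : (Fin 3 → Occ) → ℝ) :
    legLower i A (legLower j B f) = legLower j B (legLower i A f) := by
  funext n
  simp only [legLower, Function.update_of_ne h, Function.update_of_ne h.symm,
    Function.update_comm h]
  ring

lemma legRaise_comm {i j : Fin 3} (h : i ≠ j) (A B : Fin 2) (f : (Fin 3 → Occ) → ℝ) :
    legRaise i A (legRaise j B f) = legRaise j B (legRaise i A f) := by
  funext n
  simp only [legRaise, Function.update_of_ne h, Function.update_of_ne h.symm,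
    Function.update_comm h]
  ring

lemma legLower_legRaise_comm {i j : Fin 3} (h : i ≠ j) (A B : Fin 2) (f : (Fin 3 → Occ) → ℝ) :
    legLower i A (legRaise j B f) = legRaise j B (legLower i A f) := by
  funext n
  simp only [legLower, legRaise, Function.update_of_ne h, Function.update_of_ne h.symm,
    Function.update_comm h]
  ring

namespace IsTet

variable {T : State} {V₁ V₂ V₃ V₄ : (Fin 3 → Occ) → ℝ}

lemma F12 (h : IsTet T V₁ V₂ V₃ V₄) : IsTet (F12 T) (lowerPair 0 1 V₁) V₂ V₃ V₄ := by
  have := (((h.a_two 0).a_one 1).eps_smul_fst 0).add_fst (((h.a_two 1).a_one 0).eps_smul_fst 1)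
  simpa [SpinNet.F12, lowerPair, Fin.sum_univ_two, fin_two_rev_zero, fin_two_rev_one] using this

lemma E12 (h : IsTet T V₁ V₂ V₃ V₄) : IsTet (E12 T) (transfer 0 1 V₁) V₂ V₃ V₄ := by
  have := ((h.a_two 0).aDag_one 0).add_fst ((h.a_two 1).aDag_one 1)
  simpa [SpinNet.E12, transfer, Fin.sum_univ_two] using this

/-- The sign of the pairing cancels the sign of the bra, so an antisymmetric pairing of ket and bra
acts on the vertex as a transfer; `E16` is the reverse situation. -/
lemma F61 (h : IsTet T V₁ V₂ V₃ V₄) : IsTet (F61 T) V₁ (transfer 0 2 V₂) V₃ V₄ := by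
  have := (((h.aTilde_one 0).a_six 1).eps_smul_snd 0).add_snd
    (((h.aTilde_one 1).a_six 0).eps_smul_snd 1)
  have e : transfer 0 2 V₂ = sgn 0 • legLower 2 1 (sgn 0 • legRaise 0 (Fin.rev 0) V₂) +
      sgn 1 • legLower 2 0 (sgn 1 • legRaise 0 (Fin.rev 1) V₂) := by
    simp only [transfer, Fin.sum_univ_two, legLower_smul, fin_two_rev_zero, fin_two_rev_one,
      legLower_legRaise_comm (show (2 : Fin 3) ≠ 0 by decide), smul_smul]
    simp [sgn, add_comm]
  rw [e]
  simpa [SpinNet.F61, Fin.sum_univ_two, fin_two_rev_zero, fin_two_rev_one] using this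

lemma E16 (h : IsTet T V₁ V₂ V₃ V₄) : IsTet (E16 T) V₁ (-lowerPair 2 0 V₂) V₃ V₄ := by
  have := ((h.a_six 0).aTildeDag_one 0).add_snd ((h.a_six 1).aTildeDag_one 1)
  have e : -lowerPair 2 0 V₂ = sgn 0 • legLower 0 (Fin.rev 0) (legLower 2 0 V₂) +
      sgn 1 • legLower 0 (Fin.rev 1) (legLower 2 1 V₂) := by
    simp only [lowerPair, Fin.sum_univ_two, fin_two_rev_zero, fin_two_rev_one,
      legLower_comm (show (0 : Fin 3) ≠ 2 by decide)]
    simp [sgn, add_comm]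
  rw [e]
  simpa [SpinNet.E16, Fin.sum_univ_two] using this

/-- The two bras carry opposite spinor indices, so their signs always multiply to `-1`. -/
lemma F62 (h : IsTet T V₁ V₂ V₃ V₄) : IsTet (F62 T) V₁ V₂ V₃ (-raisePair 0 1 V₄) := by
  have := (((h.aTilde_two 0).aTilde_six 1).eps_smul_fourth 0).add_fourth
    (((h.aTilde_two 1).aTilde_six 0).eps_smul_fourth 1)
  have e : -raisePair 0 1 V₄ =
      sgn 0 • sgn 1 • legRaise 1 (Fin.rev 1) (sgn 0 • legRaise 0 (Fin.rev 0) V₄) +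
      sgn 1 • sgn 0 • legRaise 1 (Fin.rev 0) (sgn 1 • legRaise 0 (Fin.rev 1) V₄) := by
    simp only [raisePair, Fin.sum_univ_two, legRaise_smul, fin_two_rev_zero, fin_two_rev_one,
      legRaise_comm (show (1 : Fin 3) ≠ 0 by decide), smul_smul]
    simp [sgn, add_comm]
  rw [e]
  simpa [SpinNet.F62, Fin.sum_univ_two, fin_two_rev_zero, fin_two_rev_one] using this

lemma F26Dag (h : IsTet T V₁ V₂ V₃ V₄) : IsTet (F26Dag T) V₁ V₂ V₃ (lowerPair 0 1 V₄) := by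
  have := (((h.aTildeDag_two 1).aTildeDag_six 0).eps_smul_fourth 0).add_fourth
    (((h.aTildeDag_two 0).aTildeDag_six 1).eps_smul_fourth 1)
  have e : lowerPair 0 1 V₄ =
      sgn 0 • sgn 0 • legLower 1 (Fin.rev 0) (sgn 1 • legLower 0 (Fin.rev 1) V₄) +
      sgn 1 • sgn 1 • legLower 1 (Fin.rev 1) (sgn 0 • legLower 0 (Fin.rev 0) V₄) := by
    simp only [lowerPair, Fin.sum_univ_two, legLower_smul, fin_two_rev_zero, fin_two_rev_one,
      legLower_comm (show (1 : Fin 3) ≠ 0 by decide), smul_smul]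
    simp [sgn, add_comm]
  rw [e]
  simpa [SpinNet.F26Dag, Fin.sum_univ_two, fin_two_rev_zero, fin_two_rev_one] using this

end IsTet

/-! ### The graspings of the tetrahedral spin network -/

lemma isTet_tetState (J : Fin 6 → ℤ) :
    IsTet (tetState J) (vertex (J 0) (J 1) (J 2)) (vertex (J 0) (J 4) (J 5))
      (vertex (J 2) (J 3) (J 4)) (vertex (J 1) (J 5) (J 3)) := tetState_apply J

lemma IsTet.eq_smul {T T' : State} {V₁ V₂ V₃ V₄ : (Fin 3 → Occ) → ℝ} {x y z : ℝ}
    (h : IsTet T (x • V₁) (y • V₂) V₃ (z • V₄)) (h' : IsTet T' V₁ V₂ V₃ V₄) :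
    T = ((x * y * z : ℝ) : ℂ) • T' := by
  ext c
  rw [h, Finsupp.smul_apply, h', smul_eq_mul, ← Complex.ofReal_mul]
  congr 1
  simp only [tetOf, Pi.smul_apply, smul_eq_mul]
  ring

lemma invDim1_of_isTet {T : State} {J : ℤ} {b c : ℤ} {V₂ V₃ V₄ : (Fin 3 → Occ) → ℝ}
    (h : IsTet T (vertex J b c) V₂ V₃ V₄) : invDim1 T = ((dim J : ℝ) : ℂ)⁻¹ • T := by
  ext n
  rw [invDim1_apply, Finsupp.smul_apply, smul_eq_mul]
  by_cases hn : (n (Sum.inl 0) 0 : ℤ) + n (Sum.inl 0) 1 = J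
  · subst hn
    congr 1
    simp [dim]
  · have : T n = 0 := by
      rw [h, tetOf, vertex_of_ne (fun hh => hn hh.1)]
      simp
    rw [this, mul_zero, mul_zero]

/-- `F26Dag` lowers `j₂` and `j₆` at their common vertex with weight `-w`. The two products of
graspings then shift `j₁` up or down at its two vertices while completing the shifts of `j₂` and
`j₆` at their other ends; `F62` instead undoes the lowering, with the same root. -/
lemma graspR_tetState {J₁ J₂ J₃ J₄ J₅ J₆ : ℤ}
    (h₁₂₃ : Triad J₁ J₂ J₃) (h₁₅₆ : Triad J₁ J₅ J₆) (h₂₆₄ : Triad J₂ J₆ J₄) :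
    let w := √((spin J₂ + spin J₆ - spin J₄) * (spin J₂ + spin J₆ + spin J₄ + 1))
    graspR (tetState ![J₁, J₂, J₃, J₄, J₅, J₆]) =
      (((-w) * (√((-spin J₁ + spin J₂ + spin J₃) * (spin J₁ - spin J₂ + spin J₃ + 1)) *
        √((-spin J₁ + spin J₅ + spin J₆) * (spin J₁ + spin J₅ - spin J₆ + 1)) / dim J₁) : ℝ) : ℂ) •
          tetState ![J₁ + 1, J₂ - 1, J₃, J₄, J₅, J₆ - 1] +
      ((w * w : ℝ) : ℂ) • tetState ![J₁, J₂, J₃, J₄, J₅, J₆] +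
      ((w * (√((spin J₁ + spin J₂ - spin J₃) * (spin J₁ + spin J₂ + spin J₃ + 1)) *
        √((spin J₁ + spin J₆ - spin J₅) * (spin J₁ + spin J₅ + spin J₆ + 1)) / dim J₁) : ℝ) : ℂ) •
          tetState ![J₁ - 1, J₂ - 1, J₃, J₄, J₅, J₆ - 1] := by
  intro w
  have hT : IsTet (tetState ![J₁, J₂, J₃, J₄, J₅, J₆]) (vertex J₁ J₂ J₃) (vertex J₁ J₅ J₆)
      (vertex J₃ J₄ J₅) (vertex J₂ J₆ J₄) := isTet_tetState _
  have hp : IsTet (tetState ![J₁ + 1, J₂ - 1, J₃, J₄, J₅, J₆ - 1]) (vertex (J₁ + 1) (J₂ - 1) J₃)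
      (vertex (J₁ + 1) J₅ (J₆ - 1)) (vertex J₃ J₄ J₅) (vertex (J₂ - 1) (J₆ - 1) J₄) :=
    isTet_tetState _
  have hm : IsTet (tetState ![J₁ - 1, J₂ - 1, J₃, J₄, J₅, J₆ - 1]) (vertex (J₁ - 1) (J₂ - 1) J₃)
      (vertex (J₁ - 1) J₅ (J₆ - 1)) (vertex J₃ J₄ J₅) (vertex (J₂ - 1) (J₆ - 1) J₄) :=
    isTet_tetState _
  have hF := hT.F26Dag
  have hd := invDim1_of_isTet hF
  have e1 := hF.E12.F61
  have e2 := hF.F12.E16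
  have e3 := hF.F62
  have l4 := lowerPair_vertex h₂₆₄
  rw [l4, transfer_vertex h₁₂₃, transfer_vertex' h₁₅₆] at e1
  rw [l4, lowerPair_vertex h₁₂₃, lowerPair_vertex' h₁₅₆, ← neg_smul, neg_neg] at e2
  have e3' : IsTet (F62 (F26Dag (tetState ![J₁, J₂, J₃, J₄, J₅, J₆]))) ((1 : ℝ) • vertex J₁ J₂ J₃)
      ((1 : ℝ) • vertex J₁ J₅ J₆) (vertex J₃ J₄ J₅) ((-(w * w)) • vertex J₂ J₆ J₄) := by
    rw [one_smul, one_smul]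
    convert e3 using 1
    rw [l4, raisePair_smul]
    by_cases hz : Triad (J₂ - 1) (J₆ - 1) J₄
    · rw [raisePair_vertex hz, smul_smul, ← neg_smul]
      rw [show spin (J₂ - 1) + spin (J₆ - 1) - spin J₄ + 1 = spin J₂ + spin J₆ - spin J₄ by
        simp only [spin]; push_cast; ring,
        show spin (J₂ - 1) + spin (J₆ - 1) + spin J₄ + 2 = spin J₂ + spin J₆ + spin J₄ + 1 by
        simp only [spin]; push_cast; ring]
      simp only [sub_add_cancel]
      congr 1
      ring
    -- If the lowered spins are not a triad, then `j₄ = j₂ + j₆`.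
    · have hw : w = 0 := by
        have hs : spin J₂ + spin J₆ - spin J₄ = 0 := by
          obtain ⟨⟨s, hs⟩, t1, t2, t3⟩ := h₂₆₄
          have : J₄ = J₂ + J₆ := by
            by_contra hne
            exact hz ⟨⟨s - 1, by omega⟩, by omega, by omega, by omega⟩
          rw [this]; simp only [spin]; push_cast; ring
        simp only [w, hs, zero_mul, Real.sqrt_zero]
      have hw' : √((spin J₂ + spin J₆ - spin J₄) * (spin J₂ + spin J₆ + spin J₄ + 1)) = 0 := hw
      rw [hw, hw']
      simp
  have e1 := e1.eq_smul hp
  have e2 := e2.eq_smul hm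
  have e3 := e3'.eq_smul hT
  simp only [graspR, LinearMap.comp_apply, LinearMap.sub_apply, LinearMap.add_apply]
  rw [hd]
  simp only [map_smul]
  rw [e1, e2, e3]
  simp only [smul_smul]
  match_scalars <;> push_cast <;> ring

/-! ### Evaluation of states -/

lemma eval_add (T T' : State) (g : Fin 6 → SU2) : eval (T + T') g = eval T g + eval T' g :=
  Finsupp.sum_add_index' (by simp) (by intros; ring)

lemma eval_smul (z : ℂ) (T : State) (g : Fin 6 → SU2) : eval (z • T) g = z * eval T g := by
  rw [eval, eval, Finsupp.sum_smul_index' (by simp), Finsupp.mul_sum]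
  simp [mul_assoc]

lemma eval_zero (g : Fin 6 → SU2) : eval 0 g = 0 := Finsupp.sum_zero_index

lemma eval_single (c : Leg → Occ) (x : ℂ) (g : Fin 6 → SU2) :
    eval (Finsupp.single c x) g =
      x * ∏ e, wignerD (g e) (c (Sum.inr e)) (c (Sum.inl e)) :=
  Finsupp.sum_single_index (by simp)

lemma eval_sub (T T' : State) (g : Fin 6 → SU2) : eval (T - T') g = eval T g - eval T' g := by
  rw [sub_eq_add_neg, ← neg_one_smul ℂ T', eval_add, eval_smul]; ring

/-! ### Multiplication by a matrix element of the holonomy -/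

open MvPolynomial in
/-- The linear form `∑_A g_{AB} X_A`. -/
def holForm (g : SU2) (B : Fin 2) : MvPolynomial (Fin 2) ℂ := ∑ A, C (g.1 A B) * X A

open MvPolynomial in
/-- The polynomial of the basis state `n` transformed by `g`. -/
def holPoly (g : SU2) (n : Occ) : MvPolynomial (Fin 2) ℂ := ∏ B, holForm g B ^ n B

open MvPolynomial in
lemma pderiv_holForm (g : SU2) (A B : Fin 2) : pderiv A (holForm g B) = C (g.1 A B) := by
  rcases fin_two_cases A with rfl | rfl <;>
    simp [holForm, Fin.sum_univ_two, pderiv_mul, pderiv_X, Pi.single_apply]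

lemma det_eq_one_of_SU2 (g : SU2) : g.1 0 0 * g.1 1 1 - g.1 0 1 * g.1 1 0 = 1 := by
  have := (Matrix.mem_specialUnitaryGroup_iff.1 g.2).2
  rwa [Matrix.det_fin_two] at this

open MvPolynomial in
-- Cramer's rule: eliminating one variable between the two linear forms leaves the other times `det
-- g = 1`.
lemma holForm_relation (g : SU2) (A B : Fin 2) :
    C (g.1 A B) * holForm g (Fin.rev B) =
      C (g.1 A (Fin.rev B)) * holForm g B + C (eps A * eps B) * X (Fin.rev A) := by
  have h := congrArg (C : ℂ → MvPolynomial (Fin 2) ℂ) (det_eq_one_of_SU2 g)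
  simp only [map_sub, map_mul, map_one] at h
  rcases fin_two_cases A with rfl | rfl <;> rcases fin_two_cases B with rfl | rfl <;>
    simp [holForm, Fin.sum_univ_two, fin_two_rev_zero, fin_two_rev_one, eps]
  · linear_combination X 1 * h
  · linear_combination -X 1 * h
  · linear_combination -X 0 * h
  · linear_combination X 0 * h

open MvPolynomial in
-- The derivative yields `(n B + 1) g_{AB}` and a term with `g_{A,-B}`; `holForm_relation` converts
-- the latter into `n (-B)` further copies of `g_{AB}`, giving `2j + 1` in all, and a lowered
-- remainder.
lemma holPoly_relation (g : SU2) (A B : Fin 2) (n : Occ) :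
    C (g.1 A B * (n 0 + n 1 + 1)) * holPoly g n =
      pderiv A (holPoly g (Function.update n B (n B + 1))) +
        C (eps A * eps B * n (Fin.rev B)) * (X (Fin.rev A) *
          holPoly g (Function.update n (Fin.rev B) (n (Fin.rev B) - 1))) := by
  have h := holForm_relation g A B
  rcases fin_two_cases B with rfl | rfl
  · rw [fin_two_rev_zero] at h ⊢
    simp only [holPoly, Fin.prod_univ_two, Function.update_self, pderiv_mul, pderiv_pow,
      pderiv_holForm, Function.update_of_ne, ne_eq, one_ne_zero, zero_ne_one, not_false_eq_true]
    rcases n 1 with _ | m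
    · simp; ring
    · simp
      simp at h
      linear_combination (holForm g 0 ^ n 0 * holForm g 1 ^ m * (m + 1)) * h
  · rw [fin_two_rev_one] at h ⊢
    simp only [holPoly, Fin.prod_univ_two, Function.update_self, pderiv_mul, pderiv_pow,
      pderiv_holForm, Function.update_of_ne, ne_eq, one_ne_zero, zero_ne_one, not_false_eq_true]
    rcases n 0 with _ | m
    · simp; ring
    · simp
      simp at h
      linear_combination (holForm g 0 ^ m * holForm g 1 ^ n 1 * (m + 1)) * h

/-- The squared norm of the monomial of a basis state. -/
def occNorm (n : Occ) : ℝ := (n 0).factorial * (n 1).factorial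

lemma occNorm_pos (n : Occ) : 0 < occNorm n := by unfold occNorm; positivity

lemma occNorm_succ (n : Occ) (A : Fin 2) :
    occNorm (Function.update n A (n A + 1)) = (n A + 1) * occNorm n := by
  rcases fin_two_cases A with rfl | rfl <;> simp [occNorm, Nat.factorial_succ] <;> ring

/-- The exponent of the monomial of a basis state. -/
def occFinsupp (n : Occ) : Fin 2 →₀ ℕ := Finsupp.equivFunOnFinite.symm n

lemma occFinsupp_succ (n : Occ) (A : Fin 2) :
    occFinsupp (Function.update n A (n A + 1)) = occFinsupp n + Finsupp.single A 1 := by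
  ext B
  by_cases h : B = A
  · subst h; simp [occFinsupp]
  · simp [occFinsupp, h, Finsupp.single_apply, Ne.symm h]

lemma wignerD_eq (g : SU2) (p n : Occ) : wignerD g p n =
    ((√(occNorm p) / √(occNorm n) : ℝ) : ℂ) * MvPolynomial.coeff (occFinsupp p) (holPoly g n) := rfl

open MvPolynomial in
lemma raise_raise_wignerD (g : SU2) (A B : Fin 2) (p n : Occ) :
    (√((p A : ℝ) + 1) * √((n B : ℝ) + 1) : ℝ) *
      wignerD g (Function.update p A (p A + 1)) (Function.update n B (n B + 1)) =
    ((√(occNorm p) / √(occNorm n) : ℝ) : ℂ) *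
      coeff (occFinsupp p) (pderiv A (holPoly g (Function.update n B (n B + 1)))) := by
  rw [wignerD_eq, occNorm_succ, occNorm_succ, coeff_pderiv, ← occFinsupp_succ,
    Real.sqrt_mul (by positivity), Real.sqrt_mul (by positivity)]
  have h1 : √((p A : ℝ) + 1) * √((p A : ℝ) + 1) = p A + 1 := Real.mul_self_sqrt (by positivity)
  have h2 : √((n B : ℝ) + 1) ≠ 0 := (Real.sqrt_pos.2 (by positivity)).ne'
  have h3 : √(occNorm n) ≠ 0 := (Real.sqrt_pos.2 (occNorm_pos n)).ne'
  have h4 : √((p A : ℝ) + 1) * √((n B : ℝ) + 1) *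
      (√((p A : ℝ) + 1) * √(occNorm p) / (√((n B : ℝ) + 1) * √(occNorm n))) =
      √(occNorm p) / √(occNorm n) * (p A + 1) := by
    generalize √((p A : ℝ) + 1) = s at h1 ⊢
    rw [← h1]
    field_simp
  rw [← mul_assoc, ← Complex.ofReal_mul, h4]
  push_cast
  have : ((occFinsupp p) A : ℂ) = p A := rfl
  rw [this]
  ring

open MvPolynomial in
lemma lower_lower_wignerD (g : SU2) (A B : Fin 2) (p n : Occ) :
    (√(p A : ℝ) * √(n B : ℝ) : ℝ) *
      wignerD g (Function.update p A (p A - 1)) (Function.update n B (n B - 1)) =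
    ((√(occNorm p) / √(occNorm n) : ℝ) : ℂ) *
      (n B * coeff (occFinsupp p) (X A * holPoly g (Function.update n B (n B - 1)))) := by
  by_cases hn : n B = 0
  · simp [hn]
  by_cases hp : p A = 0
  · have : A ∉ (occFinsupp p).support := by simp [occFinsupp, hp]
    simp [hp, coeff_X_mul', this]
  set p' := Function.update p A (p A - 1) with hp'
  set n' := Function.update n B (n B - 1) with hn'
  have e1 : p = Function.update p' A (p' A + 1) := by
    simp [hp', Nat.sub_add_cancel (Nat.pos_of_ne_zero hp)]
  have e2 : n = Function.update n' B (n' B + 1) := by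
    simp [hn', Nat.sub_add_cancel (Nat.pos_of_ne_zero hn)]
  have f1 : (p A : ℝ) = p' A + 1 := by
    rw [hp']; simp [Nat.cast_sub (Nat.pos_of_ne_zero hp)]
  have f2 : (n B : ℝ) = n' B + 1 := by
    rw [hn']; simp [Nat.cast_sub (Nat.pos_of_ne_zero hn)]
  have f3 : (n B : ℂ) = ((n' B + 1 : ℝ) : ℂ) := by rw [← f2]; simp
  rw [f1, f2, f3, wignerD_eq]
  conv_rhs => rw [e1, e2, occNorm_succ, occNorm_succ, occFinsupp_succ, add_comm (occFinsupp p'),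
    coeff_X_mul]
  rw [Real.sqrt_mul (by positivity), Real.sqrt_mul (by positivity)]
  have h1 : √((n' B : ℝ) + 1) * √((n' B : ℝ) + 1) = n' B + 1 := Real.mul_self_sqrt (by positivity)
  have h2 : √((n' B : ℝ) + 1) ≠ 0 := (Real.sqrt_pos.2 (by positivity)).ne'
  have h3 : √(occNorm n') ≠ 0 := (Real.sqrt_pos.2 (occNorm_pos n')).ne'
  have h4 : √((p' A : ℝ) + 1) * √(occNorm p') / (√((n' B : ℝ) + 1) * √(occNorm n')) *
      (n' B + 1) = √((p' A : ℝ) + 1) * √((n' B : ℝ) + 1) * (√(occNorm p') / √(occNorm n')) := by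
    generalize √((n' B : ℝ) + 1) = t at h1 h2 ⊢
    rw [← h1]
    field_simp
  rw [← mul_assoc, ← mul_assoc, ← Complex.ofReal_mul, ← Complex.ofReal_mul, h4]

/-- Multiplication of a matrix element by one of the spin `1/2` representation. -/
lemma mul_wignerD (g : SU2) (A B : Fin 2) (p n : Occ) :
    g.1 A B * (n 0 + n 1 + 1) * wignerD g p n =
      (√((p A : ℝ) + 1) * √((n B : ℝ) + 1) : ℝ) *
        wignerD g (Function.update p A (p A + 1)) (Function.update n B (n B + 1)) +
      eps A * eps B * ((√(p (Fin.rev A) : ℝ) * √(n (Fin.rev B) : ℝ) : ℝ) *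
        wignerD g (Function.update p (Fin.rev A) (p (Fin.rev A) - 1))
          (Function.update n (Fin.rev B) (n (Fin.rev B) - 1))) := by
  have h := congrArg (MvPolynomial.coeff (occFinsupp p)) (holPoly_relation g A B n)
  rw [MvPolynomial.coeff_C_mul, MvPolynomial.coeff_add, MvPolynomial.coeff_C_mul] at h
  rw [raise_raise_wignerD, lower_lower_wignerD, wignerD_eq]
  linear_combination ((√(occNorm p) / √(occNorm n) : ℝ) : ℂ) * h

/-- The decomposition of spin `1/2 ⊗ j`: the first operator produces spin `j + 1/2` on the link, the
second `j - 1/2`. -/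
lemma mul_eval (T : State) (g : Fin 6 → SU2) (A B : Fin 2) :
    (g 0).1 A B * eval T g =
      eval (aTilde 0 A (aDag 0 B (invDim1 T)) +
        (eps A * eps B) • aTildeDag 0 (Fin.rev A) (a 0 (Fin.rev B) (invDim1 T))) g := by
  induction T using Finsupp.induction_linear with
  | zero => simp [eval_zero]
  | add T T' h h' =>
    rw [eval_add, mul_add, h, h']
    simp only [map_add, eval_add, smul_add]
    ring
  | single c x =>
    have hi : invDim1 (Finsupp.single c x) =
        Finsupp.single c (x * (1 / ((c (Sum.inl 0) 0 : ℂ) + c (Sum.inl 0) 1 + 1))) := by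
      simp [invDim1]
    have hd : (c (Sum.inl 0) 0 : ℂ) + c (Sum.inl 0) 1 + 1 ≠ 0 := by
      exact_mod_cast Nat.succ_ne_zero (c (Sum.inl 0) 0 + c (Sum.inl 0) 1)
    have h := mul_wignerD (g 0) A B (c (Sum.inr 0)) (c (Sum.inl 0))
    rw [hi, eval_add, eval_smul, aTilde, aDag, aTildeDag, a, raise_single, raise_single,
      lower_single, lower_single, eval_single, eval_single, eval_single]
    simp only [Fin.prod_univ_succ (n := 5)]
    simp [Fin.succ_ne_zero]
    simp at h
    field_simp
    linear_combination (x * ∏ i : Fin 5, wignerD (g i.succ) (c (Sum.inr i.succ)) (c (Sum.inl i.succ))) * h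

/-! ### Operators on different half-links commute -/

lemma lower_lower_comm {l l' : Leg} (h : l ≠ l') (A B : Fin 2) (T : State) :
    lower l A (lower l' B T) = lower l' B (lower l A T) := by
  ext c
  simp only [lower_apply, Function.update_of_ne h, Function.update_of_ne h.symm]
  rw [Function.update_comm h]
  ring

lemma raise_raise_comm {l l' : Leg} (h : l ≠ l') (A B : Fin 2) (T : State) :
    raise l A (raise l' B T) = raise l' B (raise l A T) := by
  ext c
  simp only [raise_apply, Function.update_of_ne h, Function.update_of_ne h.symm]
  rw [Function.update_comm h]
  ring

lemma lower_raise_comm {l l' : Leg} (h : l ≠ l') (A B : Fin 2) (T : State) :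
    lower l A (raise l' B T) = raise l' B (lower l A T) := by
  ext c
  simp only [raise_apply, lower_apply, Function.update_of_ne h, Function.update_of_ne h.symm]
  rw [Function.update_comm h]
  ring

lemma invDim1_lower {l : Leg} (h : l ≠ Sum.inl 0) (A : Fin 2) (T : State) :
    invDim1 (lower l A T) = lower l A (invDim1 T) := by
  ext c
  simp only [invDim1_apply, lower_apply, Function.update_of_ne h.symm]
  ring

/-- Inserting `mul_eval` and summing over `A` and `B`, the raising part factors as `F61 ∘ E12` and
the lowering part as `E16 ∘ F12`, since operators on different half-links commute. -/
lemma hamR_eq_eval_graspR (T : State) (g : Fin 6 → SU2) : hamR T g = eval (graspR T) g := by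
  set S := F26Dag T with hS
  have h : ∀ A B, (g 0).1 A B * eval (a 5 (Fin.rev A) (a 1 B S)) g =
      eval (a 5 (Fin.rev A) (aTilde 0 A (aDag 0 B (a 1 B (invDim1 S)))) +
        (eps A * eps B) •
          aTildeDag 0 (Fin.rev A) (a 5 (Fin.rev A) (a 0 (Fin.rev B) (a 1 B (invDim1 S))))) g := by
    intro A B
    rw [mul_eval]
    simp only [a, aDag, aTilde, aTildeDag]
    rw [invDim1_lower (by simp), invDim1_lower (by simp),
      ← lower_raise_comm (by simp), ← lower_raise_comm (by simp),
      lower_lower_comm (l := Sum.inl 0) (l' := Sum.inl 5) (by simp)]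
  rw [hamR, ← hS]
  have hg : graspR T = F61 (E12 (invDim1 S)) + E16 (F12 (invDim1 S)) - F62 S := by
    simp [graspR, hS]
  rw [hg, eval_sub]
  congr 1
  simp only [mul_assoc, h]
  simp only [F61, E12, E16, F12, Fin.sum_univ_two, fin_two_rev_zero, fin_two_rev_one, eps,
    LinearMap.add_apply, LinearMap.smul_apply, LinearMap.comp_apply, map_add, map_smul,
    eval_add, eval_smul, smul_add, Matrix.cons_val_zero, Matrix.cons_val_one]
  ring

/-! ### Evaluation at the identity -/

lemma wignerD_one (p n : Occ) : wignerD 1 p n = if p = n then 1 else 0 := by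
  have h : holPoly 1 n = MvPolynomial.monomial (occFinsupp n) 1 := by
    rw [MvPolynomial.monomial_eq]
    simp [holPoly, holForm, Fin.prod_univ_two, Fin.sum_univ_two, occFinsupp,
      Finsupp.prod_fintype]
  rw [wignerD_eq, h, MvPolynomial.coeff_monomial]
  have h' : occFinsupp n = occFinsupp p ↔ p = n := by
    rw [occFinsupp, occFinsupp, Equiv.apply_eq_iff_eq, eq_comm]
  have h3 : √(occNorm n) ≠ 0 := (Real.sqrt_pos.2 (occNorm_pos n)).ne'
  by_cases hpn : p = n
  · subst hpn
    rw [if_pos rfl, if_pos rfl, div_self h3]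
    simp
  · rw [if_neg (mt h'.1 hpn), if_neg hpn, mul_zero]

lemma eval_one_single (c : Leg → Occ) (x : ℂ) :
    eval (Finsupp.single c x) 1 =
      if ∀ e, c (Sum.inr e) = c (Sum.inl e) then x else 0 := by
  rw [eval_single]
  simp only [Pi.one_apply, wignerD_one]
  by_cases h : ∀ e, c (Sum.inr e) = c (Sum.inl e)
  · simp [h]
  · rw [if_neg h]
    push Not at h
    obtain ⟨e, he⟩ := h
    rw [Finset.prod_eq_zero (Finset.mem_univ e) (if_neg he), mul_zero]

/-- At the identity a link pairs bra and ket by `δ`, so an operator may be moved from the ket to the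
bra. -/
lemma eval_one_lower (e : Fin 6) (A : Fin 2) (T : State) :
    eval (lower (Sum.inl e) A T) 1 = eval (raise (Sum.inr e) A T) 1 := by
  induction T using Finsupp.induction_linear with
  | zero => simp
  | add T T' h h' => rw [map_add, map_add, eval_add, eval_add, h, h']
  | single c x =>
    rw [lower_single, raise_single, eval_one_single, eval_one_single]
    set n := c (Sum.inl e) with hn
    set p := c (Sum.inr e) with hp
    have hz : n A = 0 → x * ((√(n A : ℝ) : ℝ) : ℂ) = 0 := fun h => by simp [h]
    by_cases h0 : n A = 0
    · rw [hz h0, ite_self, if_neg]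
      intro h
      have := congrFun (h e) A
      simp [← hn, h0] at this
    · have key : (∀ i, Function.update c (Sum.inl e) (Function.update n A (n A - 1)) (Sum.inr i) =
            Function.update c (Sum.inl e) (Function.update n A (n A - 1)) (Sum.inl i)) ↔
          (∀ i, Function.update c (Sum.inr e) (Function.update p A (p A + 1)) (Sum.inr i) =
            Function.update c (Sum.inr e) (Function.update p A (p A + 1)) (Sum.inl i)) := by
        refine forall_congr' fun i => ?_
        by_cases hi : i = e
        · subst hi
          simp [← hn, ← hp]
          constructor
          · intro h
            rw [h]; simp [Nat.sub_add_cancel (Nat.pos_of_ne_zero h0)]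
          · intro h
            rw [← h]; simp
        · simp [hi]
      by_cases hc : ∀ i, Function.update c (Sum.inr e) (Function.update p A (p A + 1)) (Sum.inr i) =
            Function.update c (Sum.inr e) (Function.update p A (p A + 1)) (Sum.inl i)
      · rw [if_pos hc, if_pos (key.2 hc)]
        have := congrFun (hc e) A
        simp [← hn] at this
        rw [← this]
        simp
      · rw [if_neg hc, if_neg (mt key.1 hc)]

/-- With `g₁ = 1` only `A = B` contributes, and moving both annihilators to the bras turns the first
term into the second. -/
lemma hamR_one (T : State) : hamR T 1 = 0 := by
  set S := F26Dag T with hS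
  have h : ∀ A, eval (a 5 (Fin.rev A) (a 1 A S)) 1 =
      eval (aTilde 5 (Fin.rev A) (aTilde 1 A S)) 1 := by
    intro A
    simp only [a, aTilde]
    rw [eval_one_lower, ← lower_raise_comm (by simp), eval_one_lower,
      raise_raise_comm (by simp)]
  rw [hamR, ← hS]
  simp only [F62, Fin.sum_univ_two, fin_two_rev_zero, fin_two_rev_one, eps,
    LinearMap.add_apply, LinearMap.smul_apply, LinearMap.comp_apply, eval_add, eval_smul,
    Matrix.cons_val_zero, Matrix.cons_val_one]
  have h0 := h 0
  have h1 := h 1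
  rw [fin_two_rev_zero] at h0
  rw [fin_two_rev_one] at h1
  simp
  rw [h0, h1]
  ring

/-! ### The tetrahedral spin network at the identity -/

lemma eval_sum {ι : Type*} (s : Finset ι) (T : ι → State) (g : Fin 6 → SU2) :
    eval (∑ i ∈ s, T i) g = ∑ i ∈ s, eval (T i) g := by
  classical
  induction s using Finset.induction_on with
  | empty => simp [eval_zero]
  | insert i s hi h => rw [Finset.sum_insert hi, Finset.sum_insert hi, eval_add, h]

/-- Reversal of the magnetic numbers of the first three links. -/
def flipFirst (J : Fin 6 → ℤ) (k : Fin 6 → ℕ) (e : Fin 6) : ℕ :=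
  if e < 3 then (J e).toNat - k e else k e

lemma flipFirst_le {J : Fin 6 → ℤ} {k : Fin 6 → ℕ} (hk : ∀ e, (k e : ℤ) ≤ J e) (e : Fin 6) :
    (flipFirst J k e : ℤ) ≤ J e := by
  have := hk e
  rw [flipFirst]
  split_ifs <;> omega

lemma flipFirst_flipFirst {J : Fin 6 → ℤ} {k : Fin 6 → ℕ} (hk : ∀ e, (k e : ℤ) ≤ J e) :
    flipFirst J (flipFirst J k) = k := by
  funext e
  have := hk e
  simp only [flipFirst]
  split_ifs <;> omega

/-- The sign conventions of the two contractions differ by reversing the magnetic numbers of the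
first three links; rotations of the 3jm-symbols account for the rest. -/
lemma eval_tetState_one (J : Fin 6 → ℤ) :
    eval (tetState J) 1 = (sixJ (J 0) (J 1) (J 2) (J 3) (J 4) (J 5) : ℂ) := by
  have hJ : (![J 0, J 1, J 2, J 3, J 4, J 5] : Fin 6 → ℤ) = J := by
    funext e; fin_cases e <;> rfl
  rw [tetState, eval_sum, sixJ]
  simp only [hJ, eval_one_single]
  rw [Complex.ofReal_sum, ← Finset.sum_filter_add_sum_filter_not _
    (fun k : Leg → ℕ => ∀ e, k (Sum.inr e) = k (Sum.inl e)), add_eq_left.2]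
  · refine Finset.sum_nbij' (fun k => flipFirst J fun e => k (Sum.inl e))
      (fun k l => flipFirst J k l.link) ?_ ?_ ?_ ?_ ?_
    · intro k hk
      simp only [Finset.mem_filter, Fintype.mem_piFinset, Finset.mem_range] at hk
      simp only [Fintype.mem_piFinset, Finset.mem_range]
      intro e
      have := flipFirst_le (J := J) (k := fun e => k (Sum.inl e))
        (fun e => by have := hk.1 (Sum.inl e); simp only [Leg.link, Sum.elim_inl, id] at this; omega) e
      omega
    · intro k hk
      simp only [Fintype.mem_piFinset, Finset.mem_range] at hk
      simp only [Finset.mem_filter, Fintype.mem_piFinset, Finset.mem_range]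
      refine ⟨fun l => ?_, fun e => rfl⟩
      have := flipFirst_le (J := J) (k := k) (fun e => by have := hk e; omega) l.link
      omega
    · intro k hk
      simp only [Finset.mem_filter, Fintype.mem_piFinset, Finset.mem_range] at hk
      have := flipFirst_flipFirst (J := J) (k := fun e => k (Sum.inl e))
        (fun e => by have := hk.1 (Sum.inl e); simp only [Leg.link, Sum.elim_inl, id] at this; omega)
      funext l
      rcases l with e | e
      · exact congrFun this e
      · rw [hk.2 e]; exact congrFun this e
    · intro k hk
      simp only [Fintype.mem_piFinset, Finset.mem_range] at hk
      exact flipFirst_flipFirst (fun e => by have := hk e; omega)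
    · intro k hk
      simp only [Finset.mem_filter, Fintype.mem_piFinset, Finset.mem_range] at hk
      have hl : ∀ e, (k (Sum.inl e) : ℤ) ≤ J e := fun e => by
        have := hk.1 (Sum.inl e); simp only [Leg.link, Sum.elim_inl, id] at this; omega
      rw [if_pos (fun e => by simp [hk.2 e, Leg.link])]
      have f : ∀ e : Fin 6, e < 3 → (flipFirst J (fun e => k (Sum.inl e)) e : ℤ) =
          J e - k (Sum.inl e) := fun e he => by
        have := hl e
        rw [flipFirst, if_pos he]; omega
      have f' : ∀ e : Fin 6, ¬ e < 3 → flipFirst J (fun e => k (Sum.inl e)) e =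
          k (Sum.inl e) := fun e he => by
        rw [flipFirst, if_neg he]
      simp only [hk.2, Leg.link, Sum.elim_inl, Sum.elim_inr, id, Fin.sum_univ_six]
      rw [f 0 (by decide), f 1 (by decide), f 2 (by decide), f' 3 (by decide), f' 4 (by decide),
        f' 5 (by decide)]
      generalize hx : (k (Sum.inl 0) : ℤ) = x
      generalize hy : (k (Sum.inl 1) : ℤ) = y
      generalize hz : (k (Sum.inl 2) : ℤ) = z
      rw [threeJ_rotate (J 2) (J 3) (J 4), threeJ_rotate (J 1) (J 5) (J 3),
        threeJ_rotate (J 5) (J 3) (J 1)]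
      rw [show -(2 * (J 0 - x) - J 0) = 2 * x - J 0 by ring,
        show -(2 * (J 1 - y) - J 1) = 2 * y - J 1 by ring,
        show -(2 * (J 2 - z) - J 2) = 2 * z - J 2 by ring,
        show 2 * (J 0 - x) - J 0 = -(2 * x - J 0) by ring,
        show 2 * (J 1 - y) - J 1 = -(2 * y - J 1) by ring,
        show 2 * (J 2 - z) - J 2 = -(2 * z - J 2) by ring]
      congr 1
      -- The reversal changes the phase by the sum of the magnetic numbers at the first vertex,
      -- which is zero wherever the summand is not.
      by_cases hs : 2 * x - J 0 + (2 * y - J 1) + (2 * z - J 2) = 0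
      · rw [phase_congr (m := J 0 - x + (J 1 - y) + (J 2 - z) + (J 3 - _) + (J 4 - _) + (J 5 - _))
          (n := J 0 - (J 0 - x) + (J 1 - (J 1 - y)) + (J 2 - (J 2 - z)) +
            (J 3 - k (Sum.inl 3)) + (J 4 - k (Sum.inl 4)) + (J 5 - k (Sum.inl 5)))]
        · ring
        · exact ⟨0, by linear_combination -hs⟩
      · rw [threeJ_eq_zero_of_sum hs]
        simp
  · refine Finset.sum_eq_zero fun k hk => ?_
    simp only [Finset.mem_filter] at hk
    refine if_neg fun h => hk.2 fun e => ?_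
    have := congrFun (h e) 1
    simpa using this

/-! ### The coefficients -/

lemma Triad.nonneg {a b c : ℤ} (h : Triad a b c) : 0 ≤ a ∧ 0 ≤ b ∧ 0 ≤ c := by
  obtain ⟨-, h1, h2, h3⟩ := h
  omega

lemma Triad.swap {a b c : ℤ} (h : Triad a b c) : Triad b a c := by
  obtain ⟨⟨s, hs⟩, h1, h2, h3⟩ := h
  exact ⟨⟨s, by omega⟩, by omega, by omega, by omega⟩

lemma Triad.rotate {a b c : ℤ} (h : Triad a b c) : Triad c a b := by
  obtain ⟨⟨s, hs⟩, h1, h2, h3⟩ := h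
  exact ⟨⟨s, by omega⟩, by omega, by omega, by omega⟩

lemma spin_factor_nonneg {a b c : ℤ} (h : a ≤ b + c) : 0 ≤ -spin a + spin b + spin c := by
  have : (a : ℝ) ≤ b + c := by exact_mod_cast h
  simp only [spin]; linarith

lemma phase_one : phase 1 = -1 := by simp [phase]

/-- If `j₂` or `j₆` is zero, the symbol contains a negative spin and vanishes; the right side agrees
because of the convention `0⁻¹ = 0`. -/
lemma sixJ_lower_lower_eq {J₂ J₄ J₆ : ℤ} (h : Triad J₂ J₆ J₄) :
    sixJ J₂ (J₂ - 1) 1 (J₆ - 1) J₆ J₄ = phase ((J₂ + J₄ + J₆) / 2) *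
      √((spin J₂ + spin J₆ - spin J₄) * (spin J₂ + spin J₆ + spin J₄ + 1)) *
      ((√((J₂ : ℝ) * (J₂ + 1)))⁻¹ * (√((J₆ : ℝ) * (J₆ + 1)))⁻¹) := by
  obtain ⟨h2, h6, -⟩ := h.nonneg
  rcases h2.eq_or_lt with rfl | h2
  · rw [sixJ_eq_zero_of_neg (by norm_num)]; simp
  rcases h6.eq_or_lt with rfl | h6
  · rw [sixJ_eq_zero_of_neg (by norm_num)]; simp
  rw [sixJ_rows_swap, sixJ_lower_lower h h6 h2, show J₆ + J₂ + J₄ = J₂ + J₄ + J₆ by ring]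
  ring

lemma overall_eq {J₂ J₄ J₆ : ℤ} (h : Triad J₂ J₆ J₄) :
    overall J₂ J₄ J₆ = -√((spin J₂ + spin J₆ - spin J₄) * (spin J₂ + spin J₆ + spin J₄ + 1)) *
      (√((J₂ : ℝ) * (J₂ + 1)) * √((J₆ : ℝ) * (J₆ + 1))) := by
  obtain ⟨h2, h6, -⟩ := h.nonneg
  have h2' : (0 : ℝ) ≤ J₂ := by exact_mod_cast h2
  have h6' : (0 : ℝ) ≤ J₆ := by exact_mod_cast h6
  have e : ∀ x : ℝ, 0 ≤ x → x * (√x)⁻¹ = √x := fun x hx => by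
    rw [← div_eq_mul_inv, Real.div_sqrt]
  have e2 := e (J₂ * (J₂ + 1)) (by positivity)
  have e6 := e (J₆ * (J₆ + 1)) (by positivity)
  have hp := phase_mul_self ((J₂ + J₄ + J₆) / 2)
  rw [overall, sixJ_lower_lower_eq h, phase_add, phase_one]
  simp only [dim]
  push_cast
  generalize √((J₂ : ℝ) * (J₂ + 1)) = r at *
  generalize √((J₆ : ℝ) * (J₆ + 1)) = s at *
  generalize √((spin J₂ + spin J₆ - spin J₄) * (spin J₂ + spin J₆ + spin J₄ + 1)) = w
  generalize r⁻¹ = r' at *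
  generalize s⁻¹ = s' at *
  rw [← e2, ← e6]
  linear_combination (-w * (J₂ * (J₂ + 1) * r' * (J₆ * (J₆ + 1) * s'))) * hp

lemma coeffA0_eq {J₂ J₄ J₆ : ℤ} (h : Triad J₂ J₆ J₄) :
    coeffA0 (-1) (-1) J₂ J₄ J₆ =
      -√((spin J₂ + spin J₆ - spin J₄) * (spin J₂ + spin J₆ + spin J₄ + 1)) *
      ((√((J₂ : ℝ) * (J₂ + 1)))⁻¹ * (√((J₆ : ℝ) * (J₆ + 1)))⁻¹) := by
  have hp := phase_mul_self ((J₂ + J₄ + J₆) / 2)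
  rw [coeffA0, ← sub_eq_add_neg, ← sub_eq_add_neg, sixJ_lower_lower_eq h, phase_add, phase_one]
  linear_combination (-√((spin J₂ + spin J₆ - spin J₄) * (spin J₂ + spin J₆ + spin J₄ + 1)) *
      ((√((J₂ : ℝ) * (J₂ + 1)))⁻¹ * (√((J₆ : ℝ) * (J₆ + 1)))⁻¹)) * hp

lemma phase_coeffA {J₁ J₂ J₃ J₅ J₆ : ℤ} (h : Triad J₁ J₂ J₃) (h' : Triad J₁ J₅ J₆) :
    phase ((2 * J₁ + J₂ + J₃ + J₅ + J₆) / 2) =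
      phase ((J₁ + J₂ + J₃) / 2) * phase ((J₁ + J₆ + J₅) / 2) := by
  obtain ⟨⟨s, hs⟩, -⟩ := h
  obtain ⟨⟨t, ht⟩, -⟩ := h'
  rw [← phase_add]
  congr 1
  omega

/-- Both 6j-symbols contain `1/√((J₁ + 1)(J₁ + 2))`; the square of this factor times `d_{j₁+1/2} =
J₁ + 2` is `1/d_{j₁}`. All phases occur twice. -/
lemma coeffA_up_eq {J₁ J₂ J₃ J₅ J₆ : ℤ} (h : Triad J₁ J₂ J₃) (h' : Triad J₁ J₅ J₆) :
    coeffA (-1) (-1) 1 J₁ J₂ J₃ J₅ J₆ =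
      √((-spin J₁ + spin J₂ + spin J₃) * (spin J₁ - spin J₂ + spin J₃ + 1)) *
        √((-spin J₁ + spin J₅ + spin J₆) * (spin J₁ + spin J₅ - spin J₆ + 1)) / dim J₁ *
      ((√((J₂ : ℝ) * (J₂ + 1)))⁻¹ * (√((J₆ : ℝ) * (J₆ + 1)))⁻¹) := by
  obtain ⟨h1, h2, h3⟩ := h.nonneg
  obtain ⟨-, h5, h6⟩ := h'.nonneg
  have h1' : (0 : ℝ) ≤ J₁ := by exact_mod_cast h1
  simp only [coeffA, ← sub_eq_add_neg]
  rcases h2.eq_or_lt with rfl | h2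
  · rw [sixJ_eq_zero_of_neg (by norm_num)]; simp
  rcases h6.eq_or_lt with rfl | h6
  · rw [sixJ_eq_zero_of_neg (a := J₁ + 1) (d := 0) (by norm_num)]; simp
  have t1 := h.swap
  have t2 := h'.rotate
  rw [sixJ_raise_lower t1 h2, sixJ_raise_lower t2 h6]
  rw [show (2 * J₁ + J₂ + J₃ + J₅ + J₆) / 2 + (1 + 1) / 2 + (-1 - 1) / 2 =
    (2 * J₁ + J₂ + J₃ + J₅ + J₆) / 2 by norm_num, phase_coeffA h h']
  have p1 := phase_mul_self ((J₁ + J₂ + J₃) / 2)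
  have p2 := phase_mul_self ((J₁ + J₆ + J₅) / 2)
  have hq : (√(((J₁ : ℝ) + 1) * (J₁ + 2)))⁻¹ * (√(((J₁ : ℝ) + 1) * (J₁ + 2)))⁻¹ =
      1 / ((J₁ + 1) * (J₁ + 2)) := by
    rw [← mul_inv, Real.mul_self_sqrt (by positivity), one_div]
  have hd : dim (J₁ + 1) * (1 / (((J₁ : ℝ) + 1) * (J₁ + 2))) = 1 / dim J₁ := by
    simp only [dim]
    push_cast
    have : (J₁ : ℝ) + 1 ≠ 0 := by positivity
    have : (J₁ : ℝ) + 2 ≠ 0 := by positivity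
    have : (J₁ : ℝ) + 1 + 1 ≠ 0 := by positivity
    field_simp
    ring
  rw [show (spin J₂ - spin J₁ + spin J₃) * (-spin J₂ + spin J₁ + spin J₃ + 1) =
      (-spin J₁ + spin J₂ + spin J₃) * (spin J₁ - spin J₂ + spin J₃ + 1) by ring,
    show (spin J₆ - spin J₁ + spin J₅) * (-spin J₆ + spin J₁ + spin J₅ + 1) =
      (-spin J₁ + spin J₅ + spin J₆) * (spin J₁ + spin J₅ - spin J₆ + 1) by ring]
  generalize √((-spin J₁ + spin J₂ + spin J₃) * (spin J₁ - spin J₂ + spin J₃ + 1)) = u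
  generalize √((-spin J₁ + spin J₅ + spin J₆) * (spin J₁ + spin J₅ - spin J₆ + 1)) = v
  generalize √(((J₁ : ℝ) + 1) * (J₁ + 2)) = q at *
  generalize phase ((J₁ + J₂ + J₃) / 2) = x at *
  generalize phase ((J₁ + J₆ + J₅) / 2) = y at *
  generalize (√((J₂ : ℝ) * (J₂ + 1)))⁻¹ = r
  generalize (√((J₆ : ℝ) * (J₆ + 1)))⁻¹ = s
  calc _ = (x * x) * (y * y) * (dim (J₁ + 1) * (q⁻¹ * q⁻¹)) * (u * v * (r * s)) := by ring
    _ = _ := by rw [p1, p2, hq, hd]; ring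

lemma coeffA_down_eq {J₁ J₂ J₃ J₅ J₆ : ℤ} (h : Triad J₁ J₂ J₃) (h' : Triad J₁ J₅ J₆) :
    coeffA (-1) (-1) (-1) J₁ J₂ J₃ J₅ J₆ =
      -(√((spin J₁ + spin J₂ - spin J₃) * (spin J₁ + spin J₂ + spin J₃ + 1)) *
        √((spin J₁ + spin J₆ - spin J₅) * (spin J₁ + spin J₅ + spin J₆ + 1)) / dim J₁) *
      ((√((J₂ : ℝ) * (J₂ + 1)))⁻¹ * (√((J₆ : ℝ) * (J₆ + 1)))⁻¹) := by
  obtain ⟨h1, h2, h3⟩ := h.nonneg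
  obtain ⟨-, h5, h6⟩ := h'.nonneg
  simp only [coeffA, ← sub_eq_add_neg]
  rcases h1.eq_or_lt with rfl | h1
  -- For `j₁ = 0` the left side has the factor `d_{-1/2} = 0`, the right side `j₁ + j₂ - j₃ = 0`.
  · have : J₂ = J₃ := by obtain ⟨-, t1, t2, t3⟩ := h; omega
    subst this
    simp [dim, spin]
  rcases h2.eq_or_lt with rfl | h2
  · rw [sixJ_eq_zero_of_neg (by norm_num)]; simp
  rcases h6.eq_or_lt with rfl | h6
  · rw [sixJ_eq_zero_of_neg (a := J₁ - 1) (d := 0) (by norm_num)]; simp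
  have h1' : (0 : ℝ) < J₁ := by exact_mod_cast h1
  have t1 := h.swap
  have t2 := h'.rotate
  rw [sixJ_lower_lower t1 h1 h2, sixJ_lower_lower t2 h1 h6]
  rw [show (2 * J₁ + J₂ + J₃ + J₅ + J₆) / 2 + (-1 + 1) / 2 + (-1 - 1) / 2 =
    (2 * J₁ + J₂ + J₃ + J₅ + J₆) / 2 + -1 by norm_num, phase_add, phase_coeffA h h',
    show phase (-1) = -1 by simp [phase]]
  have p1 := phase_mul_self ((J₁ + J₂ + J₃) / 2)
  have p2 := phase_mul_self ((J₁ + J₆ + J₅) / 2)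
  have hq : (√((J₁ : ℝ) * (J₁ + 1)))⁻¹ * (√((J₁ : ℝ) * (J₁ + 1)))⁻¹ =
      1 / (J₁ * (J₁ + 1)) := by
    rw [← mul_inv, Real.mul_self_sqrt (by positivity), one_div]
  have hd : dim (J₁ - 1) * (1 / ((J₁ : ℝ) * (J₁ + 1))) = 1 / dim J₁ := by
    simp only [dim]
    push_cast
    have : (J₁ : ℝ) + 1 ≠ 0 := by positivity
    field_simp
    ring
  rw [show (spin J₂ + spin J₁ - spin J₃) * (spin J₂ + spin J₁ + spin J₃ + 1) =
      (spin J₁ + spin J₂ - spin J₃) * (spin J₁ + spin J₂ + spin J₃ + 1) by ring,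
    show (spin J₆ + spin J₁ - spin J₅) * (spin J₆ + spin J₁ + spin J₅ + 1) =
      (spin J₁ + spin J₆ - spin J₅) * (spin J₁ + spin J₅ + spin J₆ + 1) by ring]
  generalize √((spin J₁ + spin J₂ - spin J₃) * (spin J₁ + spin J₂ + spin J₃ + 1)) = u
  generalize √((spin J₁ + spin J₆ - spin J₅) * (spin J₁ + spin J₅ + spin J₆ + 1)) = v
  generalize √((J₁ : ℝ) * (J₁ + 1)) = q at *
  generalize phase ((J₁ + J₂ + J₃) / 2) = x at *
  generalize phase ((J₁ + J₆ + J₅) / 2) = y at *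
  generalize (√((J₂ : ℝ) * (J₂ + 1)))⁻¹ = r
  generalize (√((J₆ : ℝ) * (J₆ + 1)))⁻¹ = s
  calc _ = -((x * x) * (y * y) * (dim (J₁ - 1) * (q⁻¹ * q⁻¹)) * (u * v * (r * s))) := by ring
    _ = _ := by rw [p1, p2, hq, hd]; ring

/-- The weights cancel, also where they vanish, since then `w = 0`. -/
lemma lowerWeight_mul_cancel {J₂ J₄ J₆ : ℤ} (h : Triad J₂ J₆ J₄) :
    √((spin J₂ + spin J₆ - spin J₄) * (spin J₂ + spin J₆ + spin J₄ + 1)) *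
      ((√((J₂ : ℝ) * (J₂ + 1)) * √((J₆ : ℝ) * (J₆ + 1))) *
        ((√((J₂ : ℝ) * (J₂ + 1)))⁻¹ * (√((J₆ : ℝ) * (J₆ + 1)))⁻¹)) =
    √((spin J₂ + spin J₆ - spin J₄) * (spin J₂ + spin J₆ + spin J₄ + 1)) := by
  obtain ⟨h2, h6, -⟩ := h.nonneg
  rcases h2.eq_or_lt with rfl | h2
  · have : J₆ = J₄ := by obtain ⟨-, t1, t2, t3⟩ := h; omega
    subst this; simp [spin]
  rcases h6.eq_or_lt with rfl | h6
  · have : J₂ = J₄ := by obtain ⟨-, t1, t2, t3⟩ := h; omega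
    subst this; simp [spin]
  have h2' : (0 : ℝ) < J₂ := by exact_mod_cast h2
  have h6' : (0 : ℝ) < J₆ := by exact_mod_cast h6
  have e2 : √((J₂ : ℝ) * (J₂ + 1)) ≠ 0 := (Real.sqrt_pos.2 (by positivity)).ne'
  have e6 : √((J₆ : ℝ) * (J₆ + 1)) ≠ 0 := (Real.sqrt_pos.2 (by positivity)).ne'
  generalize √((J₂ : ℝ) * (J₂ + 1)) = r at *
  generalize √((J₆ : ℝ) * (J₆ + 1)) = s at *
  field_simp

lemma overall_mul_coeffA_up {J₁ J₂ J₃ J₄ J₅ J₆ : ℤ}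
    (h₁₂₃ : Triad J₁ J₂ J₃) (h₁₅₆ : Triad J₁ J₅ J₆) (h₂₆₄ : Triad J₂ J₆ J₄) :
    overall J₂ J₄ J₆ * coeffA (-1) (-1) 1 J₁ J₂ J₃ J₅ J₆ =
      -√((spin J₂ + spin J₆ - spin J₄) * (spin J₂ + spin J₆ + spin J₄ + 1)) *
        (√((-spin J₁ + spin J₂ + spin J₃) * (spin J₁ - spin J₂ + spin J₃ + 1)) *
        √((-spin J₁ + spin J₅ + spin J₆) * (spin J₁ + spin J₅ - spin J₆ + 1)) / dim J₁) := by
  rw [overall_eq h₂₆₄, coeffA_up_eq h₁₂₃ h₁₅₆]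
  linear_combination (-(√((-spin J₁ + spin J₂ + spin J₃) * (spin J₁ - spin J₂ + spin J₃ + 1)) *
    √((-spin J₁ + spin J₅ + spin J₆) * (spin J₁ + spin J₅ - spin J₆ + 1)) / dim J₁)) *
    lowerWeight_mul_cancel h₂₆₄

lemma overall_mul_coeffA0 {J₂ J₄ J₆ : ℤ} (h₂₆₄ : Triad J₂ J₆ J₄) :
    overall J₂ J₄ J₆ * coeffA0 (-1) (-1) J₂ J₄ J₆ =
      √((spin J₂ + spin J₆ - spin J₄) * (spin J₂ + spin J₆ + spin J₄ + 1)) *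
      √((spin J₂ + spin J₆ - spin J₄) * (spin J₂ + spin J₆ + spin J₄ + 1)) := by
  rw [overall_eq h₂₆₄, coeffA0_eq h₂₆₄]
  linear_combination √((spin J₂ + spin J₆ - spin J₄) * (spin J₂ + spin J₆ + spin J₄ + 1)) *
    lowerWeight_mul_cancel h₂₆₄

lemma overall_mul_coeffA_down {J₁ J₂ J₃ J₄ J₅ J₆ : ℤ}
    (h₁₂₃ : Triad J₁ J₂ J₃) (h₁₅₆ : Triad J₁ J₅ J₆) (h₂₆₄ : Triad J₂ J₆ J₄) :
    overall J₂ J₄ J₆ * coeffA (-1) (-1) (-1) J₁ J₂ J₃ J₅ J₆ =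
      √((spin J₂ + spin J₆ - spin J₄) * (spin J₂ + spin J₆ + spin J₄ + 1)) *
        (√((spin J₁ + spin J₂ - spin J₃) * (spin J₁ + spin J₂ + spin J₃ + 1)) *
        √((spin J₁ + spin J₆ - spin J₅) * (spin J₁ + spin J₅ + spin J₆ + 1)) / dim J₁) := by
  rw [overall_eq h₂₆₄, coeffA_down_eq h₁₂₃ h₁₅₆]
  linear_combination (√((spin J₁ + spin J₂ - spin J₃) * (spin J₁ + spin J₂ + spin J₃ + 1)) *
    √((spin J₁ + spin J₆ - spin J₅) * (spin J₁ + spin J₅ + spin J₆ + 1)) / dim J₁) *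
    lowerWeight_mul_cancel h₂₆₄

/-- The expansion of the Hamiltonian into spin network functions. -/
lemma hamR_tetState {J₁ J₂ J₃ J₄ J₅ J₆ : ℤ}
    (h₁₂₃ : Triad J₁ J₂ J₃) (h₁₅₆ : Triad J₁ J₅ J₆) (h₂₆₄ : Triad J₂ J₆ J₄)
    (g : Fin 6 → SU2) :
    hamR (tetState ![J₁, J₂, J₃, J₄, J₅, J₆]) g = (overall J₂ J₄ J₆ : ℂ) *
      ((coeffA (-1) (-1) 1 J₁ J₂ J₃ J₅ J₆ : ℂ) * sTet (J₁ + 1) (J₂ - 1) J₃ J₄ J₅ (J₆ - 1) g +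
        (coeffA0 (-1) (-1) J₂ J₄ J₆ : ℂ) * sTet J₁ J₂ J₃ J₄ J₅ J₆ g +
        (coeffA (-1) (-1) (-1) J₁ J₂ J₃ J₅ J₆ : ℂ) *
          sTet (J₁ - 1) (J₂ - 1) J₃ J₄ J₅ (J₆ - 1) g) := by
  rw [hamR_eq_eval_graspR, graspR_tetState h₁₂₃ h₁₅₆ h₂₆₄, eval_add, eval_add, eval_smul,
    eval_smul, eval_smul, ← overall_mul_coeffA_up h₁₂₃ h₁₅₆ h₂₆₄, ← overall_mul_coeffA0 h₂₆₄,
    ← overall_mul_coeffA_down h₁₂₃ h₁₅₆ h₂₆₄]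
  simp only [sTet]
  push_cast
  ring

lemma sTet_one (J₁ J₂ J₃ J₄ J₅ J₆ : ℤ) :
    sTet J₁ J₂ J₃ J₄ J₅ J₆ 1 = (sixJ J₁ J₂ J₃ J₄ J₅ J₆ : ℂ) :=
  eval_tetState_one _

lemma hamR_tetState_one {J₁ J₂ J₃ J₄ J₅ J₆ : ℤ}
    (h₁₂₃ : Triad J₁ J₂ J₃) (h₁₅₆ : Triad J₁ J₅ J₆) (h₂₆₄ : Triad J₂ J₆ J₄) :
    hamR (tetState ![J₁, J₂, J₃, J₄, J₅, J₆]) 1 = ((overall J₂ J₄ J₆ *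
      (coeffA (-1) (-1) 1 J₁ J₂ J₃ J₅ J₆ * sixJ (J₁ + 1) (J₂ - 1) J₃ J₄ J₅ (J₆ - 1) +
        coeffA0 (-1) (-1) J₂ J₄ J₆ * sixJ J₁ J₂ J₃ J₄ J₅ J₆ +
        coeffA (-1) (-1) (-1) J₁ J₂ J₃ J₅ J₆ *
          sixJ (J₁ - 1) (J₂ - 1) J₃ J₄ J₅ (J₆ - 1)) : ℝ) : ℂ) := by
  rw [hamR_tetState h₁₂₃ h₁₅₆ h₂₆₄, sTet_one, sTet_one, sTet_one]
  push_cast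
  ring

/-- The recursion relation of the 6j-symbols. -/
lemma sixJ_recursion {J₁ J₂ J₃ J₄ J₅ J₆ : ℤ}
    (h₁₂₃ : Triad J₁ J₂ J₃) (h₁₅₆ : Triad J₁ J₅ J₆) (h₂₆₄ : Triad J₂ J₆ J₄) :
    √((-spin J₁ + spin J₂ + spin J₃) * (spin J₁ - spin J₂ + spin J₃ + 1)) *
        √((-spin J₁ + spin J₅ + spin J₆) * (spin J₁ + spin J₅ - spin J₆ + 1)) *
        sixJ (J₁ + 1) (J₂ - 1) J₃ J₄ J₅ (J₆ - 1) -
      dim J₁ * √((spin J₂ + spin J₆ - spin J₄) * (spin J₂ + spin J₆ + spin J₄ + 1)) *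
        sixJ J₁ J₂ J₃ J₄ J₅ J₆ -
      √((spin J₁ + spin J₂ - spin J₃) * (spin J₁ + spin J₂ + spin J₃ + 1)) *
        √((spin J₁ + spin J₆ - spin J₅) * (spin J₁ + spin J₅ + spin J₆ + 1)) *
        sixJ (J₁ - 1) (J₂ - 1) J₃ J₄ J₅ (J₆ - 1) = 0 := by
  have h := (hamR_tetState_one h₁₂₃ h₁₅₆ h₂₆₄).symm.trans (hamR_one _)
  have h1 : (0 : ℝ) ≤ J₁ := by exact_mod_cast h₁₂₃.nonneg.1
  have hd : dim J₁ ≠ 0 := by unfold dim; positivity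
  rw [Complex.ofReal_eq_zero, mul_add, mul_add, ← mul_assoc, ← mul_assoc, ← mul_assoc,
    overall_mul_coeffA_up h₁₂₃ h₁₅₆ h₂₆₄, overall_mul_coeffA0 h₂₆₄,
    overall_mul_coeffA_down h₁₂₃ h₁₅₆ h₂₆₄] at h
  -- The common weight `w` of the three terms vanishes exactly here and cannot be cancelled; then
  -- the triangle inequality kills the shifted symbols.
  by_cases hJ : J₄ = J₂ + J₆
  · have hT : ∀ x, sixJ x (J₂ - 1) J₃ J₄ J₅ (J₆ - 1) = 0 := fun x =>
      sixJ_eq_zero_of_triad fun ht => by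
        have := ht.2.2.1.2.1
        omega
    have hs : spin J₂ + spin J₆ - spin J₄ = 0 := by
      rw [hJ]; simp only [spin]; push_cast; ring
    rw [hT, hT, hs]
    simp
  · have hw : √((spin J₂ + spin J₆ - spin J₄) * (spin J₂ + spin J₆ + spin J₄ + 1)) ≠ 0 := by
      obtain ⟨n2, n6, n4⟩ := h₂₆₄.nonneg
      have n2 : (0 : ℝ) ≤ J₂ := by exact_mod_cast n2
      have n6 : (0 : ℝ) ≤ J₆ := by exact_mod_cast n6
      have n4 : (0 : ℝ) ≤ J₄ := by exact_mod_cast n4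
      have h4 : (J₄ : ℝ) < J₂ + J₆ := by
        exact_mod_cast lt_of_le_of_ne h₂₆₄.2.2.2 hJ
      refine (Real.sqrt_pos.2 (mul_pos ?_ ?_)).ne' <;> simp only [spin] <;> linarith
    refine (mul_eq_zero.1 ?_).resolve_left hw
    field_simp at h
    linear_combination -h

/-- Deduced from the explicit recursion rather than by cancelling `overall`, which may be zero: the
coefficients are those of the recursion times a common factor. -/
lemma coeff_sixJ_eq_zero {J₁ J₂ J₃ J₄ J₅ J₆ : ℤ}
    (h₁₂₃ : Triad J₁ J₂ J₃) (h₁₅₆ : Triad J₁ J₅ J₆) (h₂₆₄ : Triad J₂ J₆ J₄) :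
    coeffA (-1) (-1) 1 J₁ J₂ J₃ J₅ J₆ * sixJ (J₁ + 1) (J₂ - 1) J₃ J₄ J₅ (J₆ - 1) +
      coeffA0 (-1) (-1) J₂ J₄ J₆ * sixJ J₁ J₂ J₃ J₄ J₅ J₆ +
      coeffA (-1) (-1) (-1) J₁ J₂ J₃ J₅ J₆ *
        sixJ (J₁ - 1) (J₂ - 1) J₃ J₄ J₅ (J₆ - 1) = 0 := by
  have h1 : (0 : ℝ) ≤ J₁ := by exact_mod_cast h₁₂₃.nonneg.1
  have hd : dim J₁ * (dim J₁)⁻¹ = 1 := mul_inv_cancel₀ (by unfold dim; positivity)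
  rw [coeffA_up_eq h₁₂₃ h₁₅₆, coeffA0_eq h₂₆₄, coeffA_down_eq h₁₂₃ h₁₅₆]
  have h := sixJ_recursion h₁₂₃ h₁₅₆ h₂₆₄
  generalize √((J₂ : ℝ) * (J₂ + 1)) = r
  generalize √((J₆ : ℝ) * (J₆ + 1)) = s
  linear_combination ((dim J₁)⁻¹ * (r⁻¹ * s⁻¹)) * h +
    (√((spin J₂ + spin J₆ - spin J₄) * (spin J₂ + spin J₆ + spin J₄ + 1)) *
      sixJ J₁ J₂ J₃ J₄ J₅ J₆ * (r⁻¹ * s⁻¹)) * hd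

end SpinNet

end

theorem mainTheorem2 (J₁ J₂ J₃ J₄ J₅ J₆ : ℤ)
    (h₁₂₃ : SpinNet.Triad J₁ J₂ J₃) (h₁₅₆ : SpinNet.Triad J₁ J₅ J₆)
    (h₃₄₅ : SpinNet.Triad J₃ J₄ J₅) (h₂₆₄ : SpinNet.Triad J₂ J₆ J₄) :
    -- the operator is a sum of spin-1/2 graspings
    (∀ g : Fin 6 → SpinNet.SU2,
      SpinNet.hamR (SpinNet.tetState ![J₁, J₂, J₃, J₄, J₅, J₆]) g =
        SpinNet.eval (SpinNet.graspR (SpinNet.tetState ![J₁, J₂, J₃, J₄, J₅, J₆])) g) ∧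
    -- expansion into spin network functions
    (∀ g : Fin 6 → SpinNet.SU2,
      SpinNet.hamR (SpinNet.tetState ![J₁, J₂, J₃, J₄, J₅, J₆]) g =
        (SpinNet.overall J₂ J₄ J₆ : ℂ) *
          ((SpinNet.coeffA (-1) (-1) 1 J₁ J₂ J₃ J₅ J₆ : ℂ) *
              SpinNet.sTet (J₁ + 1) (J₂ - 1) J₃ J₄ J₅ (J₆ - 1) g +
            (SpinNet.coeffA0 (-1) (-1) J₂ J₄ J₆ : ℂ) * SpinNet.sTet J₁ J₂ J₃ J₄ J₅ J₆ g +
            (SpinNet.coeffA (-1) (-1) (-1) J₁ J₂ J₃ J₅ J₆ : ℂ) *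
              SpinNet.sTet (J₁ - 1) (J₂ - 1) J₃ J₄ J₅ (J₆ - 1) g)) ∧
    -- its value at the identity, with the overall factor of the expansion
    SpinNet.hamR (SpinNet.tetState ![J₁, J₂, J₃, J₄, J₅, J₆]) 1 =
      ((SpinNet.overall J₂ J₄ J₆ *
        (SpinNet.coeffA (-1) (-1) 1 J₁ J₂ J₃ J₅ J₆ *
            SpinNet.sixJ (J₁ + 1) (J₂ - 1) J₃ J₄ J₅ (J₆ - 1) +
          SpinNet.coeffA0 (-1) (-1) J₂ J₄ J₆ * SpinNet.sixJ J₁ J₂ J₃ J₄ J₅ J₆ +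
          SpinNet.coeffA (-1) (-1) (-1) J₁ J₂ J₃ J₅ J₆ *
            SpinNet.sixJ (J₁ - 1) (J₂ - 1) J₃ J₄ J₅ (J₆ - 1)) : ℝ) : ℂ) ∧
    -- the same without the overall factor
    SpinNet.hamR (SpinNet.tetState ![J₁, J₂, J₃, J₄, J₅, J₆]) 1 =
      ((SpinNet.coeffA (-1) (-1) 1 J₁ J₂ J₃ J₅ J₆ *
            SpinNet.sixJ (J₁ + 1) (J₂ - 1) J₃ J₄ J₅ (J₆ - 1) +
          SpinNet.coeffA0 (-1) (-1) J₂ J₄ J₆ * SpinNet.sixJ J₁ J₂ J₃ J₄ J₅ J₆ +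
          SpinNet.coeffA (-1) (-1) (-1) J₁ J₂ J₃ J₅ J₆ *
            SpinNet.sixJ (J₁ - 1) (J₂ - 1) J₃ J₄ J₅ (J₆ - 1) : ℝ) : ℂ) ∧
    -- vanishing, and the resulting recursion
    SpinNet.hamR (SpinNet.tetState ![J₁, J₂, J₃, J₄, J₅, J₆]) 1 = 0 ∧
    SpinNet.coeffA (-1) (-1) 1 J₁ J₂ J₃ J₅ J₆ *
          SpinNet.sixJ (J₁ + 1) (J₂ - 1) J₃ J₄ J₅ (J₆ - 1) +
        SpinNet.coeffA0 (-1) (-1) J₂ J₄ J₆ * SpinNet.sixJ J₁ J₂ J₃ J₄ J₅ J₆ +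
        SpinNet.coeffA (-1) (-1) (-1) J₁ J₂ J₃ J₅ J₆ *
          SpinNet.sixJ (J₁ - 1) (J₂ - 1) J₃ J₄ J₅ (J₆ - 1) = 0 ∧
    -- the recursion with explicit square roots
    √((-SpinNet.spin J₁ + SpinNet.spin J₅ + SpinNet.spin J₆) *
          (SpinNet.spin J₁ + SpinNet.spin J₅ - SpinNet.spin J₆ + 1) *
          (-SpinNet.spin J₁ + SpinNet.spin J₂ + SpinNet.spin J₃) *
          (SpinNet.spin J₁ - SpinNet.spin J₂ + SpinNet.spin J₃ + 1)) *
        SpinNet.sixJ (J₁ + 1) (J₂ - 1) J₃ J₄ J₅ (J₆ - 1) -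
      SpinNet.dim J₁ *
        √((SpinNet.spin J₂ + SpinNet.spin J₆ + SpinNet.spin J₄ + 1) *
          (SpinNet.spin J₂ + SpinNet.spin J₆ - SpinNet.spin J₄)) *
        SpinNet.sixJ J₁ J₂ J₃ J₄ J₅ J₆ -
      √((SpinNet.spin J₁ - SpinNet.spin J₅ + SpinNet.spin J₆) *
          (SpinNet.spin J₁ + SpinNet.spin J₅ + SpinNet.spin J₆ + 1) *
          (SpinNet.spin J₁ + SpinNet.spin J₂ - SpinNet.spin J₃) *
          (SpinNet.spin J₁ + SpinNet.spin J₂ + SpinNet.spin J₃ + 1)) *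
        SpinNet.sixJ (J₁ - 1) (J₂ - 1) J₃ J₄ J₅ (J₆ - 1) = 0 := by
  open SpinNet in
  refine ⟨fun g => hamR_eq_eval_graspR _ g, fun g => hamR_tetState h₁₂₃ h₁₅₆ h₂₆₄ g,
    hamR_tetState_one h₁₂₃ h₁₅₆ h₂₆₄, ?_, hamR_one _, coeff_sixJ_eq_zero h₁₂₃ h₁₅₆ h₂₆₄, ?_⟩
  · rw [SpinNet.coeff_sixJ_eq_zero h₁₂₃ h₁₅₆ h₂₆₄, SpinNet.hamR_one, Complex.ofReal_zero]
  -- Splitting the root of four factors into the roots of the two vertices requires nonnegativity of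
  -- one of the two products.
  · have hu : 0 ≤ (-SpinNet.spin J₁ + SpinNet.spin J₅ + SpinNet.spin J₆) *
        (SpinNet.spin J₁ + SpinNet.spin J₅ - SpinNet.spin J₆ + 1) :=
      mul_nonneg (SpinNet.spin_factor_nonneg h₁₅₆.2.1)
        (by linarith [SpinNet.spin_factor_nonneg h₁₅₆.2.2.2])
    have hv : 0 ≤ (SpinNet.spin J₁ - SpinNet.spin J₅ + SpinNet.spin J₆) *
        (SpinNet.spin J₁ + SpinNet.spin J₅ + SpinNet.spin J₆ + 1) :=
      mul_nonneg (by linarith [SpinNet.spin_factor_nonneg h₁₅₆.2.2.1])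
        (by linarith [SpinNet.spin_factor_nonneg h₁₅₆.2.1, SpinNet.spin_factor_nonneg h₁₅₆.2.2.1,
          SpinNet.spin_factor_nonneg h₁₅₆.2.2.2])
    rw [mul_assoc (_ * _) (_ : ℝ) (_ : ℝ), Real.sqrt_mul hu,
      mul_assoc ((SpinNet.spin J₁ - SpinNet.spin J₅ + SpinNet.spin J₆) * _), Real.sqrt_mul hv,
      mul_comm (SpinNet.spin J₂ + SpinNet.spin J₆ + SpinNet.spin J₄ + 1),
      show SpinNet.spin J₁ - SpinNet.spin J₅ + SpinNet.spin J₆ =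
        SpinNet.spin J₁ + SpinNet.spin J₆ - SpinNet.spin J₅ by ring]
    linear_combination SpinNet.sixJ_recursion h₁₂₃ h₁₅₆ h₂₆₄
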